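/- For $\beta>1$ let $T_\beta:[0,1)\to[0,1)$, $T_\beta(x)=\beta x-\lfloor\beta x\rfloor$. For $t\in[0,1)$ let $K_\beta(t)=\{x\in[0,1): T_\beta^n(x)\ge t\ \text{for all } n\ge 0\}$, and let $\mathscr{E}_\beta=\{t\in[0,1): K_\beta(t')\ne K_\beta(t)\ \text{for all } t'\in(t,1)\}$. Let $F_0=(0,1)$ and let the ordered list of words $F_{n+1}$ arise from $F_n$ by inserting between any two neighbours $\mathbf{u},\mathbf{v}$ their concatenation $\mathbf{u}\mathbf{v}$; let $\mathcal{F}=\bigcup_{n} F_n\setminus\{0,1\}$, and let $\mathcal{F}_e$ be the set of all words obtained from a word in $\mathcal{F}\cup\{1\}$ by adding the same integer $k\ge 0$ to each digit. For a word $\mathbf{s}$ let $\mathbb{L}(\mathbf{s})$ be its lexicographically largest cyclic permutation, and let $\mathbf{s}^+$ be $\mathbf{s}$ with its last digit increased by one. For a bounded sequence $(c_i)_{i\ge1}$ of non-negative integers put $((c_i))_\beta=\sum_{i\ge 1}c_i\beta^{-i}$. For $\mathbf{s}\in\mathcal{F}_e$ let $\beta_\ell^{\mathbf{s}},\beta_r^{\mathbf{s}}>1$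 be the unique bases with $(\mathbb{L}(\mathbf{s})^\infty)_{\beta_\ell^{\mathbf{s}}}=1$ and $(\mathbb{L}(\mathbf{s})^+\mathbf{s}^\infty)_{\beta_r^{\mathbf{s}}}=1$, and let $$E_L=\Big((1,\infty)\setminus\bigcup_{\mathbf{s}\in\mathcal{F}_e}[\beta_\ell^{\mathbf{s}},\beta_r^{\mathbf{s}}]\Big)\cup\{\beta_\ell^{\mathbf{s}}:\mathbf{s}\in\mathcal{F}_e\}.$$ Then the following hold. (i) For every $\beta>1$, $\mathscr{E}_\beta=\{t\in[0,1): T_\beta^n(t)\ge t\ \text{for all } n\ge 0\}$. (ii) For every $\beta>1$, $\mathscr{E}_\beta$ has Lebesgue measure zero and Hausdorff dimension $1$. (iii) For Lebesgue-almost every $\beta\in(1,\infty)$ and every $\delta>0$, the interval $(0,\delta)$ contains infinitely many isolated points of $\mathscr{E}_\beta$ and infinitely many points of $\mathscr{E}_\beta$ that are accumulation points of $\mathscr{E}_\beta$. (iv) The set $E_L$ is uncountable and has Hausdorff dimension $0$, and for every $\beta>1$ the set $\mathscr{E}_\beta$ has no isolated points if and only if $\beta\in E_L$. -/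

import Mathlib

open Set MeasureTheory Topology Filter

noncomputable section

namespace BetaBifurcation

/-! ### The beta-transformation, its survivor sets and its bifurcation set -/

/-- The `β`-transformation `x ↦ β x - ⌊β x⌋`; it maps `[0,1)` into itself. -/
def betaMap (β : ℝ) (x : ℝ) : ℝ := β * x - (⌊β * x⌋ : ℝ)

/-- The survivor set `K_β(t)`: points of `[0,1)` whose orbit never enters `[0,t)`. -/
def survivorSet (β t : ℝ) : Set ℝ :=
  {x | x ∈ Ico (0 : ℝ) 1 ∧ ∀ n : ℕ, t ≤ (betaMap β)^[n] x}

/-- The set-valued bifurcation set: the parameters `t ∈ [0,1)` such that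
`K_β(t') ≠ K_β(t)` for all parameters `t' ∈ [0,1)` with `t' > t`. -/
def bifurcationSet (β : ℝ) : Set ℝ :=
  {t | t ∈ Ico (0 : ℝ) 1 ∧
    ∀ t' ∈ Ico (0 : ℝ) 1, t < t' → survivorSet β t' ≠ survivorSet β t}

/-- The isolated points of a set of reals (they belong to the set). -/
def isolatedPoints (S : Set ℝ) : Set ℝ :=
  {t | t ∈ S ∧ ∃ U ∈ 𝓝 t, U ∩ S = {t}}

/-- The accumulation points of a set of reals which belong to the set. -/
def accumulationPoints (S : Set ℝ) : Set ℝ :=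
  {t | t ∈ S ∧ AccPt t (𝓟 S)}

/-! ### Finite words (lists of digits) and infinite sequences of digits -/

/-- The word `w⁺`: the last digit is increased by one. -/
def wordPlus (w : List ℕ) : List ℕ := w.dropLast ++ [w.getLastD 0 + 1]

/-- The lexicographically largest cyclic permutation `𝕃(w)` of the word `w`
(the order on lists is the lexicographic one). -/
def largestRotation (w : List ℕ) : List ℕ := w.cyclicPermutations.foldr max w

/-- The map `θ` which increases each digit of a word by one. -/
def incr (w : List ℕ) : List ℕ := w.map (· + 1)

/-- The periodic sequence `w^∞ = www⋯`. -/
def periodicSeq (w : List ℕ) : ℕ → ℕ := fun i => w.getD (i % w.length) 0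

/-- The sequence `u c₀ c₁ c₂ ⋯`, a finite word followed by an infinite sequence. -/
def prependWord (u : List ℕ) (c : ℕ → ℕ) : ℕ → ℕ :=
  fun i => if i < u.length then u.getD i 0 else c (i - u.length)

/-- The value `∑_{i ≥ 1} c_i / β^i` in base `β` (digits are numbered from `0` here, so the
digit number `i` has weight `β^{-(i+1)}`). The series converges for bounded digits and `β > 1`. -/
def baseValue (β : ℝ) (c : ℕ → ℕ) : ℝ := ∑' i : ℕ, (c i : ℝ) / β ^ (i + 1)

/-! ### Farey words and extended Farey words -/

/-- Insert between any two neighbours `u`, `v` of a list of words their concatenation `uv`. -/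
def fareyInsert : List (List ℕ) → List (List ℕ)
  | [] => []
  | [w] => [w]
  | u :: v :: l => u :: (u ++ v) :: fareyInsert (v :: l)

/-- The ordered sets `F_0 = (0, 1)`, `F_1 = (0, 01, 1)`, `F_2 = (0, 001, 01, 011, 1)`, … -/
def fareyList : ℕ → List (List ℕ)
  | 0 => [[0], [1]]
  | n + 1 => fareyInsert (fareyList n)

/-- The Farey words of length at least two. -/
def fareyWords : Set (List ℕ) := {w | (∃ n : ℕ, w ∈ fareyList n) ∧ w ≠ [0] ∧ w ≠ [1]}

/-- The extended Farey words: all `θ^k(w)`, where `k ≥ 0` and `w` is the word `1` or a Farey word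
of length at least two. -/
def extendedFareyWords : Set (List ℕ) :=
  {s | ∃ w ∈ insert [1] fareyWords, ∃ k : ℕ, s = incr^[k] w}

/-! ### Farey intervals and the set `E_L` -/

/-- `β` is the left endpoint of the interval of the word `s`: the number `β > 1` such that
`𝕃(s)^∞` has the value `1` in base `β`. -/
def IsLeftEnd (s : List ℕ) (β : ℝ) : Prop :=
  1 < β ∧ baseValue β (periodicSeq (largestRotation s)) = 1

/-- `β` is the right endpoint of the interval of the word `s`: the number `β > 1` such that
`𝕃(s)⁺ s^∞` has the value `1` in base `β`. -/
def IsRightEnd (s : List ℕ) (β : ℝ) : Prop :=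
  1 < β ∧ baseValue β (prependWord (wordPlus (largestRotation s)) (periodicSeq s)) = 1

/-- The closed interval `J^s` between the left and the right endpoint given by the word `s`. -/
def fareyInterval (s : List ℕ) : Set ℝ :=
  {β | ∃ a b : ℝ, IsLeftEnd s a ∧ IsRightEnd s b ∧ β ∈ Icc a b}

/-- The exceptional set `E`: the bases `β > 1` outside all Farey intervals. -/
def exceptionalSet : Set ℝ := Ioi 1 \ ⋃ s ∈ extendedFareyWords, fareyInterval s

/-- The set `E_L`: the exceptional set together with the left endpoints of all Farey intervals. -/
def exceptionalSetL : Set ℝ :=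
  exceptionalSet ∪ {β | ∃ s ∈ extendedFareyWords, IsLeftEnd s β}

end BetaBifurcation

end

namespace BetaBifurcation

/-! ### Elementary facts on the beta-transformation -/

/-! Write T for `betaMap β`. If some iterate carries t below t, it does so on a right neighbourhood
of t. The forward invariant set K(t) then misses that neighbourhood and does not change when t is
raised slightly. So the bifurcation set consists of the points minimal in their own orbit
(`bifurcationSet_eq_minimalPoints`), and everything is proved for `minimalPoints`.

Measure and dimension. Just below a minimal point x > 0 there is, at every small scale β^(-n), an
interval of proportional size which T^n maps into [0, x/2] and which contains no minimal point; by
the density theorem such a porous set is null. For the dimension, there are at least β^n/(n+1) full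
cylinders of rank n. All but two of them generate a self-similar set of dimension close to 1 whose
orbits stay away from 0, and division by a power of β turns its points into minimal points near 0.
Isolated points being countable, accumulation points also occur near 0.

Isolated points for typical bases. The minimum t of a periodic orbit is isolated if points to the
right of some orbit point p either drop below t after one period or keep moving away from p
(`mem_isolatedPoints_of_escape`). When the orbit of 1 first passes a low level and lands far below
it, lowering by one the last digit read from the expansion of 1 and repeating the block gives such
an orbit. That almost every base has infinitely many such passages is porosity again, now in the
space of bases: `defect` expresses the orbit of 1 as a function of the base with two-sided Lipschitz
control.

The set `exceptionalSetL`. Let V(γ) be the value in base β of the digits ⌈(n+1)γ⌉ - ⌈nγ⌉. By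
summation by parts, inequalities between partial sums give inequalities between values. Hence V is
strictly increasing and left continuous, with right limit W(γ) = `lowerValue β γ 0 + 1 / β`, and V =
W at irrational γ. So either V(γ) = 1 for some γ > 0, or V(γ) < 1 ≤ W(γ) for a rational γ
(`slope_dichotomy`). In the second case V(γ) is periodic and meets the escape criterion. In the
first case nothing is isolated: non-periodic minimal points are limits of periodic ones built from
Lyndon prefixes (`accPt_of_not_periodic`), while a periodic one lies below 1 - 1/β and is approached
from the right by points that shadow it and then jump to V(γ') with γ' slightly below γ.

Finally, extended Farey words are the Christoffel words of positive reduced fractions, and the ends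
of their intervals solve V = 1 and W = 1. Thus `exceptionalSetL` equals `rotationBases`. It is
uncountable because different slopes have different bases. It has dimension 0 because only
polynomially many prefixes of length n occur and each fixes the base up to an exponentially small
error. -/

/-- Points which are minimal in their orbit under the beta-transformation. -/
def minimalPoints (β : ℝ) : Set ℝ :=
  {t : ℝ | t ∈ Ico (0 : ℝ) 1 ∧ ∀ n : ℕ, t ≤ (betaMap β)^[n] t}

theorem betaMap_mem (β x : ℝ) : betaMap β x ∈ Ico (0 : ℝ) 1 :=
  ⟨Int.fract_nonneg _, Int.fract_lt_one _⟩

theorem iterate_betaMap_mem (β : ℝ) {x : ℝ} (hx : x ∈ Ico (0 : ℝ) 1) (n : ℕ) :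
    (betaMap β)^[n] x ∈ Ico (0 : ℝ) 1 := by
  cases n with
  | zero => exact hx
  | succ n => rw [Function.iterate_succ_apply']; exact betaMap_mem _ _

theorem betaMap_eq_of_mem {β x : ℝ} {k : ℤ} (h : β * x - k ∈ Ico (0 : ℝ) 1) :
    betaMap β x = β * x - k := by
  have : ⌊β * x⌋ = k := by
    rw [Int.floor_eq_iff]
    constructor <;> linarith [h.1, h.2]
  rw [betaMap, this]

/-- Shadowing: as long as the orbit of `x`, displaced by the expanding difference `y - x`, stays
in the unit interval, it is the orbit of `y`. -/
theorem iterate_betaMap_shadow {β x y : ℝ} {n : ℕ}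
    (h : ∀ i ≤ n, (betaMap β)^[i] x + β ^ i * (y - x) ∈ Ico (0 : ℝ) 1) :
    ∀ i ≤ n, (betaMap β)^[i] y = (betaMap β)^[i] x + β ^ i * (y - x) := by
  intro i
  induction i with
  | zero => intro _; simp
  | succ i ih =>
    intro hi
    have h1 := ih (by omega)
    have h2 := h (i + 1) hi
    rw [Function.iterate_succ_apply', Function.iterate_succ_apply'] at *
    rw [h1]
    have key : betaMap β ((betaMap β)^[i] x) + β ^ (i + 1) * (y - x) =
        β * ((betaMap β)^[i] x + β ^ i * (y - x)) - (⌊β * (betaMap β)^[i] x⌋ : ℝ) := by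
      simp only [betaMap]; ring
    rw [key] at h2 ⊢
    exact betaMap_eq_of_mem h2

theorem iterate_betaMap_le {β x : ℝ} (hβ : 0 ≤ β) (hx : x ∈ Ico (0 : ℝ) 1) (n : ℕ) :
    (betaMap β)^[n] x ≤ β ^ n * x := by
  induction n with
  | zero => simp
  | succ n ih =>
    rw [Function.iterate_succ_apply']
    have h0 : (0 : ℝ) ≤ ⌊β * (betaMap β)^[n] x⌋ := by
      exact_mod_cast Int.floor_nonneg.2 (mul_nonneg hβ (iterate_betaMap_mem β hx n).1)
    have := mul_le_mul_of_nonneg_left ih hβ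
    rw [betaMap, pow_succ]
    nlinarith

/-- Lowering a point within its cylinder of rank `n`. -/
theorem iterate_betaMap_lower {β x z : ℝ} {n : ℕ} (hβ : 1 < β) (hx : x ∈ Ico (0 : ℝ) 1)
    (hz0 : 0 ≤ z) (hz : z ≤ (betaMap β)^[n] x) {i : ℕ} (hi : i ≤ n) :
    0 ≤ (betaMap β)^[i] x - ((betaMap β)^[n] x - z) / β ^ (n - i) ∧
    (betaMap β)^[i] (x - ((betaMap β)^[n] x - z) / β ^ n) =
      (betaMap β)^[i] x - ((betaMap β)^[n] x - z) / β ^ (n - i) := by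
  have h0 : (0 : ℝ) < β := by linarith
  have e : ∀ j ≤ n, β ^ j * ((x - ((betaMap β)^[n] x - z) / β ^ n) - x) =
      - (((betaMap β)^[n] x - z) / β ^ (n - j)) := by
    intro j hj
    have : β ^ n = β ^ j * β ^ (n - j) := by rw [← pow_add]; congr 1; omega
    rw [this]; field_simp; ring
  have hnn : ∀ j ≤ n, 0 ≤ (betaMap β)^[j] x - ((betaMap β)^[n] x - z) / β ^ (n - j) := by
    intro j hj
    have h1 := iterate_betaMap_le h0.le (iterate_betaMap_mem β hx j) (n - j)
    rw [← Function.iterate_add_apply, show n - j + j = n by omega] at h1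
    have hp : 0 < β ^ (n - j) := by positivity
    rw [sub_nonneg, div_le_iff₀ hp]
    linarith
  refine ⟨hnn i hi, ?_⟩
  have := iterate_betaMap_shadow (β := β) (x := x)
    (y := x - ((betaMap β)^[n] x - z) / β ^ n) (n := n) (fun j hj => ?_) i hi
  · rw [this, e i hi]; ring
  · rw [e j hj]
    have h2 := hnn j hj
    have h3 : 0 ≤ ((betaMap β)^[n] x - z) / β ^ (n - j) :=
      div_nonneg (by linarith) (by positivity)
    exact ⟨by linarith, by linarith [(iterate_betaMap_mem β hx j).2]⟩

/-- The iterates of the beta-transformation are affine in a right neighbourhood of a point. -/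
theorem iterate_betaMap_right {β x : ℝ} (hβ : 1 < β) (hx : x ∈ Ico (0 : ℝ) 1) (n : ℕ) :
    ∃ ε > 0, ∀ y ∈ Ico x (x + ε), ∀ i ≤ n,
      (betaMap β)^[i] y = (betaMap β)^[i] x + β ^ i * (y - x) := by
  have h0 : (0 : ℝ) < β := by linarith
  obtain ⟨m, -, hm⟩ := Finset.exists_min_image (Finset.range (n + 1))
    (fun i => 1 - (betaMap β)^[i] x) ⟨0, by simp⟩
  have hpos : 0 < 1 - (betaMap β)^[m] x := by linarith [(iterate_betaMap_mem β hx m).2]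
  refine ⟨(1 - (betaMap β)^[m] x) / β ^ n, by positivity, fun y hy => ?_⟩
  apply iterate_betaMap_shadow
  intro i hi
  have h1 := hm i (Finset.mem_range.2 (by omega))
  have h2 : β ^ i * (y - x) ≤ β ^ n * (y - x) :=
    mul_le_mul_of_nonneg_right (pow_le_pow_right₀ hβ.le hi) (by linarith [hy.1])
  have h3 : β ^ n * (y - x) < 1 - (betaMap β)^[m] x := by
    rw [← lt_div_iff₀' (by positivity)]; linarith [hy.2]
  have h4 : 0 ≤ β ^ i * (y - x) := mul_nonneg (by positivity) (by linarith [hy.1])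
  have h5 := (iterate_betaMap_mem β hx i).1
  exact ⟨by linarith, by linarith⟩

theorem bifurcationSet_eq_minimalPoints {β : ℝ} (hβ : 1 < β) :
    bifurcationSet β = minimalPoints β := by
  ext t
  constructor
  · rintro ⟨ht, h⟩
    refine ⟨ht, fun N => ?_⟩
    by_contra! hN
    obtain ⟨ε, hε, hy⟩ := iterate_betaMap_right hβ ht N
    have hβN : (0 : ℝ) < β ^ N := by positivity
    -- Up to t + ε the iterate T^N is affine; the second bound keeps its values below t, and the
    -- third keeps the new parameter below 1.
    set η := min ε (min ((t - (betaMap β)^[N] t) / β ^ N) (1 - t)) with hη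
    have hη0 : 0 < η := by
      refine lt_min hε (lt_min (div_pos (by linarith) hβN) (by linarith [ht.2]))
    have gap : ∀ x ∈ survivorSet β t, t + η ≤ x := by
      intro x hx
      by_contra! hlt
      have hx0 : t ≤ x := by simpa using hx.2 0
      have h1 := hy x ⟨hx0, by linarith [min_le_left ε (min ((t - (betaMap β)^[N] t) / β ^ N)
        (1 - t))]⟩ N le_rfl
      have h2 := hx.2 N
      have h3 : x - t < (t - (betaMap β)^[N] t) / β ^ N := by
        have := (min_le_right ε (min ((t - (betaMap β)^[N] t) / β ^ N) (1 - t))).trans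
          (min_le_left _ _)
        linarith
      rw [lt_div_iff₀' hβN] at h3
      linarith
    have hη1 : η ≤ 1 - t := (min_le_right _ _).trans (min_le_right _ _)
    refine h (t + η / 2) ⟨by linarith [ht.1], by linarith [ht.2]⟩ (by linarith) ?_
    ext x
    constructor
    · rintro ⟨hx, hn⟩
      exact ⟨hx, fun n => by linarith [hn n]⟩
    · intro hx
      refine ⟨hx.1, fun n => ?_⟩
      have := gap ((betaMap β)^[n] x) ⟨iterate_betaMap_mem β hx.1 n, fun k => by
        rw [← Function.iterate_add_apply]; exact hx.2 _⟩
      linarith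
  · rintro ⟨ht, h⟩
    refine ⟨ht, fun t' _ hlt heq => ?_⟩
    have : t ∈ survivorSet β t' := by rw [heq]; exact ⟨ht, h⟩
    have := this.2 0
    simp at this
    linarith

/-! ### Porous sets are null sets -/

/-- A set of reals which has, near each of its points, holes of a fixed proportion at arbitrarily
small scales, is a null set. -/
theorem volume_eq_zero_of_porous {S : Set ℝ}
    (h : ∀ x ∈ S, ∃ K : ℝ, ∀ ε > 0, ∃ w δ : ℝ, 0 < δ ∧ δ < ε ∧ |x - w| ≤ K * δ ∧
      ∀ y, |y - w| ≤ δ → y ∉ S) : volume S = 0 := by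
  -- The density theorem allows balls that contain x only after enlargement by the factor K. On
  -- holes the density ratio is constantly 0, while it tends to 1 at almost every point of S.
  have key : ∀ K : ℕ, ∀ᵐ x ∂(volume.restrict S), ∀ (w : ℕ → ℝ) (δ : ℕ → ℝ),
      Tendsto δ atTop (𝓝[>] 0) → (∀ j, x ∈ Metric.closedBall (w j) (K * δ j)) →
      ¬ ∀ j, S ∩ Metric.closedBall (w j) (δ j) = ∅ := by
    intro K
    filter_upwards [IsUnifLocDoublingMeasure.ae_tendsto_measure_inter_div volume S (K : ℝ)]
      with x hx w δ hδ hw hS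
    have := hx w δ hδ (Eventually.of_forall hw)
    simp only [hS, measure_empty, ENNReal.zero_div] at this
    exact zero_ne_one (tendsto_nhds_unique tendsto_const_nhds this)
  rw [← ae_all_iff] at key
  have key' : ∀ᵐ x ∂(volume.restrict S), x ∉ S := by
    filter_upwards [key] with x hx hxS
    obtain ⟨K, hK⟩ := h x hxS
    obtain ⟨k, hk⟩ := exists_nat_ge K
    choose w δ h1 h2 h3 h4 using fun j : ℕ => hK (1 / ((j : ℝ) + 1)) (by positivity)
    refine hx k w δ ?_ ?_ ?_
    · refine tendsto_nhdsWithin_iff.2 ⟨?_, Eventually.of_forall h1⟩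
      exact squeeze_zero (fun j => (h1 j).le) (fun j => (h2 j).le)
        tendsto_one_div_add_atTop_nhds_zero_nat
    · intro j
      rw [Metric.mem_closedBall, Real.dist_eq]
      exact (h3 j).trans (mul_le_mul_of_nonneg_right hk (h1 j).le)
    · intro j
      ext y
      simp only [mem_inter_iff, Metric.mem_closedBall, Real.dist_eq, mem_empty_iff_false,
        iff_false, not_and]
      exact fun hy hy' => h4 j y hy' hy
  have h2 := ae_iff.1 key'
  simp only [not_not] at h2
  have h3 : (volume.restrict S) S = volume S := Measure.restrict_apply_self _ _
  rw [← h3]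
  exact h2

/-- If y just below x > 0 satisfies T^n y ≤ x/2 and y > x/2, then y is not minimal. Since T^n x ≥ x,
such y fill an interval of length x/(2β^n) within distance β^(-n) of x, which is porosity at x. The
point 0 is treated separately. -/
theorem volume_minimalPoints {β : ℝ} (hβ : 1 < β) : volume (minimalPoints β) = 0 := by
  have hpor : volume (minimalPoints β ∩ Ioi 0) = 0 := by
    apply volume_eq_zero_of_porous
    rintro x ⟨⟨hx, hmin⟩, hx0⟩
    have hx0 : 0 < x := hx0
    refine ⟨4 / x + 1, fun ε hε => ?_⟩
    obtain ⟨n, hn⟩ := exists_pow_lt_of_lt_one (y := β⁻¹) (show 0 < min ε (x / 2) by positivity)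
      (inv_lt_one_of_one_lt₀ hβ)
    have hβ0 : (0 : ℝ) < β := by linarith
    have hp : 0 < (β⁻¹) ^ n := by positivity
    have hn1 : (β⁻¹) ^ n < ε := hn.trans_le (min_le_left _ _)
    have hn2 : (β⁻¹) ^ n < x / 2 := hn.trans_le (min_le_right _ _)
    have hTn := iterate_betaMap_mem β hx n
    have hmn := hmin n
    set b := (β⁻¹) ^ n with hb
    have hdiv : ∀ a : ℝ, a / β ^ n = b * a := fun a => by rw [hb, inv_pow]; field_simp
    -- As y runs through this ball, the number z below, which will be T^n y, runs through [0, x/2].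
    refine ⟨x - b * (betaMap β)^[n] x + b * x / 4, b * x / 4, by positivity, ?_, ?_, ?_⟩
    · nlinarith [hx.2]
    · rw [show (4 / x + 1) * (b * x / 4) = b + b * x / 4 by field_simp]
      have : 0 ≤ b * (betaMap β)^[n] x := mul_nonneg hp.le hTn.1
      have : b * (betaMap β)^[n] x ≤ b := by nlinarith [hTn.2]
      have : 0 < b * x := by positivity
      rw [abs_le]; constructor <;> linarith
    · rintro y hy ⟨⟨-, hymin⟩, -⟩
      rw [abs_le] at hy
      set z := (y - x) / b + (betaMap β)^[n] x with hz
      have hyz : y = x - ((betaMap β)^[n] x - z) / β ^ n := by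
        rw [hdiv, hz]; field_simp; ring
      have hbz : b * z = y - x + b * (betaMap β)^[n] x := by rw [hz]; field_simp
      have hz0 : 0 ≤ z := by
        by_contra! h; nlinarith
      have hz1 : z ≤ x / 2 := by
        by_contra! h; nlinarith
      have := (iterate_betaMap_lower hβ hx hz0 (by linarith) (le_refl n)).2
      rw [← hyz] at this
      have h2 := hymin n
      rw [this] at h2
      simp at h2
      have : b * (betaMap β)^[n] x ≤ b := by nlinarith [hTn.2]
      have : 0 ≤ b * z := by positivity
      linarith
  refine measure_mono_null (t := (minimalPoints β ∩ Ioi 0) ∪ {0}) ?_ ?_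
  · intro x hx
    rcases hx.1.1.eq_or_lt with h | h
    · right; exact h.symm
    · left; exact ⟨hx, h⟩
  · exact measure_union_null hpor (by simp)

/-! ### The quasi-greedy orbit of one -/

/-- The orbit of `1` under the left-continuous version of the beta-transformation. -/
noncomputable def oneOrbit (β : ℝ) : ℕ → ℝ
  | 0 => 1
  | n + 1 => β * oneOrbit β n - (⌈β * oneOrbit β n⌉ - 1 : ℤ)

/-- The quasi-greedy expansion of `1`. -/
noncomputable def oneDigit (β : ℝ) (n : ℕ) : ℤ := ⌈β * oneOrbit β n⌉ - 1

theorem oneOrbit_succ (β : ℝ) (n : ℕ) :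
    oneOrbit β (n + 1) = β * oneOrbit β n - oneDigit β n := rfl

theorem oneOrbit_mem (β : ℝ) (n : ℕ) : oneOrbit β n ∈ Ioc (0 : ℝ) 1 := by
  cases n with
  | zero => simp [oneOrbit]
  | succ n =>
    rw [oneOrbit_succ, oneDigit]
    push_cast
    constructor <;> linarith [Int.le_ceil (β * oneOrbit β n), Int.ceil_lt_add_one (β * oneOrbit β n)]

theorem oneDigit_nonneg {β : ℝ} (hβ : 0 < β) (n : ℕ) : 0 ≤ oneDigit β n := by
  have : 0 < β * oneOrbit β n := mul_pos hβ (oneOrbit_mem β n).1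
  have := Int.ceil_pos.2 this
  rw [oneDigit]; omega

/-- The quotient is the length of the cylinder of rank n adjacent to 1, and these cylinders are
nested. -/
theorem oneOrbit_div_pow_le {β : ℝ} (hβ : 0 < β) (n : ℕ) :
    oneOrbit β (n + 1) / β ^ (n + 1) ≤ oneOrbit β n / β ^ n := by
  have h1 : (0 : ℝ) ≤ oneDigit β n := by exact_mod_cast oneDigit_nonneg hβ n
  rw [oneOrbit_succ, pow_succ, div_le_div_iff₀ (by positivity) (by positivity)]
  have : 0 < β ^ n := by positivity
  nlinarith

theorem oneOrbit_div_pow_antitone {β : ℝ} (hβ : 0 < β) :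
    Antitone (fun n => oneOrbit β n / β ^ n) :=
  antitone_nat_of_succ_le (oneOrbit_div_pow_le hβ)

/-- Points close to one follow the quasi-greedy orbit of one. -/
theorem iterate_betaMap_near_one {β y : ℝ} {k : ℕ} (hβ : 0 < β) (hy : y < 1)
    (hk : 1 - oneOrbit β k / β ^ k ≤ y) :
    ∀ i ≤ k, (betaMap β)^[i] y = oneOrbit β i - β ^ i * (1 - y) := by
  intro i
  induction i with
  | zero => intro _; simp [oneOrbit]
  | succ i ih =>
    intro hi
    rw [Function.iterate_succ_apply', ih (by omega), oneOrbit_succ]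
    have e : β * (oneOrbit β i - β ^ i * (1 - y)) - oneDigit β i =
        oneOrbit β (i + 1) - β ^ (i + 1) * (1 - y) := by rw [oneOrbit_succ]; ring
    have h1 : 1 - y ≤ oneOrbit β (i + 1) / β ^ (i + 1) := by
      have := oneOrbit_div_pow_antitone hβ hi
      simp only at this
      linarith
    rw [le_div_iff₀' (by positivity)] at h1
    have h2 : 0 < β ^ (i + 1) * (1 - y) := mul_pos (by positivity) (by linarith)
    rw [betaMap_eq_of_mem (k := oneDigit β i), e, oneOrbit_succ]
    rw [e]
    exact ⟨by linarith, by linarith [(oneOrbit_mem β (i + 1)).2]⟩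

/-! ### Full cylinders -/

/-- The left endpoints of the full cylinders of rank `n`. -/
def fullStarts (β : ℝ) (n : ℕ) : Set ℝ :=
  {a | 0 ≤ a ∧ a + 1 / β ^ n ≤ 1 ∧ ∀ y ∈ Ico (0 : ℝ) 1, (betaMap β)^[n] (a + y / β ^ n) = y}

theorem iterate_betaMap_div_pow {β y : ℝ} (hβ : 1 < β) (hy : y ∈ Ico (0 : ℝ) 1) (m : ℕ) :
    ∀ i ≤ m, (betaMap β)^[i] (y / β ^ m) = y / β ^ (m - i) := by
  intro i hi
  have hfix : ∀ j, (betaMap β)^[j] 0 = 0 := by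
    intro j
    induction j with
    | zero => rfl
    | succ j ih => rw [Function.iterate_succ_apply', ih]; simp [betaMap]
  have e : ∀ j ≤ m, (betaMap β)^[j] 0 + β ^ j * (y / β ^ m - 0) = y / β ^ (m - j) := by
    intro j hj
    have : β ^ m = β ^ j * β ^ (m - j) := by rw [← pow_add]; congr 1; omega
    rw [hfix, this]; field_simp; ring
  rw [iterate_betaMap_shadow (x := 0) (n := m) _ i hi, e i hi]
  intro j hj
  rw [e j hj]
  refine ⟨div_nonneg hy.1 (by positivity), ?_⟩
  exact (div_le_self hy.1 (one_le_pow₀ hβ.le)).trans_lt hy.2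

theorem zero_mem_fullStarts {β : ℝ} (hβ : 1 < β) (n : ℕ) : (0 : ℝ) ∈ fullStarts β n := by
  refine ⟨le_rfl, ?_, fun y hy => ?_⟩
  · rw [zero_add]; exact div_le_one_of_le₀ (one_le_pow₀ hβ.le) (by positivity)
  · rw [zero_add, iterate_betaMap_div_pow hβ hy n n le_rfl]; simp

/-- Concatenating the words of two full cylinders gives a full cylinder. -/
theorem add_mem_fullStarts {β a b : ℝ} (hβ : 1 < β) {i k : ℕ} (ha : a ∈ fullStarts β i)
    (hb : b ∈ fullStarts β k) : a + b / β ^ i ∈ fullStarts β (i + k) := by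
  have h0 : (0 : ℝ) < β := by linarith
  have hi : 0 < β ^ i := by positivity
  have hk : 0 < β ^ k := by positivity
  refine ⟨add_nonneg ha.1 (div_nonneg hb.1 hi.le), ?_, fun y hy => ?_⟩
  · have : a + b / β ^ i + 1 / β ^ (i + k) = a + (b + 1 / β ^ k) / β ^ i := by
      rw [pow_add]; field_simp; ring
    rw [this]
    refine le_trans ?_ ha.2.1
    gcongr
    exact hb.2.1
  · have : a + b / β ^ i + y / β ^ (i + k) = a + (b + y / β ^ k) / β ^ i := by
      rw [pow_add]; field_simp; ring
    rw [this, add_comm i k, Function.iterate_add_apply, ha.2.2, hb.2.2 y hy]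
    have h1 : y / β ^ k < 1 / β ^ k := by gcongr; exact hy.2
    exact ⟨add_nonneg hb.1 (div_nonneg hy.1 hk.le), by linarith [hb.2.1]⟩

theorem fullStarts_mono {β : ℝ} (hβ : 1 < β) {i n : ℕ} (h : i ≤ n) :
    fullStarts β i ⊆ fullStarts β n := by
  intro a ha
  have := add_mem_fullStarts hβ ha (zero_mem_fullStarts hβ (n - i))
  rwa [zero_div, add_zero, show i + (n - i) = n by omega] at this

/-- If b lay inside the full cylinder starting at a, then T^n b would be both 0 and β^n (b - a) > 0.
-/
theorem fullStarts_separated {β a b : ℝ} (hβ : 1 < β) {n : ℕ} (ha : a ∈ fullStarts β n)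
    (hb : b ∈ fullStarts β n) (hab : a < b) : a + 1 / β ^ n ≤ b := by
  by_contra! h
  have hn : (0 : ℝ) < β ^ n := by positivity
  have h1 : (b - a) * β ^ n < 1 := by
    rw [← lt_div_iff₀ hn]; linarith
  have h0 : 0 < (b - a) * β ^ n := mul_pos (by linarith) hn
  have h2 := ha.2.2 ((b - a) * β ^ n) ⟨h0.le, h1⟩
  rw [mul_div_assoc, div_self hn.ne', mul_one, add_sub_cancel] at h2
  have h3 := hb.2.2 0 ⟨le_rfl, one_pos⟩
  rw [zero_div, add_zero, h2] at h3
  linarith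

/-- Every point lies in a full cylinder of some rank `i ≤ n`, in the last cylinder of rank `n` in
it. -/
theorem exists_fullStarts_cover {β : ℝ} (hβ : 1 < β) {x : ℝ} (hx : x ∈ Ico (0 : ℝ) 1) (n : ℕ) :
    ∃ i k, i + k = n ∧ ∃ a ∈ fullStarts β i, ∃ y ∈ Ico (0 : ℝ) 1, x = a + y / β ^ i ∧
      1 - oneOrbit β k / β ^ k ≤ y := by
  have h0 : (0 : ℝ) < β := by linarith
  induction n with
  | zero => exact ⟨0, 0, rfl, 0, zero_mem_fullStarts hβ 0, x, hx, by simp, by simp [oneOrbit, hx.1]⟩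
  | succ n ih =>
    obtain ⟨i, k, hik, a, ha, y, hy, hxa, hky⟩ := ih
    rcases le_or_gt (1 - oneOrbit β (k + 1) / β ^ (k + 1)) y with h | h
    · exact ⟨i, k + 1, by omega, a, ha, y, hy, hxa, h⟩
    have hpk : (0 : ℝ) < β ^ k := by positivity
    set p := 1 - oneOrbit β k / β ^ k with hp
    have hp0 : 0 ≤ p := by
      rw [hp, sub_nonneg, div_le_one hpk]
      exact (oneOrbit_mem β k).2.trans (one_le_pow₀ hβ.le)
    -- The integer part of u is the next digit. Here it is smaller than the digit of 1, so the
    -- cylinder it defines is full, and the remainder restarts with k = 0.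
    set u := β ^ (k + 1) * (y - p) with hu
    have hu0 : 0 ≤ u := mul_nonneg (by positivity) (by linarith)
    have hud : u < oneDigit β k := by
      have e : (oneDigit β k : ℝ) = β ^ (k + 1) *
          (oneOrbit β k / β ^ k - oneOrbit β (k + 1) / β ^ (k + 1)) := by
        rw [oneOrbit_succ, pow_succ]; field_simp; ring
      rw [e, hu]
      apply mul_lt_mul_of_pos_left _ (by positivity)
      rw [hp]; linarith
    set d := ⌊u⌋ with hd
    have hd0 : (0 : ℝ) ≤ d := by exact_mod_cast Int.floor_nonneg.2 hu0
    have hd1 : (d : ℝ) + 1 ≤ oneDigit β k := by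
      have : d < oneDigit β k := Int.floor_lt.2 hud
      exact_mod_cast this
    have hd2 : (oneDigit β k : ℝ) < β * oneOrbit β k := by
      have := (oneOrbit_mem β (k + 1)).1
      rw [oneOrbit_succ] at this; linarith
    have hb : p + d / β ^ (k + 1) ∈ fullStarts β (k + 1) := by
      have hle : p + d / β ^ (k + 1) + 1 / β ^ (k + 1) ≤ 1 := by
        have : (d + 1) / β ^ (k + 1) ≤ oneOrbit β k / β ^ k := by
          rw [pow_succ, div_le_div_iff₀ (by positivity) hpk]
          nlinarith
        rw [add_div] at this
        rw [hp]; linarith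
      refine ⟨by positivity, hle, fun w hw => ?_⟩
      have hw1 : w / β ^ (k + 1) < 1 / β ^ (k + 1) := by gcongr; exact hw.2
      have hw0 : 0 ≤ w / β ^ (k + 1) := div_nonneg hw.1 (by positivity)
      have hd0' : 0 ≤ (d : ℝ) / β ^ (k + 1) := by positivity
      have hT := iterate_betaMap_near_one (k := k) h0
        (show p + d / β ^ (k + 1) + w / β ^ (k + 1) < 1 by linarith)
        (by rw [← hp]; linarith) k le_rfl
      rw [Function.iterate_succ_apply', hT]
      have e : oneOrbit β k - β ^ k * (1 - (p + d / β ^ (k + 1) + w / β ^ (k + 1))) =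
          (d + w) / β := by
        rw [hp, pow_succ]; field_simp; ring
      rw [e, betaMap_eq_of_mem (k := d)]
      · field_simp; ring
      · rw [mul_div_cancel₀ _ h0.ne', add_sub_cancel_left]; exact hw
    refine ⟨i + (k + 1), 0, by omega, _, add_mem_fullStarts hβ ha hb, u - d,
      ⟨by linarith [Int.floor_le u], by linarith [Int.lt_floor_add_one u]⟩, ?_, ?_⟩
    · rw [hxa, hu, pow_add β i]; field_simp; ring
    · simp [oneOrbit]; linarith [Int.floor_le u]

/-- There are at least `β ^ n / (n + 1)` full cylinders of rank `n`. -/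
theorem exists_finset_fullStarts {β : ℝ} (hβ : 1 < β) (n : ℕ) :
    ∃ s : Finset ℝ, ↑s ⊆ fullStarts β n ∧ β ^ n ≤ (n + 1) * s.card := by
  have h0 : (0 : ℝ) < β := by linarith
  rcases (fullStarts β n).finite_or_infinite with hf | hf
  · refine ⟨hf.toFinset, by simp, ?_⟩
    -- Each full cylinder of rank i contributes its last subcylinder of rank n, of length at most
    -- β^(-n). Comparing total length with 1 gives the count.
    have hcov : Ico (0 : ℝ) 1 ⊆ ⋃ i ∈ Finset.range (n + 1), ⋃ a ∈ hf.toFinset,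
        Icc (a + (1 - oneOrbit β (n - i) / β ^ (n - i)) / β ^ i) (a + 1 / β ^ i) := by
      intro x hx
      obtain ⟨i, k, hik, a, ha, y, hy, hxa, hky⟩ := exists_fullStarts_cover hβ hx n
      simp only [mem_iUnion]
      refine ⟨i, Finset.mem_range.2 (by omega), a, by
        rw [Finite.mem_toFinset]; exact fullStarts_mono hβ (by omega) ha, ?_⟩
      rw [show n - i = k by omega, hxa]
      constructor
      · gcongr
      · gcongr; exact hy.2.le
    have hm := measure_mono (μ := volume) hcov
    have h2 := hm.trans ((measure_biUnion_finset_le _ _).trans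
      (Finset.sum_le_sum fun i _ => measure_biUnion_finset_le _ _))
    have hlen : ∀ i ∈ Finset.range (n + 1), ∀ a : ℝ,
        volume (Icc (a + (1 - oneOrbit β (n - i) / β ^ (n - i)) / β ^ i) (a + 1 / β ^ i)) ≤
          ENNReal.ofReal (1 / β ^ n) := by
      intro i hi a
      rw [Finset.mem_range] at hi
      rw [Real.volume_Icc]
      apply ENNReal.ofReal_le_ofReal
      have : β ^ n = β ^ (n - i) * β ^ i := by rw [← pow_add]; congr 1; omega
      rw [this]
      have := (oneOrbit_mem β (n - i)).2
      have e : a + 1 / β ^ i - (a + (1 - oneOrbit β (n - i) / β ^ (n - i)) / β ^ i) =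
          oneOrbit β (n - i) / (β ^ (n - i) * β ^ i) := by field_simp; ring
      rw [e]
      gcongr
    have h3 := h2.trans (Finset.sum_le_sum fun i hi => Finset.sum_le_sum fun a _ => hlen i hi a)
    simp only [Finset.sum_const, Finset.card_range, nsmul_eq_mul, Real.volume_Ico] at h3
    rw [sub_zero, ← ENNReal.ofReal_natCast, ← ENNReal.ofReal_natCast, ← ENNReal.ofReal_mul
      (by positivity), ← ENNReal.ofReal_mul (by positivity), ENNReal.ofReal_le_ofReal_iff
      (by positivity), ← mul_assoc, mul_one_div, le_div_iff₀ (by positivity)] at h3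
    push_cast at h3
    linarith
  -- Separation in fact excludes an infinite set; here it is enough to pick ⌈β^n⌉ of its elements.
  · obtain ⟨s, hs, hc⟩ := hf.exists_subset_card_eq (⌈β ^ n⌉₊)
    refine ⟨s, hs, ?_⟩
    rw [hc]
    have := Nat.le_ceil (β ^ n)
    have h4 : (0 : ℝ) ≤ ⌈β ^ n⌉₊ := by positivity
    have h5 : (0 : ℝ) ≤ n := by positivity
    nlinarith

/-! ### Homogeneous self-similar sets -/

/-- The point with code `d` of the self-similar set with translations `a` and ratio `1 / B`. -/
noncomputable def codePoint {N : ℕ} (B : ℝ) (a : Fin N → ℝ) (d : ℕ → Fin N) : ℝ :=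
  ∑' j : ℕ, a (d j) * (1 / B) ^ j

section SelfSimilar

variable {N : ℕ} {B ρ : ℝ} {a : Fin N → ℝ}

theorem summable_codePoint (hB : 1 < B) (h0 : ∀ i, 0 ≤ a i) (h1 : ∀ i, a i ≤ ρ * (1 - 1 / B))
    (d : ℕ → Fin N) : Summable fun j : ℕ => a (d j) * (1 / B) ^ j := by
  have hb : 0 ≤ 1 / B := by positivity
  have hb1 : 1 / B < 1 := by rw [div_lt_one (by linarith)]; exact hB
  refine Summable.of_nonneg_of_le (fun j => mul_nonneg (h0 _) (by positivity))
    (fun j => mul_le_mul_of_nonneg_right (h1 (d j)) (by positivity))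
    ((summable_geometric_of_lt_one hb hb1).mul_left _)

/-- The bound on `a i` says that x ↦ a i + x / B maps [0, ρ] into itself. -/
theorem codePoint_mem (hB : 1 < B) (h0 : ∀ i, 0 ≤ a i) (h1 : ∀ i, a i ≤ ρ * (1 - 1 / B))
    (d : ℕ → Fin N) : codePoint B a d ∈ Icc 0 ρ := by
  have hb : 0 ≤ 1 / B := by positivity
  have hb1 : 1 / B < 1 := by rw [div_lt_one (by linarith)]; exact hB
  refine ⟨tsum_nonneg fun j => mul_nonneg (h0 _) (by positivity), ?_⟩
  have := (summable_codePoint hB h0 h1 d).tsum_le_tsum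
    (fun j => mul_le_mul_of_nonneg_right (h1 (d j)) (by positivity))
    ((summable_geometric_of_lt_one hb hb1).mul_left _)
  rw [tsum_mul_left, tsum_geometric_of_lt_one hb hb1, mul_assoc,
    mul_inv_cancel₀ (by linarith), mul_one] at this
  exact this

theorem codePoint_shift (hB : 1 < B) (h0 : ∀ i, 0 ≤ a i) (h1 : ∀ i, a i ≤ ρ * (1 - 1 / B))
    (d : ℕ → Fin N) :
    codePoint B a d = a (d 0) + codePoint B a (fun j => d (j + 1)) / B := by
  rw [codePoint, (summable_codePoint hB h0 h1 d).tsum_eq_zero_add, codePoint, ← tsum_div_const]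
  simp only [pow_zero, mul_one]
  congr 1
  refine tsum_congr fun j => ?_
  rw [pow_succ]; ring

theorem codePoint_sub (hB : 1 < B) (h0 : ∀ i, 0 ≤ a i) (h1 : ∀ i, a i ≤ ρ * (1 - 1 / B)) (m : ℕ) :
    ∀ d e : ℕ → Fin N, (∀ i < m, d i = e i) → codePoint B a d - codePoint B a e =
      (codePoint B a (fun j => d (j + m)) - codePoint B a (fun j => e (j + m))) / B ^ m := by
  induction m with
  | zero => intro d e _; simp
  | succ m ih =>
    intro d e h
    rw [ih d e (fun i hi => h i (by omega)), codePoint_shift hB h0 h1 (fun j => d (j + m)),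
      codePoint_shift hB h0 h1 (fun j => e (j + m))]
    have : d m = e m := h m (by omega)
    simp only [zero_add, this, add_sub_add_left_eq_sub]
    rw [← sub_div, div_div, ← pow_succ']
    simp only [add_assoc, add_comm 1 m]

/-- After rescaling by B^m the leading translations are at least 1/B apart, while the tails, lying
in [0, ρ/B], can close at most ρ/B of this. -/
theorem le_abs_codePoint_sub (hB : 1 < B) (h0 : ∀ i, 0 ≤ a i) (h1 : ∀ i, a i ≤ ρ * (1 - 1 / B))
    (hsep : ∀ i j, a i < a j → a i + 1 / B ≤ a j) (hinj : Function.Injective a)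
    {d e : ℕ → Fin N} {m : ℕ} (h : ∀ i < m, d i = e i) (hm : d m ≠ e m) :
    (1 - ρ) / B * (1 / B ^ m) ≤ |codePoint B a d - codePoint B a e| := by
  have hB0 : 0 < B := by linarith
  have key : ∀ d e : ℕ → Fin N, a (d 0) < a (e 0) →
      (1 - ρ) / B ≤ codePoint B a e - codePoint B a d := by
    intro d e hde
    rw [codePoint_shift hB h0 h1 d, codePoint_shift hB h0 h1 e]
    have h2 := hsep _ _ hde
    have h3 : codePoint B a (fun j => d (j + 1)) / B ≤ ρ / B := by
      gcongr; exact (codePoint_mem hB h0 h1 _).2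
    have h4 : 0 ≤ codePoint B a (fun j => e (j + 1)) / B :=
      div_nonneg (codePoint_mem hB h0 h1 _).1 hB0.le
    rw [sub_div]; linarith
  rw [codePoint_sub hB h0 h1 m d e h, abs_div, abs_of_pos (pow_pos hB0 m), mul_one_div]
  gcongr
  rcases lt_or_gt_of_ne (fun h => hm (hinj h)) with h2 | h2
  · rw [abs_sub_comm]
    exact (key _ _ (by simpa using h2)).trans (le_abs_self _)
  · exact (key _ _ (by simpa using h2)).trans (le_abs_self _)

/-- Sending a point to the real number whose base-N digits are its code is r-Hölder, since N^(-m) ≤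
B^(-rm). The image contains [0, 1), so 1 ≤ dim / r. -/
theorem le_dimH_range_codePoint (hN : 2 ≤ N) (hB : 1 < B) (h0 : ∀ i, 0 ≤ a i)
    (h1 : ∀ i, a i ≤ ρ * (1 - 1 / B)) (hρ : ρ < 1)
    (hsep : ∀ i j, a i < a j → a i + 1 / B ≤ a j) (hinj : Function.Injective a)
    {r : NNReal} (hr : 0 < r) (hBr : B ^ (r : ℝ) ≤ N) :
    (r : ENNReal) ≤ dimH (range (codePoint B a)) := by
  have hB0 : 0 < B := by linarith
  have : NeZero N := ⟨by omega⟩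
  have first : ∀ d e : ℕ → Fin N, d ≠ e → ∃ m, (∀ i < m, d i = e i) ∧ d m ≠ e m := by
    intro d e hde
    have : ∃ m, d m ≠ e m := Function.ne_iff.1 hde
    classical
    exact ⟨Nat.find this, fun i hi => not_not.1 (Nat.find_min this hi), Nat.find_spec this⟩
  have hc : 0 < (1 - ρ) / B := div_pos (by linarith) hB0
  have cinj : Function.Injective (codePoint B a) := by
    intro d e hde
    by_contra hne
    obtain ⟨m, hm, hm'⟩ := first d e hne
    have := le_abs_codePoint_sub hB h0 h1 hsep hinj hm hm'
    rw [hde, sub_self, abs_zero] at this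
    have : 0 < (1 - ρ) / B * (1 / B ^ m) := by positivity
    linarith
  set g : ℝ → ℝ := fun x => Real.ofDigits (Function.invFun (codePoint B a) x) with hg
  have hgc : ∀ d, g (codePoint B a d) = Real.ofDigits d := by
    intro d
    rw [hg]; simp only; rw [Function.leftInverse_invFun cinj d]
  have hH : HolderOnWith (((1 - ρ) / B) ^ (-(r : ℝ))).toNNReal r g (range (codePoint B a)) := by
    rintro _ ⟨d, rfl⟩ _ ⟨e, rfl⟩
    rw [hgc, hgc]
    by_cases hde : d = e
    · subst hde; simp
    obtain ⟨m, hm, hm'⟩ := first d e hde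
    have hge := le_abs_codePoint_sub hB h0 h1 hsep hinj hm hm'
    have hle := Real.abs_ofDigits_sub_ofDigits_le hm
    have hpos : 0 < (1 - ρ) / B * (1 / B ^ m) := by positivity
    rw [edist_dist, edist_dist, Real.dist_eq, Real.dist_eq,
      ENNReal.ofReal_rpow_of_nonneg (abs_nonneg _) r.coe_nonneg]
    change _ ≤ ENNReal.ofReal (((1 - ρ) / B) ^ (-(r : ℝ))) * _
    rw [← ENNReal.ofReal_mul (Real.rpow_nonneg hc.le _)]
    apply ENNReal.ofReal_le_ofReal
    refine hle.trans ?_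
    have h2 : ((1 - ρ) / B * (1 / B ^ m)) ^ (r : ℝ) ≤
        |codePoint B a d - codePoint B a e| ^ (r : ℝ) :=
      Real.rpow_le_rpow hpos.le hge r.coe_nonneg
    refine le_trans ?_ (mul_le_mul_of_nonneg_left h2 (Real.rpow_nonneg hc.le _))
    rw [Real.mul_rpow hc.le (by positivity), ← mul_assoc, ← Real.rpow_add hc, neg_add_cancel,
      Real.rpow_zero, one_mul, one_div, Real.inv_rpow (by positivity), ← Real.rpow_natCast B,
      ← Real.rpow_mul hB0.le, mul_comm (m : ℝ), Real.rpow_mul hB0.le, Real.rpow_natCast]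
    have h3 : 0 < B ^ (r : ℝ) := Real.rpow_pos_of_pos hB0 _
    gcongr
  have hdim := hH.dimH_image_le hr
  have hsub : Ico (0 : ℝ) 1 ⊆ g '' range (codePoint B a) := by
    intro x hx
    refine ⟨_, ⟨Real.digits x N, rfl⟩, ?_⟩
    rw [hgc, Real.ofDigits_digits (by omega) hx]
  have hone : (1 : ENNReal) ≤ dimH (g '' range (codePoint B a)) := by
    refine le_trans ?_ (dimH_mono hsub)
    rw [Real.dimH_of_nonempty_interior]
    · simp
    · rw [interior_Ico]; exact ⟨1 / 2, by norm_num, by norm_num⟩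
  have := hone.trans hdim
  rwa [ENNReal.le_div_iff_mul_le (by simp [hr.ne']) (by simp), one_mul] at this

end SelfSimilar

/-! ### The dimension of the set of minimal points -/

/-- Because the translations start full cylinders, T^n acts as the shift on codes. -/
theorem iterate_codePoint {β ρ : ℝ} {n N : ℕ} {a : Fin N → ℝ} (hβ : 1 < β) (hn : n ≠ 0)
    (ha : ∀ i, a i ∈ fullStarts β n) (h1 : ∀ i, a i ≤ ρ * (1 - 1 / β ^ n)) (hρ : ρ < 1) (j : ℕ) :
    ∀ d : ℕ → Fin N, (betaMap β)^[n * j] (codePoint (β ^ n) a d) =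
      codePoint (β ^ n) a (fun i => d (i + j)) := by
  have hB : 1 < β ^ n := one_lt_pow₀ hβ hn
  induction j with
  | zero => intro d; rfl
  | succ j ih =>
    intro d
    have hmem := codePoint_mem hB (fun i => (ha i).1) h1 (fun j => d (j + 1))
    rw [Nat.mul_succ, Function.iterate_add_apply, codePoint_shift hB (fun i => (ha i).1) h1 d,
      (ha (d 0)).2.2 _ ⟨hmem.1, hmem.2.trans_lt hρ⟩, ih]
    simp only [add_assoc]

/-- At multiples of n the orbit is at least β^(-n). Any earlier time is at most n steps before such
a multiple, and T multiplies by at most β per step. -/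
theorem le_iterate_codePoint {β ρ : ℝ} {n N : ℕ} {a : Fin N → ℝ} (hβ : 1 < β) (hn : n ≠ 0)
    (ha : ∀ i, a i ∈ fullStarts β n) (h1 : ∀ i, a i ≤ ρ * (1 - 1 / β ^ n)) (hρ : ρ < 1)
    (hlow : ∀ i, 1 / β ^ n ≤ a i) (d : ℕ → Fin N) (k : ℕ) :
    1 / β ^ (2 * n) ≤ (betaMap β)^[k] (codePoint (β ^ n) a d) := by
  have hB : 1 < β ^ n := one_lt_pow₀ hβ hn
  have hmem := codePoint_mem hB (fun i => (ha i).1) h1 d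
  set x := codePoint (β ^ n) a d
  have hx : x ∈ Ico (0 : ℝ) 1 := ⟨hmem.1, hmem.2.trans_lt hρ⟩
  have h2 := iterate_codePoint hβ hn ha h1 hρ (k / n + 1) d
  have h3 : 1 / β ^ n ≤ (betaMap β)^[n * (k / n + 1)] x := by
    rw [h2, codePoint_shift hB (fun i => (ha i).1) h1]
    refine (hlow _).trans (le_add_of_nonneg_right ?_)
    exact div_nonneg (codePoint_mem hB (fun i => (ha i).1) h1 _).1 (by positivity)
  have h4 : k < n * (k / n + 1) := Nat.lt_mul_div_succ k (by omega)
  have h5 : n * (k / n + 1) - k ≤ n := by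
    have := Nat.div_mul_le_self k n
    rw [mul_comm] at this
    rw [Nat.mul_succ]; omega
  obtain ⟨m, hm⟩ : ∃ m, n * (k / n + 1) = m + k := ⟨n * (k / n + 1) - k, by omega⟩
  rw [hm, Function.iterate_add_apply] at h3
  have h6 := iterate_betaMap_le (zero_le_one.trans hβ.le) (iterate_betaMap_mem β hx k) m
  have h7 : β ^ m ≤ β ^ n := pow_le_pow_right₀ hβ.le (by omega)
  have h8 : 1 / β ^ n ≤ β ^ n * (betaMap β)^[k] x :=
    (h3.trans h6).trans (mul_le_mul_of_nonneg_right h7 (iterate_betaMap_mem β hx k).1)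
  have hp : 0 < β ^ n := by positivity
  rw [two_mul, pow_add, div_le_iff₀ (by positivity)]
  rw [div_le_iff₀ hp] at h8
  linarith

/-- Division by β^m puts m zeros in front of the expansion. The first m iterates only climb back to
x, and the later ones stay above β^(-m), which exceeds x / β^m. -/
theorem div_pow_mem_minimalPoints {β x : ℝ} (hβ : 1 < β) (hx : x ∈ Ico (0 : ℝ) 1) {m : ℕ}
    (h : ∀ k, 1 / β ^ m ≤ (betaMap β)^[k] x) : x / β ^ m ∈ minimalPoints β := by
  have hp : 0 < β ^ m := by positivity
  have h1 : x / β ^ m ≤ x := div_le_self hx.1 (one_le_pow₀ hβ.le)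
  refine ⟨⟨div_nonneg hx.1 hp.le, h1.trans_lt hx.2⟩, fun n => ?_⟩
  rcases le_total n m with hn | hn
  · rw [iterate_betaMap_div_pow hβ hx m n hn]
    exact div_le_div_of_nonneg_left hx.1 (by positivity) (pow_le_pow_right₀ hβ.le (by omega))
  · rw [show n = (n - m) + m by omega, Function.iterate_add_apply,
      iterate_betaMap_div_pow hβ hx m m le_rfl, Nat.sub_self, pow_zero, div_one]
    refine le_trans ?_ (h _)
    gcongr
    exact hx.2.le

theorem le_dimH_minimalPoints_inter {β : ℝ} (hβ : 1 < β) {r : NNReal} (hr0 : 0 < r) (hr : r < 1)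
    {δ : ℝ} (hδ : 0 < δ) : (r : ENNReal) ≤ dimH (minimalPoints β ∩ Ioo 0 δ) := by
  have hβ0 : 0 < β := by linarith
  have hr' : (r : ℝ) < 1 := by exact_mod_cast hr
  -- The 4 pays for the two cylinders to be discarded and leaves N ≥ β^(rn) + 2, so in particular N
  -- ≥ 2.
  obtain ⟨n, hn0, hnδ, hn2, hnr⟩ : ∃ n : ℕ, n ≠ 0 ∧ 1 / β ^ (2 * n) < δ ∧ 1 < β ^ n ∧
      (n + 1) * ((β ^ (r : ℝ)) ^ n + 4) ≤ β ^ n := by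
    have e1 : ∀ᶠ n : ℕ in atTop, (β⁻¹) ^ n < δ :=
      (tendsto_pow_atTop_nhds_zero_of_lt_one (by positivity)
        (inv_lt_one_of_one_lt₀ hβ)).eventually_lt_const hδ
    have hq : β ^ (r : ℝ) < β := by
      conv_rhs => rw [← Real.rpow_one β]
      exact Real.rpow_lt_rpow_of_exponent_lt hβ hr'
    have hq0 : 0 < β ^ (r : ℝ) := Real.rpow_pos_of_pos hβ0 _
    have e2 : Tendsto (fun n : ℕ => ((n : ℝ) + 1) * ((β ^ (r : ℝ)) ^ n + 4) / β ^ n) atTop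
        (𝓝 0) := by
      have t1 := tendsto_self_mul_const_pow_of_lt_one (r := β ^ (r : ℝ) / β) (by positivity)
        (by rw [div_lt_one hβ0]; exact hq)
      have t2 := tendsto_pow_atTop_nhds_zero_of_lt_one (r := β ^ (r : ℝ) / β) (by positivity)
        (by rw [div_lt_one hβ0]; exact hq)
      have t3 := tendsto_self_mul_const_pow_of_lt_one (r := β⁻¹) (by positivity)
        (inv_lt_one_of_one_lt₀ hβ)
      have t4 := tendsto_pow_atTop_nhds_zero_of_lt_one (r := β⁻¹) (by positivity)
        (inv_lt_one_of_one_lt₀ hβ)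
      have := (t1.add t2).add ((t3.add t4).const_mul 4)
      simp only [add_zero, mul_zero] at this
      refine this.congr fun n => ?_
      rw [div_pow, inv_pow]; field_simp
    have e3 := e2.eventually_lt_const (show (0 : ℝ) < 1 by norm_num)
    obtain ⟨n, h1, h2, h3⟩ := (e1.and (e3.and (eventually_gt_atTop 0))).exists
    have hp : 0 < β ^ n := by positivity
    refine ⟨n, by omega, ?_, one_lt_pow₀ hβ (by omega), ?_⟩
    · refine lt_of_le_of_lt ?_ h1
      rw [inv_pow, ← one_div]
      exact div_le_div_of_nonneg_left zero_le_one hp (pow_le_pow_right₀ hβ.le (by omega))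
    · rw [div_lt_one hp] at h2; exact h2.le
  obtain ⟨s, hs, hcard⟩ := exists_finset_fullStarts hβ n
  have hp : 0 < β ^ n := by positivity
  set B := β ^ n with hB
  -- Dropping the cylinder at 0 forces all translations to be at least 1/B, which keeps orbits away
  -- from 0; dropping the one ending at 1 makes ρ < 1 possible.
  set s' := (s.erase 0).erase (1 - 1 / B) with hs'
  set N := s'.card with hN
  have hN1 : s.card ≤ N + 2 := by
    have h1 := Finset.pred_card_le_card_erase (s := s) (a := 0)
    have h2 := Finset.pred_card_le_card_erase (s := s.erase 0) (a := 1 - 1 / B)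
    rw [← hs', ← hN] at h2
    omega
  have hN2 : (β ^ (r : ℝ)) ^ n + 2 ≤ N := by
    have h1 : ((n : ℝ) + 1) * ((β ^ (r : ℝ)) ^ n + 4) ≤ (n + 1) * (N + 2) := by
      refine hnr.trans (hcard.trans ?_)
      gcongr
      exact_mod_cast hN1
    have := le_of_mul_le_mul_left h1 (by positivity)
    linarith
  have hN3 : 2 ≤ N := by
    have : (0 : ℝ) < (β ^ (r : ℝ)) ^ n := pow_pos (Real.rpow_pos_of_pos hβ0 _) _
    have : (2 : ℝ) ≤ N := by linarith
    exact_mod_cast this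
  set a : Fin N → ℝ := fun i => (s'.equivFin.symm i : ℝ) with ha
  have ha' : ∀ i, a i ∈ s' := fun i => (s'.equivFin.symm i).2
  have hamem : ∀ i, a i ∈ fullStarts β n := fun i =>
    hs (Finset.mem_of_mem_erase (Finset.mem_of_mem_erase (ha' i)))
  have hinj : Function.Injective a := Subtype.val_injective.comp s'.equivFin.symm.injective
  have hlow : ∀ i, 1 / B ≤ a i := by
    intro i
    have h1 : a i ≠ 0 := Finset.ne_of_mem_erase (Finset.mem_of_mem_erase (ha' i))
    have := fullStarts_separated hβ (zero_mem_fullStarts hβ n) (hamem i)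
      (lt_of_le_of_ne (hamem i).1 h1.symm)
    linarith
  have hhigh : ∀ i, a i < 1 - 1 / B := by
    intro i
    have h1 : a i ≠ 1 - 1 / B := Finset.ne_of_mem_erase (ha' i)
    exact lt_of_le_of_ne (by linarith [(hamem i).2.1]) h1
  have hpos : 0 < 1 - 1 / B := by
    rw [sub_pos, div_lt_one hp]; exact hn2
  have : Nonempty (Fin N) := ⟨⟨0, by omega⟩⟩
  obtain ⟨i0, hi0⟩ := Finite.exists_max a
  set ρ := a i0 / (1 - 1 / B) with hρ
  have hρ1 : ρ < 1 := by rw [hρ, div_lt_one hpos]; exact hhigh i0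
  have h1 : ∀ i, a i ≤ ρ * (1 - 1 / B) := by
    intro i; rw [hρ, div_mul_cancel₀ _ hpos.ne']; exact hi0 i
  have hdim := le_dimH_range_codePoint hN3 hn2 (fun i => (hamem i).1) h1 hρ1
    (fun i j hij => fullStarts_separated hβ (hamem i) (hamem j) hij) hinj hr0
    (by rw [hB, ← Real.rpow_natCast, ← Real.rpow_mul hβ0.le, mul_comm, Real.rpow_mul hβ0.le,
          Real.rpow_natCast]; linarith)
  have hβm : 0 < β ^ (2 * n) := by positivity
  have hL : LipschitzWith ⟨β ^ (2 * n), hβm.le⟩ (fun x : ℝ => β ^ (2 * n) * x) := by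
    refine LipschitzWith.of_dist_le_mul fun x y => ?_
    rw [Real.dist_eq, Real.dist_eq, ← mul_sub, abs_mul, abs_of_pos hβm]; rfl
  refine (hdim.trans (dimH_mono ?_)).trans (hL.dimH_image_le _)
  rintro _ ⟨d, rfl⟩
  have hmem := codePoint_mem hn2 (fun i => (hamem i).1) h1 d
  have hlo := le_iterate_codePoint hβ hn0 hamem h1 hρ1 hlow d
  have hx1 : codePoint B a d < 1 := hmem.2.trans_lt hρ1
  refine ⟨codePoint B a d / β ^ (2 * n), ⟨?_, ?_, ?_⟩, ?_⟩
  · exact div_pow_mem_minimalPoints hβ ⟨hmem.1, hx1⟩ hlo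
  · have := hlo 0
    simp only [Function.iterate_zero, id] at this
    exact div_pos (lt_of_lt_of_le (by positivity) this) hβm
  · refine lt_trans ?_ hnδ
    gcongr
  · field_simp

theorem dimH_minimalPoints {β : ℝ} (hβ : 1 < β) : dimH (minimalPoints β) = 1 := by
  apply le_antisymm
  · calc dimH (minimalPoints β) ≤ dimH (univ : Set ℝ) := dimH_mono (subset_univ _)
      _ = 1 := Real.dimH_univ
  · refine le_of_forall_lt fun c hc => ?_
    obtain ⟨r, hr1, hr2⟩ := ENNReal.lt_iff_exists_nnreal_btwn.1 hc
    have hr : r < 1 := by exact_mod_cast hr2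
    have hr0 : 0 < r := by
      have := (zero_le (a := c)).trans_lt hr1
      exact_mod_cast this
    exact hr1.trans_le ((le_dimH_minimalPoints_inter hβ hr0 hr one_pos).trans
      (dimH_mono inter_subset_left))

/-! ### Accumulation points -/

/-- They form a discrete subspace of a second countable space. -/
theorem countable_isolatedPoints (S : Set ℝ) : (isolatedPoints S).Countable := by
  have hd : DiscreteTopology (isolatedPoints S) := by
    rw [discreteTopology_subtype_iff']
    rintro t ⟨htS, U, hU, hUS⟩
    obtain ⟨V, hVU, hVo, htV⟩ := mem_nhds_iff.1 hU
    refine ⟨V, hVo, ?_⟩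
    ext y
    constructor
    · rintro ⟨hyV, hy⟩
      rw [← hUS]; exact ⟨hVU hyV, hy.1⟩
    · rintro rfl
      exact ⟨htV, htS, U, hU, hUS⟩
  exact countable_coe_iff.1 (TopologicalSpace.separableSpace_iff_countable.1 inferInstance)

theorem accPt_or_mem_isolatedPoints {S : Set ℝ} {t : ℝ} (ht : t ∈ S) :
    AccPt t (𝓟 S) ∨ t ∈ isolatedPoints S := by
  by_cases h : AccPt t (𝓟 S)
  · exact Or.inl h
  · right
    rw [accPt_iff_nhds] at h
    push Not at h
    obtain ⟨U, hU, h⟩ := h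
    refine ⟨ht, U, hU, ?_⟩
    ext y
    constructor
    · exact fun hy => h y hy
    · rintro rfl; exact ⟨mem_of_mem_nhds hU, ht⟩

/-- Otherwise the minimal points in (0, δ) would be countable, hence of dimension 0, but their
dimension is at least 1/2. -/
theorem infinite_accumulationPoints {β : ℝ} (hβ : 1 < β) {δ : ℝ} (hδ : 0 < δ) :
    (accumulationPoints (minimalPoints β) ∩ Ioo 0 δ).Infinite := by
  intro hfin
  have hc : (minimalPoints β ∩ Ioo 0 δ).Countable := by
    refine (hfin.countable.union (countable_isolatedPoints (minimalPoints β))).mono ?_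
    rintro t ⟨ht, htδ⟩
    rcases accPt_or_mem_isolatedPoints ht with h | h
    · exact Or.inl ⟨⟨ht, h⟩, htδ⟩
    · exact Or.inr h
  have h1 := le_dimH_minimalPoints_inter hβ (r := 1 / 2) (by norm_num) (by
    rw [← NNReal.coe_lt_coe]; norm_num) hδ
  rw [dimH_countable hc] at h1
  simp at h1

/-! ### A criterion for isolated points -/

/-- Expansion away from p cannot go on forever inside [0, 1), so every point right of p eventually
falls below t, and an iterate carries points just right of t to the right of p. On the left, T^q
expands around its fixed point t, so a point slightly below t is sent below itself. -/
theorem mem_isolatedPoints_of_escape {β p t : ℝ} {q i₀ : ℕ} (hβ : 1 < β) (hp : p ∈ Ico (0 : ℝ) 1)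
    (hq : q ≠ 0) (hper : (betaMap β)^[q] p = p) (ht : (betaMap β)^[i₀] p = t) (ht0 : 0 < t)
    (hmin : ∀ n, t ≤ (betaMap β)^[n] p)
    (hesc : ∀ y ∈ Ioo p 1, (betaMap β)^[q] y < t ∨ (betaMap β)^[q] y = p + β ^ q * (y - p)) :
    t ∈ isolatedPoints (minimalPoints β) := by
  have htm : t ∈ Ico (0 : ℝ) 1 := ht ▸ iterate_betaMap_mem β hp i₀
  have htE : t ∈ minimalPoints β := by
    refine ⟨htm, fun n => ?_⟩
    conv_rhs => rw [← ht]
    rw [← Function.iterate_add_apply]; exact hmin _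
  have hqq : 1 < β ^ q := one_lt_pow₀ hβ hq
  have hout : ∀ y ∈ Ioo p 1, ∃ n, (betaMap β)^[n] y < t := by
    intro y hy
    by_contra! hge
    have hall : ∀ j : ℕ, (betaMap β)^[q * j] y = p + (β ^ q) ^ j * (y - p) := by
      intro j
      induction j with
      | zero => simp
      | succ j ih =>
        rw [Nat.mul_succ, add_comm, Function.iterate_add_apply]
        have h1 : (betaMap β)^[q * j] y ∈ Ioo p 1 := by
          refine ⟨?_, (iterate_betaMap_mem β ⟨by linarith [hp.1, hy.1], hy.2⟩ _).2⟩
          rw [ih]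
          have : 0 < (β ^ q) ^ j * (y - p) := mul_pos (by positivity) (by linarith [hy.1])
          linarith
        rcases hesc _ h1 with h2 | h2
        · rw [← Function.iterate_add_apply] at h2
          exact absurd (hge _) (not_le.2 h2)
        · rw [h2, ih]; ring
    obtain ⟨j, hj⟩ := pow_unbounded_of_one_lt (1 / (y - p)) hqq
    have h1 := hall j
    have h2 := (iterate_betaMap_mem β (x := y) ⟨by linarith [hp.1, hy.1], hy.2⟩ (q * j)).2
    rw [div_lt_iff₀ (by linarith [hy.1])] at hj
    linarith [hp.1]
  obtain ⟨i₁, hi₁⟩ : ∃ i₁, (betaMap β)^[i₁] t = p := by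
    refine ⟨q * i₀ - i₀, ?_⟩
    rw [← ht, ← Function.iterate_add_apply,
      Nat.sub_add_cancel (Nat.le_mul_of_pos_left _ (by omega))]
    exact (Function.IsPeriodicPt.mul_const (show Function.IsPeriodicPt (betaMap β) q p from hper) i₀)
  have htper : (betaMap β)^[q] t = t := by
    rw [← ht, ← Function.iterate_add_apply, add_comm, Function.iterate_add_apply, hper]
  obtain ⟨ε, hε, hright⟩ := iterate_betaMap_right hβ htm i₁
  refine ⟨htE, Ioo (t - t / β ^ q) (t + ε), Ioo_mem_nhds ?_ (by linarith), ?_⟩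
  · have : 0 < t / β ^ q := by positivity
    linarith
  ext y
  simp only [mem_inter_iff, mem_singleton_iff, mem_Ioo]
  refine ⟨?_, ?_⟩
  · rintro ⟨⟨hy1, hy2⟩, hyE⟩
    rcases lt_trichotomy y t with h | h | h
    · exfalso
      have e : y = t - ((betaMap β)^[q] t - (t - β ^ q * (t - y))) / β ^ q := by
        rw [htper]; field_simp; ring
      have h1 : (t - y) * β ^ q < t := by
        rw [← lt_div_iff₀ (by positivity)]; linarith
      have h2 := (iterate_betaMap_lower (β := β) (x := t) (z := t - β ^ q * (t - y)) (n := q) hβ htm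
        (by linarith) (by rw [htper]; nlinarith) le_rfl).2
      rw [← e, htper] at h2
      simp only [Nat.sub_self, pow_zero, div_one] at h2
      have h3 := hyE.2 q
      nlinarith
    · exact h
    · exfalso
      have h1 := hright y ⟨h.le, hy2⟩ i₁ le_rfl
      rw [hi₁] at h1
      have h2 : 0 < β ^ i₁ * (y - t) := mul_pos (by positivity) (by linarith)
      obtain ⟨n, hn⟩ := hout ((betaMap β)^[i₁] y) ⟨by linarith,
        (iterate_betaMap_mem β hyE.1 i₁).2⟩
      rw [← Function.iterate_add_apply] at hn
      linarith [hyE.2 (n + i₁)]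
  · rintro rfl
    have : 0 < y / β ^ q := by positivity
    exact ⟨⟨by linarith, by linarith⟩, htE⟩

/-! ### Minimal points which are not periodic -/

/-- The digits of the greedy expansion of `x`. -/
noncomputable def greedyDigit (β x : ℝ) (i : ℕ) : ℤ := ⌊β * (betaMap β)^[i] x⌋

theorem iterate_betaMap_succ (β x : ℝ) (i : ℕ) :
    (betaMap β)^[i + 1] x = β * (betaMap β)^[i] x - greedyDigit β x i := by
  rw [Function.iterate_succ_apply', betaMap, greedyDigit]

theorem greedyDigit_iterate (β x : ℝ) (k i : ℕ) :
    greedyDigit β ((betaMap β)^[k] x) i = greedyDigit β x (k + i) := by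
  rw [greedyDigit, greedyDigit, ← Function.iterate_add_apply, add_comm]

theorem iterate_sub_of_greedyDigit_eq {β x y : ℝ} {j : ℕ}
    (h : ∀ i < j, greedyDigit β x i = greedyDigit β y i) :
    (betaMap β)^[j] x - (betaMap β)^[j] y = β ^ j * (x - y) := by
  induction j with
  | zero => simp
  | succ j ih =>
    rw [iterate_betaMap_succ, iterate_betaMap_succ, h j (by omega), pow_succ]
    have := ih (fun i hi => h i (by omega))
    linear_combination β * this

/-- The order of points is the lexicographic order of greedy expansions; `exists_greedyDigit_lt` is
the converse. -/
theorem lt_of_greedyDigit_lt {β x y : ℝ} {j : ℕ} (hβ : 1 < β)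
    (h : ∀ i < j, greedyDigit β x i = greedyDigit β y i)
    (hj : greedyDigit β x j < greedyDigit β y j) : x < y := by
  have h1 := iterate_sub_of_greedyDigit_eq h
  have h2 : β * (betaMap β)^[j] x < greedyDigit β x j + 1 := Int.lt_floor_add_one _
  have h3 : (greedyDigit β y j : ℝ) ≤ β * (betaMap β)^[j] y := Int.floor_le _
  have h4 : (greedyDigit β x j : ℝ) + 1 ≤ greedyDigit β y j := by exact_mod_cast hj
  have h5 : (betaMap β)^[j] x < (betaMap β)^[j] y := by
    by_contra! h
    have := mul_le_mul_of_nonneg_left h (show 0 ≤ β by linarith)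
    linarith
  have h6 : 0 < β ^ j := by positivity
  by_contra! h
  have : 0 ≤ β ^ j * (x - y) := mul_nonneg h6.le (by linarith)
  linarith

theorem exists_greedyDigit_lt {β x y : ℝ} (hβ : 1 < β) (hx : x ∈ Ico (0 : ℝ) 1)
    (hy : y ∈ Ico (0 : ℝ) 1) (hxy : x < y) :
    ∃ j, (∀ i < j, greedyDigit β x i = greedyDigit β y i) ∧
      greedyDigit β x j < greedyDigit β y j := by
  classical
  have hex : ∃ j, greedyDigit β x j ≠ greedyDigit β y j := by
    by_contra! h
    obtain ⟨j, hj⟩ := pow_unbounded_of_one_lt (1 / (y - x)) hβ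
    have h1 := iterate_sub_of_greedyDigit_eq (j := j) (fun i _ => h i)
    have h2 := iterate_betaMap_mem β hx j
    have h3 := iterate_betaMap_mem β hy j
    rw [div_lt_iff₀ (by linarith)] at hj
    linarith [h2.1, h3.2]
  have h1 : ∀ i < Nat.find hex, greedyDigit β x i = greedyDigit β y i :=
    fun i hi => not_not.1 (Nat.find_min hex hi)
  refine ⟨Nat.find hex, h1, ?_⟩
  rcases lt_or_gt_of_ne (Nat.find_spec hex) with h | h
  · exact h
  · exact absurd (lt_of_greedyDigit_lt hβ (fun i hi => (h1 i hi).symm) h) (not_lt.2 hxy.le)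

/-- The expansion of a non-periodic minimal point has arbitrarily long Lyndon prefixes. -/
theorem exists_lyndon_prefix {β t : ℝ} (hβ : 1 < β) (ht : t ∈ minimalPoints β)
    (hnp : ∀ n, n ≠ 0 → (betaMap β)^[n] t ≠ t) (M : ℕ) :
    ∃ n ≥ M, ∀ k, k ≠ 0 → k < n → ∃ j, k + j < n ∧
      (∀ i < j, greedyDigit β t i = greedyDigit β t (k + i)) ∧
      greedyDigit β t j < greedyDigit β t (k + j) := by
  classical
  have hJ : ∀ k, ∃ j, k ≠ 0 → (∀ i < j, greedyDigit β t i = greedyDigit β t (k + i)) ∧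
      greedyDigit β t j < greedyDigit β t (k + j) := by
    intro k
    by_cases hk : k = 0
    · exact ⟨0, fun h => absurd hk h⟩
    · obtain ⟨j, h1, h2⟩ := exists_greedyDigit_lt hβ ht.1 (iterate_betaMap_mem β ht.1 k)
        (lt_of_le_of_ne (ht.2 k) (hnp k hk).symm)
      refine ⟨j, fun _ => ⟨fun i hi => ?_, ?_⟩⟩
      · rw [h1 i hi, greedyDigit_iterate]
      · rwa [greedyDigit_iterate] at h2
  choose J hJ using hJ
  by_cases hal : ∃ k, k ≠ 0 ∧ k < M ∧ M ≤ k + J k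
  · obtain ⟨hk0, hkM, hkJ⟩ := Nat.find_spec hal
    set k := Nat.find hal with hk
    have hmin : ∀ k' < k, ¬ (k' ≠ 0 ∧ k' < M ∧ M ≤ k' + J k') := fun k' h => Nat.find_min hal h
    -- Here k is the least start whose comparison with the whole sequence is undecided before M; the
    -- prefix is cut just after that comparison is decided. Smaller starts are decided before M by
    -- minimality.
    refine ⟨k + J k + 1, by omega, fun k' hk'0 hk' => ⟨J k', ?_, hJ k' hk'0⟩⟩
    by_contra! hcon
    rcases lt_trichotomy k' k with h | h | h
    · exact hmin k' h ⟨hk'0, by omega, by omega⟩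
    · rw [h] at hcon; omega
    · obtain ⟨m, rfl⟩ : ∃ m, k' = k + m := ⟨k' - k, by omega⟩
      have hm : m ≠ 0 := by omega
      obtain ⟨l, hl⟩ : ∃ l, J k = m + l := ⟨J k - m, by omega⟩
      obtain ⟨hk1, hk2⟩ := hJ k hk0
      obtain ⟨hk3, -⟩ := hJ (k + m) hk'0
      -- A later start still undecided would repeat the prefix through the place where start k was
      -- decided, and this would make the m-th iterate smaller than t.
      have : (betaMap β)^[m] t < t := by
        refine lt_of_greedyDigit_lt (j := l) hβ (fun i hi => ?_) ?_
        · rw [greedyDigit_iterate, hk1 (m + i) (by omega), hk3 i (by omega), add_assoc]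
        · rw [greedyDigit_iterate, ← hl, hk3 l (by omega), add_assoc, ← hl]
          exact hk2
      exact absurd (ht.2 m) (not_le.2 this)
  · push Not at hal
    exact ⟨M, le_rfl, fun k hk hkM => ⟨J k, hal k hk hkM, hJ k hk⟩⟩

/-- Repeating a Lyndon prefix of length n periodically gives a point slightly below t; the Lyndon
property makes it minimal, and its distance to t is less than 1/(β^n - 1). -/
theorem accPt_of_not_periodic {β t : ℝ} (hβ : 1 < β) (ht : t ∈ minimalPoints β)
    (hnp : ∀ n, n ≠ 0 → (betaMap β)^[n] t ≠ t) : AccPt t (𝓟 (minimalPoints β)) := by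
  rw [accPt_iff_nhds]
  intro U hU
  obtain ⟨ε, hε, hball⟩ := Metric.mem_nhds_iff.1 hU
  obtain ⟨M, hM⟩ := pow_unbounded_of_one_lt (1 + 1 / ε) hβ
  obtain ⟨n, hn, hly⟩ := exists_lyndon_prefix hβ ht hnp (M + 1)
  have hn0 : n ≠ 0 := by omega
  have hpn : 1 + 1 / ε < β ^ n := hM.trans_le (pow_le_pow_right₀ hβ.le (by omega))
  have hε' : 0 < 1 / ε := by positivity
  have hp : 0 < β ^ n := by positivity
  have hp1 : 0 < β ^ n - 1 := by linarith
  set z := (betaMap β)^[n] t with hz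
  have hzt : t < z := lt_of_le_of_ne (ht.2 n) (hnp n hn0).symm
  have hz1 : z < 1 := (iterate_betaMap_mem β ht.1 n).2
  have hlow0 := iterate_betaMap_le (zero_le_one.trans hβ.le) ht.1 n
  -- The solution of x = t - (z - x) / β^n: lowering t inside its cylinder until T^n maps the new
  -- point to itself.
  set x := (β ^ n * t - z) / (β ^ n - 1) with hx
  have hx0 : 0 ≤ x := div_nonneg (by linarith) hp1.le
  have hxt : t - x = (z - t) / (β ^ n - 1) := by rw [hx]; field_simp; ring
  have hxt0 : 0 < t - x := by rw [hxt]; exact div_pos (by linarith) hp1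
  have hxe : x = t - (z - x) / β ^ n := by
    rw [eq_sub_iff_add_eq, ← eq_sub_iff_add_eq', hxt, div_eq_div_iff hp.ne' hp1.ne', hx]
    field_simp; ring
  have hfol : ∀ i ≤ n, (betaMap β)^[i] x = (betaMap β)^[i] t - (z - x) / β ^ (n - i) := by
    intro i hi
    have := (iterate_betaMap_lower hβ ht.1 hx0 (show x ≤ (betaMap β)^[n] t by linarith) hi).2
    rw [← hz, ← hxe] at this
    exact this
  have hxm : x ∈ Ico (0 : ℝ) 1 := ⟨hx0, by linarith [ht.1.2]⟩
  have hper : Function.IsPeriodicPt (betaMap β) n x := by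
    have := hfol n le_rfl
    rw [Nat.sub_self, pow_zero, div_one, ← hz, sub_sub_cancel] at this
    exact this
  have hdig : ∀ i < n, greedyDigit β x i = greedyDigit β t i := by
    intro i hi
    have h1 := hfol i hi.le
    have h2 := hfol (i + 1) hi
    have h3 := iterate_betaMap_mem β hxm (i + 1)
    rw [iterate_betaMap_succ β t] at h2
    have e : β ^ (n - i) = β * β ^ (n - (i + 1)) := by rw [← pow_succ']; congr 1; omega
    have h4 : (betaMap β)^[i + 1] x = β * (betaMap β)^[i] x - greedyDigit β t i := by
      rw [h1, h2, e]; field_simp; ring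
    rw [h4] at h3
    rw [greedyDigit, Int.floor_eq_iff]
    constructor <;> linarith [h3.1, h3.2]
  refine ⟨x, ⟨hball ?_, hxm, fun k => ?_⟩, by intro h; rw [h] at hxt0; linarith⟩
  · rw [Metric.mem_ball, Real.dist_eq, abs_sub_comm, abs_of_pos hxt0, hxt, div_lt_iff₀ hp1]
    have : ε * (1 / ε) < ε * (β ^ n - 1) := mul_lt_mul_of_pos_left (by linarith) hε
    rw [mul_one_div_cancel hε.ne'] at this
    linarith [ht.1.1]
  · rw [← hper.iterate_mod_apply k]
    set k' := k % n with hk'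
    have hk'n : k' < n := Nat.mod_lt _ (by omega)
    by_cases hk0 : k' = 0
    · rw [hk0]; rfl
    · obtain ⟨j, hj, h1, h2⟩ := hly k' hk0 hk'n
      refine (lt_of_greedyDigit_lt (j := j) hβ (fun i hi => ?_) ?_).le
      · rw [greedyDigit_iterate, hdig i (by omega), hdig _ (by omega), h1 i hi]
      · rw [greedyDigit_iterate, hdig j (by omega), hdig _ hj]; exact h2

/-! ### Isolated points near zero -/

/-- The point p has as period the first q + 1 digits of 1 with the last one lowered by one. A point
right of p follows 1 for q steps and then either uses the lowered digit, moving away from p, or the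
original digit, landing below `oneOrbit β (q + 1)`. The hypothesis `hgood` says that this bound is
at most the minimum of the orbit of p. -/
theorem exists_isolatedPoint {β : ℝ} {q : ℕ} (hβ : 1 < β) (h2 : 2 < β ^ (q + 1))
    (ha : 1 ≤ oneDigit β q)
    (hgood : ∀ i ≤ q, oneOrbit β (q + 1) ≤
      oneOrbit β i - β ^ i * (oneOrbit β (q + 1) / (β ^ (q + 1) - 1))) :
    ∃ t ∈ isolatedPoints (minimalPoints β), 0 < t ∧ ∀ i ≤ q, t < oneOrbit β i := by
  have hβ0 : 0 < β := by linarith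
  have ha' : (1 : ℝ) ≤ oneDigit β q := by exact_mod_cast ha
  obtain ⟨hf0, hf1⟩ := oneOrbit_mem β (q + 1)
  have hfs := oneOrbit_succ β q
  set f := oneOrbit β (q + 1) with hf
  set P := β ^ (q + 1) with hP
  have hP1 : 0 < P - 1 := by linarith
  set e := f / (P - 1) with he
  have he0 : 0 < e := div_pos hf0 hP1
  have heP : e * (P - 1) = f := div_mul_cancel₀ _ hP1.ne'
  set p := 1 - e with hp
  have hp0 : 0 < p := by
    rw [hp, sub_pos, he, div_lt_one hP1]; linarith
  have hpm : p ∈ Ico (0 : ℝ) 1 := ⟨hp0.le, by linarith⟩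
  have hpq : 0 < β ^ q := by positivity
  have hek : e ≤ oneOrbit β q / β ^ q := by
    rw [le_div_iff₀ hpq]
    have h3 : β * oneOrbit β q = f + oneDigit β q := by linarith
    have h4 : e * P ≤ f + 1 := by nlinarith
    rw [hP, pow_succ] at h4
    have : β * (e * β ^ q) ≤ β * oneOrbit β q := by linarith
    exact le_of_mul_le_mul_left this hβ0
  have horb : ∀ i ≤ q, (betaMap β)^[i] p = oneOrbit β i - β ^ i * e := by
    intro i hi
    rw [iterate_betaMap_near_one (k := q) hβ0 hpm.2 (by linarith) i hi, hp, sub_sub_cancel]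
  have hstep : ∀ y, β * (oneOrbit β q - β ^ q * (1 - y)) = p + P * (y - p) + (oneDigit β q - 1) := by
    intro y
    have h5 : β * oneOrbit β q = f + oneDigit β q := by linarith
    rw [hP, pow_succ] at heP ⊢
    rw [hp]
    linear_combination h5 - heP
  have hper : (betaMap β)^[q + 1] p = p := by
    rw [Function.iterate_succ_apply', iterate_betaMap_near_one (k := q) hβ0 hpm.2 (by linarith) q
      le_rfl, betaMap_eq_of_mem (k := oneDigit β q - 1)]
    · rw [hstep]; push_cast; ring
    · rw [hstep]; push_cast; constructor <;> linarith
  obtain ⟨i₀, hi₀, hmin⟩ := Finset.exists_min_image (Finset.range (q + 1))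
    (fun i => (betaMap β)^[i] p) ⟨0, by simp⟩
  have hi₀' : i₀ ≤ q := by rw [Finset.mem_range] at hi₀; omega
  have hft : f ≤ (betaMap β)^[i₀] p := by rw [horb i₀ hi₀']; exact hgood i₀ hi₀'
  refine ⟨(betaMap β)^[i₀] p, mem_isolatedPoints_of_escape hβ hpm (show q + 1 ≠ 0 by omega) hper rfl
    (by linarith) ?_ ?_, by linarith, ?_⟩
  · intro n
    rw [← Function.IsPeriodicPt.iterate_mod_apply (show Function.IsPeriodicPt (betaMap β) (q + 1) p
      from hper) n]
    exact hmin _ (Finset.mem_range.2 (Nat.mod_lt _ (Nat.succ_pos q)))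
  · intro y hy
    have hTy : (betaMap β)^[q + 1] y = betaMap β (oneOrbit β q - β ^ q * (1 - y)) := by
      rw [Function.iterate_succ_apply', iterate_betaMap_near_one (k := q) hβ0 hy.2
        (by linarith [hy.1]) q le_rfl]
    have hP0 : 0 < P * (y - p) := mul_pos (by linarith) (by linarith [hy.1])
    rcases lt_or_ge (p + P * (y - p)) 1 with h | h
    · right
      rw [hTy, betaMap_eq_of_mem (k := oneDigit β q - 1)]
      · rw [hstep]; push_cast; ring
      · rw [hstep]; push_cast; constructor <;> linarith
    · left
      have h6 : p + P * (y - p) - 1 < f := by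
        have : P * (y - p) < P * (1 - p) := mul_lt_mul_of_pos_left (by linarith [hy.2]) (by linarith)
        have h7 : P * (1 - p) = f + e := by rw [hp]; linarith
        linarith
      rw [hTy, betaMap_eq_of_mem (k := oneDigit β q)]
      · rw [hstep]; linarith
      · rw [hstep]; constructor <;> linarith
  · intro i hi
    refine (hmin i (Finset.mem_range.2 (by omega))).trans_lt ?_
    rw [horb i hi]
    have : 0 < β ^ i * e := by positivity
    linarith

/-- The condition on the orbit of one which produces an isolated point: at the first passage below
level `1 / β ^ m` the orbit falls below a quarter of this level. -/
theorem exists_isolatedPoint_of_passage {β : ℝ} {q m : ℕ} (hβ : 1 < β) (h2 : 2 < β ^ (q + 1))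
    (hq : oneOrbit β (q + 1) ≤ 1 / β ^ m / 4) (hfirst : ∀ i ≤ q, 1 / β ^ m < oneOrbit β i) :
    ∃ t ∈ isolatedPoints (minimalPoints β), 0 < t ∧ ∀ i ≤ q, t < oneOrbit β i := by
  have hβ0 : 0 < β := by linarith
  have hm : 0 < 1 / β ^ m := by positivity
  have hm1 : 1 / β ^ m ≤ 1 := div_le_one_of_le₀ (one_le_pow₀ hβ.le) (by positivity)
  have hfs := oneOrbit_succ β q
  have hf0 := (oneOrbit_mem β (q + 1)).1
  have ha : 1 ≤ oneDigit β q := by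
    by_contra! h
    have h0 : oneDigit β q = 0 := le_antisymm (by omega) (oneDigit_nonneg hβ0 q)
    rw [h0] at hfs
    have h3 := hfirst q le_rfl
    have : oneOrbit β q ≤ β * oneOrbit β q := le_mul_of_one_le_left (by linarith) hβ.le
    push_cast at hfs
    linarith
  refine exists_isolatedPoint hβ h2 ha fun i hi => ?_
  have ha' : (1 : ℝ) ≤ oneDigit β q := by exact_mod_cast ha
  have h3 := oneOrbit_div_pow_antitone hβ0 hi
  simp only at h3
  have hP : 0 < β ^ (q + 1) - 1 := by linarith
  -- Cylinder lengths decrease with the rank, and β times the q-th orbit point exceeds 1 because its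
  -- digit is nonzero. This makes the displacement of p from 1, seen at time i, at most half of the
  -- i-th orbit point.
  have h4 : β ^ i ≤ oneOrbit β i * β ^ (q + 1) := by
    rw [div_le_div_iff₀ (by positivity) (by positivity)] at h3
    have h5 : 1 ≤ β * oneOrbit β q := by linarith
    have h6 : 0 < β ^ i := by positivity
    rw [pow_succ]
    nlinarith
  have h7 := hfirst i hi
  have h8 : β ^ i * (oneOrbit β (q + 1) / (β ^ (q + 1) - 1)) ≤ oneOrbit β i / 2 := by
    rw [← mul_div_assoc, div_le_iff₀ hP]
    have h9 : oneOrbit β (q + 1) ≤ 1 / 4 := by linarith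
    have h10 : 0 < β ^ i := by positivity
    have h11 : 0 < oneOrbit β i := by linarith
    have h12 : β ^ i * oneOrbit β (q + 1) ≤ oneOrbit β i * β ^ (q + 1) * (1 / 4) :=
      mul_le_mul h4 h9 hf0.le (by positivity)
    have h13 : oneOrbit β i * 2 < oneOrbit β i * β ^ (q + 1) := mul_lt_mul_of_pos_left h2 h11
    linarith
  linarith

/-! ### The orbit of one as a function of the base -/

/-- The defect `1 - ∑_{i < n} a_i / x ^ (i + 1)`. -/
noncomputable def defect (a : ℕ → ℤ) (n : ℕ) (x : ℝ) : ℝ :=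
  1 - ∑ i ∈ Finset.range n, (a i : ℝ) / x ^ (i + 1)

theorem defect_succ (a : ℕ → ℤ) (n : ℕ) (x : ℝ) :
    defect a (n + 1) x = defect a n x - a n / x ^ (n + 1) := by
  rw [defect, defect, Finset.sum_range_succ]; ring

theorem oneOrbit_eq_defect {β : ℝ} (hβ : 0 < β) (n : ℕ) :
    oneOrbit β n = β ^ n * defect (oneDigit β) n β := by
  induction n with
  | zero => simp [oneOrbit, defect]
  | succ n ih => rw [oneOrbit_succ, ih, defect_succ, mul_sub, pow_succ]; field_simp

/-- Quasi-greedy digits are the unique integers keeping the orbit in (0, 1]. So bases with given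
first digits are found by controlling `defect` alone. -/
theorem oneDigit_eq_of_defect {x : ℝ} (hx : 0 < x) (a : ℕ → ℤ) {n : ℕ}
    (h : ∀ i ≤ n, x ^ i * defect a i x ∈ Ioc (0 : ℝ) 1) :
    (∀ i ≤ n, oneOrbit x i = x ^ i * defect a i x) ∧ ∀ i < n, oneDigit x i = a i := by
  have step : ∀ i < n, oneOrbit x i = x ^ i * defect a i x →
      oneDigit x i = a i ∧ oneOrbit x (i + 1) = x ^ (i + 1) * defect a (i + 1) x := by
    intro i hi h1
    have h2 := h (i + 1) hi
    have e : x ^ (i + 1) * defect a (i + 1) x = x * oneOrbit x i - a i := by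
      rw [h1, defect_succ, mul_sub, pow_succ]; field_simp
    rw [e] at h2 ⊢
    have : oneDigit x i = a i := by
      rw [oneDigit, sub_eq_iff_eq_add, Int.ceil_eq_iff]
      push_cast
      constructor <;> linarith [h2.1, h2.2]
    exact ⟨this, by rw [oneOrbit_succ, this]⟩
  have h1 : ∀ i ≤ n, oneOrbit x i = x ^ i * defect a i x := by
    intro i
    induction i with
    | zero => intro _; simp [oneOrbit, defect]
    | succ i ih => intro hi; exact (step i hi (ih (by omega))).2
  exact ⟨h1, fun i hi => (step i hi (h1 i hi.le)).1⟩

/-- The first digit alone, being at least 1, contributes this growth; the other terms also increase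
with the base. -/
theorem defect_sub_ge {a : ℕ → ℤ} (ha : ∀ i, 0 ≤ a i) (ha0 : 1 ≤ a 0) {n : ℕ} (hn : n ≠ 0)
    {x y B : ℝ} (hx : 0 < x) (hxy : x ≤ y) (hyB : y ≤ B) :
    (y - x) / B ^ 2 ≤ defect a n y - defect a n x := by
  obtain ⟨m, rfl⟩ := Nat.exists_eq_succ_of_ne_zero hn
  have hy : 0 < y := by linarith
  have hsum : ∑ i ∈ Finset.range m, ((a (i + 1) : ℝ) / y ^ (i + 1 + 1)) ≤
      ∑ i ∈ Finset.range m, ((a (i + 1) : ℝ) / x ^ (i + 1 + 1)) := by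
    refine Finset.sum_le_sum fun i _ => ?_
    have : (0 : ℝ) ≤ a (i + 1) := by exact_mod_cast ha (i + 1)
    gcongr
  have h0 : (1 : ℝ) ≤ a 0 := by exact_mod_cast ha0
  have h1 : (y - x) / B ^ 2 ≤ a 0 / x - a 0 / y := by
    have e : (a 0 : ℝ) / x - a 0 / y = a 0 * (y - x) / (x * y) := by field_simp
    rw [e]
    have : x * y ≤ B ^ 2 := by nlinarith
    have h3 : 0 ≤ y - x := by linarith
    gcongr
    nlinarith
  rw [defect, defect, Finset.sum_range_succ', Finset.sum_range_succ']
  simp only [zero_add, pow_one]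
  linarith

theorem hasSum_one_div_pow_succ {z : ℝ} (hz : 1 < z) :
    HasSum (fun i : ℕ => 1 / z ^ (i + 1)) (1 / (z - 1)) := by
  have h1 := (hasSum_geometric_of_lt_one (r := 1 / z) (by positivity)
    (by rw [div_lt_one (by linarith)]; exact hz)).mul_right (1 / z)
  have e : (1 - 1 / z)⁻¹ * (1 / z) = 1 / (z - 1) := by
    have : z - 1 ≠ 0 := by linarith
    field_simp
  rw [e] at h1
  convert! h1 using 2 with i
  rw [one_div_pow, pow_succ]; field_simp

/-- Replacing every digit by A leaves a difference of geometric series. -/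
theorem defect_sub_le {a : ℕ → ℤ} {A : ℝ} (hA : 0 ≤ A) (ha : ∀ i, (a i : ℝ) ≤ A) {n : ℕ}
    {x y c : ℝ} (hc : 1 < c) (hx : c ≤ x) (hxy : x ≤ y) :
    defect a n y - defect a n x ≤ A / (c - 1) ^ 2 * (y - x) := by
  have hd := (hasSum_one_div_pow_succ (z := x) (by linarith)).sub
    (hasSum_one_div_pow_succ (z := y) (by linarith))
  have hx0 : 0 < x := by linarith
  have hnn : ∀ i : ℕ, 0 ≤ 1 / x ^ (i + 1) - 1 / y ^ (i + 1) := by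
    intro i
    rw [sub_nonneg]; gcongr
  have h1 : ∑ i ∈ Finset.range n, (1 / x ^ (i + 1) - 1 / y ^ (i + 1)) ≤
      1 / (x - 1) - 1 / (y - 1) := sum_le_hasSum _ (fun i _ => hnn i) hd
  have h2 : 1 / (x - 1) - 1 / (y - 1) ≤ (y - x) / (c - 1) ^ 2 := by
    have e : 1 / (x - 1) - 1 / (y - 1) = (y - x) / ((x - 1) * (y - 1)) := by
      have : x - 1 ≠ 0 := by linarith
      have : y - 1 ≠ 0 := by linarith
      field_simp; ring
    rw [e]
    have : (c - 1) ^ 2 ≤ (x - 1) * (y - 1) := by nlinarith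
    have : 0 ≤ y - x := by linarith
    have : 0 < (c - 1) ^ 2 := by have : 0 < c - 1 := by linarith
                                 positivity
    gcongr
  calc defect a n y - defect a n x
      = ∑ i ∈ Finset.range n, (a i : ℝ) * (1 / x ^ (i + 1) - 1 / y ^ (i + 1)) := by
        rw [defect, defect, sub_sub_sub_cancel_left, ← Finset.sum_sub_distrib]
        exact Finset.sum_congr rfl fun i _ => by ring
    _ ≤ ∑ i ∈ Finset.range n, A * (1 / x ^ (i + 1) - 1 / y ^ (i + 1)) :=
        Finset.sum_le_sum fun i _ => mul_le_mul_of_nonneg_right (ha i) (hnn i)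
    _ = A * ∑ i ∈ Finset.range n, (1 / x ^ (i + 1) - 1 / y ^ (i + 1)) := by rw [Finset.mul_sum]
    _ ≤ A * ((y - x) / (c - 1) ^ 2) := mul_le_mul_of_nonneg_left (h1.trans h2) hA
    _ = A / (c - 1) ^ 2 * (y - x) := by ring

theorem defect_anti {a : ℕ → ℤ} (ha : ∀ i, 0 ≤ a i) {x : ℝ} (hx : 0 < x) :
    Antitone fun n => defect a n x := by
  refine antitone_nat_of_succ_le fun n => ?_
  rw [defect_succ]
  have : (0 : ℝ) ≤ a n := by exact_mod_cast ha n
  have : 0 ≤ (a n : ℝ) / x ^ (n + 1) := by positivity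
  linarith

theorem oneDigit_zero_pos {β : ℝ} (hβ : 1 < β) : 1 ≤ oneDigit β 0 := by
  have : 1 < ⌈β * oneOrbit β 0⌉ := by rw [oneOrbit, mul_one, Int.lt_ceil]; exact_mod_cast hβ
  rw [oneDigit]; omega

theorem oneDigit_le {β : ℝ} (hβ : 0 < β) (n : ℕ) : (oneDigit β n : ℝ) ≤ β := by
  have h1 := (oneOrbit_mem β (n + 1)).1
  have h2 := (oneOrbit_mem β n).2
  rw [oneOrbit_succ] at h1
  nlinarith

/-- To the left of a base `b` there are, at arbitrarily small scales, intervals of bases which share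
the first digits with `b` and whose orbit of one is much smaller in a fixed proportion. -/
theorem exists_parameter_hole {b η : ℝ} (hb : 1 < b) (hη : 0 < η) :
    ∃ κ > 0, κ ≤ 1 ∧ ∀ ε > 0, ∃ Q : ℕ, ∀ n ≥ Q, ∃ c, b - ε < c ∧ 1 < c ∧ c < b ∧
      ∀ x, c < x → x < b → x ≤ c + κ * (b - c) →
        (∀ i < n, oneDigit x i = oneDigit b i) ∧ oneOrbit x n ≤ η * oneOrbit b n := by
  have hb0 : 0 < b := by linarith
  set c₀ := (1 + b) / 2 with hc₀
  have hc1 : 1 < c₀ := by rw [hc₀]; linarith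
  have hc0b : c₀ < b := by rw [hc₀]; linarith
  set D := b / (c₀ - 1) ^ 2 with hD
  have hD0 : 0 < D := div_pos hb0 (pow_pos (by linarith) 2)
  set a := oneDigit b with ha
  have ha0 : ∀ i, 0 ≤ a i := fun i => oneDigit_nonneg hb0 i
  have haD : ∀ i, (a i : ℝ) ≤ b := fun i => oneDigit_le hb0 i
  -- D bounds the growth of the defect from above and 1 / b^2 from below. Starting at a zero c, a
  -- fraction κ of the way to b thus leaves at most D κ b^2 ≤ η times the defect at b.
  refine ⟨min 1 (η / (D * b ^ 2)), by positivity, min_le_left _ _, fun ε hε => ?_⟩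
  set κ := min 1 (η / (D * b ^ 2)) with hκ
  have hκ0 : 0 < κ := by positivity
  have hκD : D * κ * b ^ 2 ≤ η := by
    have h1 : κ ≤ η / (D * b ^ 2) := min_le_right _ _
    rw [le_div_iff₀ (by positivity)] at h1
    linarith
  set c₁ := max c₀ (b - ε) with hc₁
  have hc₁b : c₁ < b := max_lt hc0b (by linarith)
  have hc₁0 : c₀ ≤ c₁ := le_max_left _ _
  have hpos : 0 < (b - c₁) / b ^ 2 := div_pos (by linarith) (by positivity)
  obtain ⟨Q, hQ⟩ := exists_pow_lt_of_lt_one (y := b⁻¹) hpos (inv_lt_one_of_one_lt₀ hb)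
  refine ⟨Q + 1, fun n hn => ?_⟩
  have hn0 : n ≠ 0 := by omega
  have hdb : ∀ i, defect a i b = oneOrbit b i / b ^ i := by
    intro i; rw [oneOrbit_eq_defect hb0 i, ← ha]; field_simp
  have hnb : defect a n b < (b - c₁) / b ^ 2 := by
    refine lt_of_le_of_lt ?_ hQ
    rw [hdb, inv_pow, ← one_div]
    have h1 : b ^ Q ≤ b ^ n := pow_le_pow_right₀ hb.le (by omega)
    exact div_le_div₀ zero_le_one (oneOrbit_mem b n).2 (by positivity) h1
  have hneg : defect a n c₁ < 0 := by
    have := defect_sub_ge ha0 (oneDigit_zero_pos hb) hn0 (by linarith : 0 < c₁) hc₁b.le le_rfl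
    linarith
  have hposb : 0 < defect a n b := by
    rw [hdb]; exact div_pos (oneOrbit_mem b n).1 (by positivity)
  have hcont : ContinuousOn (defect a n) (Icc c₁ b) := by
    unfold defect
    refine continuousOn_const.sub (continuousOn_finsetSum _ fun i _ => ?_)
    refine continuousOn_const.div (continuousOn_id.pow _) fun x hx => ?_
    have : 0 < x := by linarith [hx.1]
    exact (pow_pos this _).ne'
  -- This zero of the defect is the left end of the set of bases below b sharing the first n digits.
  obtain ⟨c, ⟨hc2, hc3⟩, hc4⟩ := intermediate_value_Icc hc₁b.le hcont ⟨hneg.le, hposb.le⟩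
  have hc2' : c₁ < c := lt_of_le_of_ne hc2 (by rintro rfl; linarith)
  have hc3' : c < b := lt_of_le_of_ne hc3 (by rintro rfl; linarith)
  refine ⟨c, by linarith [le_max_right c₀ (b - ε)], by linarith, hc3', fun x hx1 hx2 hx3 => ?_⟩
  have hx0 : 0 < x := by linarith
  have hmono : ∀ i, ∀ u v : ℝ, 0 < u → u ≤ v → v ≤ b → i ≠ 0 → (v - u) / b ^ 2 ≤
      defect a i v - defect a i u :=
    fun i u v h1 h2 h3 hi => defect_sub_ge ha0 (oneDigit_zero_pos hb) hi h1 h2 h3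
  have hxn : 0 < defect a n x := by
    have h1 := hmono n c x (by linarith) hx1.le hx2.le hn0
    have h2 : 0 < (x - c) / b ^ 2 := div_pos (by linarith) (by positivity)
    linarith
  obtain ⟨h1, h2⟩ := oneDigit_eq_of_defect hx0 a (n := n) (by
    intro i hi
    have hxi : 0 < defect a i x := hxn.trans_le (defect_anti ha0 hx0 hi)
    refine ⟨mul_pos (by positivity) hxi, ?_⟩
    rcases Nat.eq_zero_or_pos i with rfl | hi0
    · simp [defect]
    · have h1 := hmono i x b hx0 hx2.le le_rfl (by omega)
      have h2 : 0 ≤ (b - x) / b ^ 2 := div_nonneg (by linarith) (by positivity)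
      have h3 : defect a i x ≤ 1 / b ^ i := by
        have : defect a i b ≤ 1 / b ^ i := by rw [hdb]; gcongr; exact (oneOrbit_mem b i).2
        linarith
      calc x ^ i * defect a i x ≤ b ^ i * (1 / b ^ i) := by gcongr
        _ = 1 := by field_simp)
  refine ⟨h2, ?_⟩
  rw [h1 n le_rfl, oneOrbit_eq_defect hb0 n]
  have h3 := defect_sub_le hb0.le haD (n := n) hc1 (by linarith : c₀ ≤ c) hx1.le
  have h4 := hmono n c b (by linarith) hc3 le_rfl hn0
  rw [hc4, sub_zero] at h3 h4
  have h5 : defect a n x ≤ η * defect a n b := by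
    calc defect a n x ≤ D * (x - c) := h3
      _ ≤ D * (κ * (b - c)) := by gcongr; linarith
      _ = D * κ * b ^ 2 * ((b - c) / b ^ 2) := by field_simp
      _ ≤ η * ((b - c) / b ^ 2) :=
          mul_le_mul_of_nonneg_right hκD (div_nonneg (by linarith) (by positivity))
      _ ≤ η * defect a n b := by gcongr
  calc x ^ n * defect a n x ≤ b ^ n * (η * defect a n b) := by gcongr
    _ = η * (b ^ n * defect a n b) := by ring

/-- A set of bases is null if every base in it has, for infinitely many `n`, the property that no
base which shares its first `n` digits and has a much smaller `n`-th point in the orbit of one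
belongs to the set. -/
theorem volume_eq_zero_of_oneOrbit {S : Set ℝ} (hS : S ⊆ Ioi 1) {η : ℝ} (hη : 0 < η)
    (h : ∀ b ∈ S, ∀ Q : ℕ, ∃ n ≥ Q, ∀ x, 1 < x → x < b → (∀ i < n, oneDigit x i = oneDigit b i) →
      oneOrbit x n ≤ η * oneOrbit b n → x ∉ S) : volume S = 0 := by
  refine volume_eq_zero_of_porous fun b hbS => ?_
  have hb : 1 < b := hS hbS
  obtain ⟨κ, hκ0, hκ1, hκ⟩ := exists_parameter_hole hb hη
  refine ⟨4 / κ, fun ε hε => ?_⟩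
  obtain ⟨Q, hQ⟩ := hκ ε hε
  obtain ⟨n, hnQ, hn⟩ := h b hbS Q
  obtain ⟨c, hc1, hc2, hc3, hc⟩ := hQ n hnQ
  have hbc : 0 < b - c := by linarith
  have hκb : κ * (b - c) ≤ b - c := mul_le_of_le_one_left hbc.le hκ1
  have hκp : 0 < κ * (b - c) := by positivity
  refine ⟨c + κ * (b - c) / 2, κ * (b - c) / 4, by positivity, by linarith, ?_, fun y hy => ?_⟩
  · rw [show 4 / κ * (κ * (b - c) / 4) = b - c by field_simp, abs_le]
    constructor <;> linarith
  · rw [abs_le] at hy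
    obtain ⟨h1, h2⟩ := hc y (by linarith) (by linarith) (by linarith)
    exact hn y (by linarith) (by linarith) h1 h2

/-- Together with the converse `oneOrbit_le_of_oneDigit_eq_zero`, this turns being below level
β^(-m) into a run of m zero digits, a condition that transfers between bases with common digits. -/
theorem oneDigit_eq_zero_of_oneOrbit_le {β : ℝ} (hβ : 1 < β) {m : ℕ} :
    ∀ {i : ℕ}, oneOrbit β i ≤ 1 / β ^ m → ∀ j < m, oneDigit β (i + j) = 0 := by
  have hβ0 : 0 < β := by linarith
  induction m with
  | zero => intro i _ j hj; omega
  | succ m ih =>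
    intro i hi j hj
    have h0 := (oneOrbit_mem β i).1
    have h1 : β * oneOrbit β i ≤ 1 / β ^ m := by
      have := mul_le_mul_of_nonneg_left hi hβ0.le
      refine this.trans_eq ?_
      rw [pow_succ]; field_simp
    have h2 : (1 : ℝ) / β ^ m ≤ 1 := div_le_one_of_le₀ (one_le_pow₀ hβ.le) (by positivity)
    have h3 : oneDigit β i = 0 := by
      rw [oneDigit, sub_eq_zero, Int.ceil_eq_iff]
      have : 0 < β * oneOrbit β i := by positivity
      constructor <;> push_cast <;> linarith
    cases j with
    | zero => exact h3
    | succ j =>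
      have := ih (i := i + 1) (by rw [oneOrbit_succ, h3]; simpa using h1) j (by omega)
      rw [← this]; congr 1; omega

theorem oneOrbit_le_of_oneDigit_eq_zero {β : ℝ} (hβ : 1 < β) {m i : ℕ}
    (h : ∀ j < m, oneDigit β (i + j) = 0) : oneOrbit β i ≤ 1 / β ^ m := by
  have key : ∀ k ≤ m, oneOrbit β (i + k) = β ^ k * oneOrbit β i := by
    intro k
    induction k with
    | zero => simp
    | succ k ih =>
      intro hk
      rw [← add_assoc, oneOrbit_succ, h k (by omega), ih (by omega), pow_succ]
      push_cast; ring
  have := (oneOrbit_mem β (i + m)).2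
  rw [key m le_rfl] at this
  rw [le_div_iff₀' (by positivity)]
  exact this

/-- Almost every base: the orbit of one comes arbitrarily close to zero. -/
theorem ae_oneOrbit_small : ∀ᵐ β : ℝ, 1 < β → ∀ m : ℕ, ∃ n, oneOrbit β n ≤ 1 / β ^ m := by
  have key : ∀ m B : ℕ, ∀ᵐ β : ℝ, β ∉ {β : ℝ | 1 < β ∧ β ≤ B ∧ ∀ n, 1 / β ^ m < oneOrbit β n} := by
    intro m B
    refine measure_eq_zero_iff_ae_notMem.1 ?_
    rcases Nat.eq_zero_or_pos B with rfl | hB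
    · convert! measure_empty (μ := (volume : Measure ℝ))
      ext x
      simp only [mem_ofPred_eq, mem_empty_iff_false, iff_false]
      rintro ⟨h1, h2, -⟩
      push_cast at h2; linarith
    refine volume_eq_zero_of_oneOrbit (fun β h => h.1) (η := 1 / (B : ℝ) ^ m) (by positivity) ?_
    rintro b ⟨hb1, hbB, hb⟩ Q
    refine ⟨Q, le_rfl, fun x hx1 hxb _ hxo hxS => ?_⟩
    have h1 := hxS.2.2 Q
    have h2 : 1 / (B : ℝ) ^ m * oneOrbit b Q ≤ 1 / (B : ℝ) ^ m :=
      mul_le_of_le_one_right (by positivity) (oneOrbit_mem b Q).2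
    have h3 : 1 / (B : ℝ) ^ m ≤ 1 / x ^ m := by
      have : x ≤ B := by linarith
      gcongr
    linarith
  filter_upwards [ae_all_iff.2 fun m => ae_all_iff.2 (key m)] with β hβ h1 m
  obtain ⟨B, hB⟩ := exists_nat_ge β
  have := hβ m B
  simp only [not_and, not_forall, not_lt] at this
  exact this h1 hB

/-- Almost every base: infinitely often the first passage below a level goes far below it. -/
theorem ae_oneOrbit_passage : ∀ᵐ β : ℝ, 1 < β → ∀ M : ℕ, ∃ m ≥ M, ∃ q,
    oneOrbit β q ≤ 1 / β ^ m / 4 ∧ ∀ i < q, 1 / β ^ m < oneOrbit β i := by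
  have key : ∀ M : ℕ, ∀ᵐ β : ℝ, β ∉ {β : ℝ | 1 < β ∧ (∀ m : ℕ, ∃ n, oneOrbit β n ≤ 1 / β ^ m) ∧
      ∀ m ≥ M, ∀ q, (∀ i < q, 1 / β ^ m < oneOrbit β i) → 1 / β ^ m / 4 < oneOrbit β q} := by
    intro M
    refine measure_eq_zero_iff_ae_notMem.1 ?_
    refine volume_eq_zero_of_oneOrbit (fun β h => h.1) (η := 1 / 4) (by norm_num) ?_
    rintro b ⟨hb1, hb2, hb3⟩ Q
    have hb0 : 0 < b := by linarith
    obtain ⟨i₀, -, hi₀⟩ := Finset.exists_min_image (Finset.range (Q + 1)) (oneOrbit b) ⟨0, by simp⟩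
    obtain ⟨m₀, hm₀⟩ := exists_pow_lt_of_lt_one (y := b⁻¹) (oneOrbit_mem b i₀).1
      (inv_lt_one_of_one_lt₀ hb1)
    -- The level lies below the first Q + 1 orbit points, so its first passage occurs after time Q.
    set m := max m₀ M with hm
    have hmi : 1 / b ^ m < oneOrbit b i₀ := by
      refine lt_of_le_of_lt ?_ hm₀
      rw [inv_pow, ← one_div]
      exact div_le_div_of_nonneg_left zero_le_one (by positivity)
        (pow_le_pow_right₀ hb1.le (le_max_left _ _))
    classical
    obtain ⟨hq, hqmin⟩ : oneOrbit b (Nat.find (hb2 m)) ≤ 1 / b ^ m ∧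
        ∀ i < Nat.find (hb2 m), 1 / b ^ m < oneOrbit b i :=
      ⟨Nat.find_spec (hb2 m), fun i hi => not_le.1 (Nat.find_min (hb2 m) hi)⟩
    set q := Nat.find (hb2 m) with hqdef
    have hqQ : Q < q := by
      by_contra! h
      have := hi₀ q (Finset.mem_range.2 (by omega))
      linarith
    refine ⟨q, hqQ.le, fun x hx1 hxb hdig hxo hxS => ?_⟩
    obtain ⟨k, hk⟩ : ∃ k, q = k + 1 := ⟨q - 1, by omega⟩
    have hdk : oneDigit b k ≠ 0 := by
      intro h0
      have h1 := oneOrbit_succ b k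
      rw [h0, ← hk] at h1
      have h2 := hqmin k (by omega)
      have h3 : oneOrbit b k ≤ b * oneOrbit b k :=
        le_mul_of_one_le_left (oneOrbit_mem b k).1.le hb1.le
      push_cast at h1
      linarith
    -- The first passage of x is not earlier than q: an earlier one would be a run of m zeros. It
    -- cannot cover place k = q - 1, whose digit is nonzero, so it lies in the digits shared with b,
    -- where it would be an earlier passage of b.
    have h1 := hxS.2.2 m (le_max_right _ _) q (by
      intro i hi
      by_contra! hle
      have hz := oneDigit_eq_zero_of_oneOrbit_le hx1 hle
      rcases le_or_gt q (i + m) with h | h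
      · have := hz (k - i) (by omega)
        rw [show i + (k - i) = k by omega, hdig k (by omega)] at this
        exact hdk this
      · have := oneOrbit_le_of_oneDigit_eq_zero hb1 (m := m) (i := i) (fun j hj => by
          rw [← hdig (i + j) (by omega)]; exact hz j hj)
        linarith [hqmin i hi])
    have hx0 : 0 < x := by linarith
    have h2 : 1 / b ^ m ≤ 1 / x ^ m := by gcongr
    linarith
  filter_upwards [ae_all_iff.2 key, ae_oneOrbit_small] with β hβ h1 hβ1 M
  have := hβ M
  simp only [not_and, not_forall, not_lt] at this
  obtain ⟨m, hm, q, hq1, hq2⟩ := this hβ1 (h1 hβ1)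
  exact ⟨m, hm, q, hq2, hq1⟩

theorem ae_infinite_isolatedPoints : ∀ᵐ β : ℝ, 1 < β → ∀ δ : ℝ, 0 < δ →
    (isolatedPoints (minimalPoints β) ∩ Ioo 0 δ).Infinite := by
  filter_upwards [ae_oneOrbit_small, ae_oneOrbit_passage] with β hsmall hpass hβ
  have hβ0 : 0 < β := by linarith
  have hex : ∀ δ : ℝ, 0 < δ → ∃ t ∈ isolatedPoints (minimalPoints β), 0 < t ∧ t < δ := by
    intro δ hδ
    obtain ⟨m₁, hm₁⟩ := exists_pow_lt_of_lt_one (y := β⁻¹) hδ (inv_lt_one_of_one_lt₀ hβ)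
    obtain ⟨n₁, hn₁⟩ := hsmall hβ m₁
    have hn₁δ : oneOrbit β n₁ < δ := by
      refine hn₁.trans_lt ?_
      rwa [one_div, ← inv_pow]
    obtain ⟨Q, hQ⟩ := pow_unbounded_of_one_lt 2 hβ
    obtain ⟨i₀, -, hi₀⟩ := Finset.exists_min_image (Finset.range (Q + n₁ + 1)) (oneOrbit β)
      ⟨0, by simp⟩
    obtain ⟨M, hM⟩ := exists_pow_lt_of_lt_one (y := β⁻¹) (oneOrbit_mem β i₀).1
      (inv_lt_one_of_one_lt₀ hβ)
    obtain ⟨m, hmM, q, hq, hfirst⟩ := hpass hβ M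
    have hmi : 1 / β ^ m < oneOrbit β i₀ := by
      refine lt_of_le_of_lt ?_ hM
      rw [inv_pow, ← one_div]
      exact div_le_div_of_nonneg_left zero_le_one (by positivity) (pow_le_pow_right₀ hβ.le hmM)
    -- The passage comes after time n₁, when the orbit of 1 was already below δ, so the isolated
    -- point obtained is below δ too.
    have hqQ : Q + n₁ < q := by
      by_contra! h
      have h1 := hi₀ q (Finset.mem_range.2 (by omega))
      have : 0 < 1 / β ^ m := by positivity
      linarith
    obtain ⟨k, rfl⟩ : ∃ k, q = k + 1 := ⟨q - 1, by omega⟩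
    obtain ⟨t, ht, ht0, htf⟩ := exists_isolatedPoint_of_passage hβ
      (hQ.trans_le (pow_le_pow_right₀ hβ.le (by omega))) hq (fun i hi => hfirst i (by omega))
    exact ⟨t, ht, ht0, (htf n₁ (by omega)).trans hn₁δ⟩
  intro δ hδ hfin
  obtain ⟨t₀, ht₀, ht₀0, ht₀δ⟩ := hex δ hδ
  obtain ⟨s, hs, hsmin⟩ := Set.exists_min_image _ id hfin ⟨t₀, ht₀, ht₀0, ht₀δ⟩
  obtain ⟨t, ht, ht0, hts⟩ := hex s hs.2.1
  have := hsmin t ⟨ht, ht0, hts.trans hs.2.2⟩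
  simp only [id] at this
  linarith

/-! ### Values of sequences of digits given by their partial sums -/

/-- The sequence `S` has bounded increments. -/
def BddIncrements (S : ℕ → ℤ) : Prop := ∃ C : ℝ, ∀ i, |((S (i + 1) - S i : ℤ) : ℝ)| ≤ C

/-- The value in base `β` of the sequence of digits with partial sums `S`. -/
noncomputable def sumValue (β : ℝ) (S : ℕ → ℤ) : ℝ :=
  ∑' i : ℕ, ((S (i + 1) - S i : ℤ) : ℝ) / β ^ (i + 1)

theorem summable_const_div_pow {β : ℝ} (hβ : 1 < β) (C : ℝ) :
    Summable fun i : ℕ => C / β ^ (i + 1) := by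
  have h := (summable_geometric_of_lt_one (r := 1 / β) (by positivity)
      (by rw [div_lt_one (by linarith)]; exact hβ)).mul_left (C / β)
  refine h.congr fun i => ?_
  rw [one_div_pow, pow_succ]; field_simp

theorem summable_sumValue {β : ℝ} (hβ : 1 < β) {S : ℕ → ℤ} (hS : BddIncrements S) :
    Summable fun i : ℕ => ((S (i + 1) - S i : ℤ) : ℝ) / β ^ (i + 1) := by
  obtain ⟨C, hC⟩ := hS
  refine Summable.of_norm_bounded (summable_const_div_pow hβ C) fun i => ?_
  rw [Real.norm_eq_abs, abs_div, abs_of_pos (show 0 < β ^ (i + 1) by positivity)]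
  gcongr
  exact hC i

theorem BddIncrements.sub {S S' : ℕ → ℤ} (h : BddIncrements S) (h' : BddIncrements S') :
    BddIncrements fun n => S n - S' n := by
  obtain ⟨C, hC⟩ := h
  obtain ⟨C', hC'⟩ := h'
  refine ⟨C + C', fun i => ?_⟩
  have e : (((S (i + 1) - S' (i + 1)) - (S i - S' i) : ℤ) : ℝ) =
      ((S (i + 1) - S i : ℤ) : ℝ) - ((S' (i + 1) - S' i : ℤ) : ℝ) := by push_cast; ring
  rw [e]
  exact (abs_sub _ _).trans (add_le_add (hC i) (hC' i))

theorem sumValue_sub {β : ℝ} (hβ : 1 < β) {S S' : ℕ → ℤ} (h : BddIncrements S)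
    (h' : BddIncrements S') :
    sumValue β (fun n => S n - S' n) = sumValue β S - sumValue β S' := by
  rw [sumValue, sumValue, sumValue, ← (summable_sumValue hβ h).tsum_sub (summable_sumValue hβ h')]
  refine tsum_congr fun i => ?_
  push_cast; ring

/-- Summation by parts. -/
theorem le_sumValue {β : ℝ} (hβ : 1 < β) {D : ℕ → ℤ} (h : BddIncrements D) (h0 : D 0 = 0)
    (hD : ∀ n, 0 ≤ D n) (m : ℕ) : (β - 1) * D m / β ^ (m + 1) ≤ sumValue β D := by
  have hpart : ∀ n : ℕ, ∑ i ∈ Finset.range n, ((D (i + 1) - D i : ℤ) : ℝ) / β ^ (i + 1) =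
      D n / β ^ n + ∑ i ∈ Finset.range n, (β - 1) * D i / β ^ (i + 1) := by
    intro n
    induction n with
    | zero => simp [h0]
    | succ n ih =>
      rw [Finset.sum_range_succ, Finset.sum_range_succ, ih, pow_succ]
      have : β ≠ 0 := by linarith
      push_cast; field_simp; ring
  refine ge_of_tendsto (summable_sumValue hβ h).hasSum.tendsto_sum_nat ?_
  filter_upwards [eventually_gt_atTop m] with n hn
  rw [hpart n]
  have hnn : ∀ i, (0 : ℝ) ≤ D i := fun i => by exact_mod_cast hD i
  have hβ1 : 0 < β - 1 := by linarith
  have h1 : (β - 1) * D m / β ^ (m + 1) ≤ ∑ i ∈ Finset.range n, (β - 1) * D i / β ^ (i + 1) :=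
    Finset.single_le_sum (f := fun i => (β - 1) * (D i : ℝ) / β ^ (i + 1))
      (fun i _ => div_nonneg (mul_nonneg hβ1.le (hnn i)) (by positivity))
      (Finset.mem_range.2 hn)
  have h2 : 0 ≤ (D n : ℝ) / β ^ n := div_nonneg (hnn n) (by positivity)
  linarith

/-- Partial sums rather than digits are compared, so the order is the same in every base and no
admissibility of the sequences is needed. -/
theorem sumValue_mono {β : ℝ} (hβ : 1 < β) {S S' : ℕ → ℤ} (h : BddIncrements S)
    (h' : BddIncrements S') (h0 : S 0 = S' 0) (hle : ∀ n, S n ≤ S' n) :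
    sumValue β S ≤ sumValue β S' := by
  have := le_sumValue hβ (h'.sub h) (by simp [h0]) (fun n => sub_nonneg.2 (hle n)) 0
  rw [sumValue_sub hβ h' h] at this
  simp only [h0, sub_self, Int.cast_zero, mul_zero, zero_div] at this
  linarith

theorem sumValue_lt {β : ℝ} (hβ : 1 < β) {S S' : ℕ → ℤ} (h : BddIncrements S)
    (h' : BddIncrements S') (h0 : S 0 = S' 0) (hle : ∀ n, S n ≤ S' n) {m : ℕ} (hm : S m < S' m) :
    sumValue β S < sumValue β S' := by
  have := le_sumValue hβ (h'.sub h) (by simp [h0]) (fun n => sub_nonneg.2 (hle n)) m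
  rw [sumValue_sub hβ h' h] at this
  have h1 : (0 : ℝ) < ((S' m - S m : ℤ) : ℝ) := by exact_mod_cast sub_pos.2 hm
  have : 0 < (β - 1) * ((S' m - S m : ℤ) : ℝ) / β ^ (m + 1) :=
    div_pos (mul_pos (by linarith) h1) (by positivity)
  linarith

theorem sumValue_nonneg {β : ℝ} (hβ : 1 < β) {S : ℕ → ℤ} (h : Monotone S) : 0 ≤ sumValue β S := by
  refine tsum_nonneg fun i => div_nonneg ?_ (by positivity)
  exact_mod_cast sub_nonneg.2 (h (Nat.le_succ i))

theorem sumValue_shift {β : ℝ} (hβ : 1 < β) {S : ℕ → ℤ} (h : BddIncrements S) (N : ℕ) (c : ℤ) :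
    sumValue β S = ∑ i ∈ Finset.range N, ((S (i + 1) - S i : ℤ) : ℝ) / β ^ (i + 1) +
      sumValue β (fun n => S (N + n) - c) / β ^ N := by
  rw [sumValue, ← (summable_sumValue hβ h).sum_add_tsum_nat_add N, sumValue, ← tsum_div_const]
  congr 1
  refine tsum_congr fun i => ?_
  rw [div_div, ← pow_add, sub_sub_sub_cancel_right, ← add_assoc, add_comm i N,
    show N + i + 1 = i + 1 + N by ring]

/-- The value in base `β` of a sequence with one nonzero digit. -/
theorem sumValue_indicator (β : ℝ) : sumValue β (fun n => if n = 0 then 0 else 1) = 1 / β := by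
  rw [sumValue, tsum_eq_single 0]
  · simp
  · intro i hi; simp [hi]

theorem bddIncrements_indicator : BddIncrements fun n => if n = 0 then 0 else 1 := by
  refine ⟨1, fun i => ?_⟩
  by_cases h : i = 0 <;> simp [h]

/-- If `S` and `S'` agree up to `N` then their values nearly agree. -/
theorem sumValue_le_of_agree {β : ℝ} (hβ : 1 < β) {S S' : ℕ → ℤ} (h : BddIncrements S)
    (h' : BddIncrements S') {N : ℕ} (hN : ∀ n ≤ N, S n = S' n)
    (hmono : ∀ n ≥ N, S' n ≤ S' (n + 1)) (c : ℤ) :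
    sumValue β S ≤ sumValue β S' + sumValue β (fun n => S (N + n) - c) / β ^ N := by
  rw [sumValue_shift hβ h N c, sumValue_shift hβ h' N 0]
  have h1 : ∑ i ∈ Finset.range N, ((S (i + 1) - S i : ℤ) : ℝ) / β ^ (i + 1) =
      ∑ i ∈ Finset.range N, ((S' (i + 1) - S' i : ℤ) : ℝ) / β ^ (i + 1) := by
    refine Finset.sum_congr rfl fun i hi => ?_
    rw [Finset.mem_range] at hi
    rw [hN i (by omega), hN (i + 1) (by omega)]
  have h2 : 0 ≤ sumValue β (fun n => S' (N + n) - 0) / β ^ N := by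
    refine div_nonneg (sumValue_nonneg hβ ?_) (by positivity)
    refine monotone_nat_of_le_succ fun n => ?_
    have := hmono (N + n) (by omega)
    simp only [sub_zero]
    exact this
  rw [h1]; linarith

/-! ### Rotation sequences -/

/-- Partial sums of the upper rotation sequence with slope `γ` and intercept `u`. -/
noncomputable def ceilSum (γ u : ℝ) (n : ℕ) : ℤ := ⌈u + n * γ⌉ - ⌈u⌉

/-- Partial sums of the lower rotation sequence with slope `γ` and intercept `u`. -/
noncomputable def floorSum (γ u : ℝ) (n : ℕ) : ℤ := ⌊u + n * γ⌋ - ⌊u⌋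

theorem bddIncrements_ceilSum (γ u : ℝ) : BddIncrements (ceilSum γ u) := by
  refine ⟨|γ| + 1, fun i => ?_⟩
  simp only [ceilSum]
  push_cast
  have h1 := Int.le_ceil (u + (i : ℝ) * γ)
  have h2 := Int.ceil_lt_add_one (u + (i : ℝ) * γ)
  have h3 := Int.le_ceil (u + ((i : ℝ) + 1) * γ)
  have h4 := Int.ceil_lt_add_one (u + ((i : ℝ) + 1) * γ)
  have h5 := le_abs_self γ
  have h6 := neg_abs_le γ
  rw [abs_le]; constructor <;> linarith

theorem bddIncrements_floorSum (γ u : ℝ) : BddIncrements (floorSum γ u) := by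
  refine ⟨|γ| + 1, fun i => ?_⟩
  simp only [floorSum]
  push_cast
  have h1 := Int.floor_le (u + (i : ℝ) * γ)
  have h2 := Int.lt_floor_add_one (u + (i : ℝ) * γ)
  have h3 := Int.floor_le (u + ((i : ℝ) + 1) * γ)
  have h4 := Int.lt_floor_add_one (u + ((i : ℝ) + 1) * γ)
  have h5 := le_abs_self γ
  have h6 := neg_abs_le γ
  rw [abs_le]; constructor <;> linarith

theorem ceilSum_zero (γ u : ℝ) : ceilSum γ u 0 = 0 := by simp [ceilSum]

theorem floorSum_zero (γ u : ℝ) : floorSum γ u 0 = 0 := by simp [floorSum]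

theorem ceilSum_zero_right (γ : ℝ) (n : ℕ) : ceilSum γ 0 n = ⌈n * γ⌉ := by simp [ceilSum]

theorem floorSum_zero_right (γ : ℝ) (n : ℕ) : floorSum γ 0 n = ⌊n * γ⌋ := by simp [floorSum]

theorem ceilSum_le (γ u : ℝ) (n : ℕ) : ceilSum γ u n ≤ ⌈n * γ⌉ := by
  have := Int.ceil_add_le u (n * γ)
  rw [ceilSum]; omega

theorem le_ceilSum (γ u : ℝ) (n : ℕ) : ⌊n * γ⌋ ≤ ceilSum γ u n := by
  have : ⌈u + (⌊(n : ℝ) * γ⌋ : ℝ)⌉ ≤ ⌈u + n * γ⌉ :=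
    Int.ceil_mono (by linarith [Int.floor_le ((n : ℝ) * γ)])
  rw [Int.ceil_add_intCast] at this
  rw [ceilSum]; omega

theorem floorSum_le (γ u : ℝ) (n : ℕ) : floorSum γ u n ≤ ⌈n * γ⌉ := by
  have : ⌊u + n * γ⌋ ≤ ⌊u + (⌈(n : ℝ) * γ⌉ : ℝ)⌋ :=
    Int.floor_mono (by linarith [Int.le_ceil ((n : ℝ) * γ)])
  rw [Int.floor_add_intCast] at this
  rw [floorSum]; omega

theorem ceilSum_monotone {γ : ℝ} (hγ : 0 ≤ γ) (u : ℝ) : Monotone (ceilSum γ u) := by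
  intro m n h
  have : ⌈u + m * γ⌉ ≤ ⌈u + n * γ⌉ := Int.ceil_mono (by gcongr)
  rw [ceilSum, ceilSum]; omega

theorem floorSum_monotone {γ : ℝ} (hγ : 0 ≤ γ) (u : ℝ) : Monotone (floorSum γ u) := by
  intro m n h
  have : ⌊u + m * γ⌋ ≤ ⌊u + n * γ⌋ := Int.floor_mono (by gcongr)
  rw [floorSum, floorSum]; omega

/-- The value of the upper rotation sequence with slope `γ` and intercept `u`. -/
noncomputable def upperValue (β γ u : ℝ) : ℝ := sumValue β (ceilSum γ u)

/-- The value of the lower rotation sequence with slope `γ` and intercept `u`. -/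
noncomputable def lowerValue (β γ u : ℝ) : ℝ := sumValue β (floorSum γ u)

theorem mul_sumValue {β : ℝ} (hβ : 1 < β) {S : ℕ → ℤ} (h : BddIncrements S) (h0 : S 0 = 0) :
    β * sumValue β S = S 1 + sumValue β (fun n => S (1 + n) - S 1) := by
  rw [sumValue_shift hβ h 1 (S 1)]
  have : β ≠ 0 := by linarith
  simp [h0]; field_simp

theorem mul_upperValue {β : ℝ} (hβ : 1 < β) (γ u : ℝ) :
    β * upperValue β γ u = (⌈u + γ⌉ - ⌈u⌉ : ℤ) + upperValue β γ (u + γ) := by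
  rw [upperValue, mul_sumValue hβ (bddIncrements_ceilSum γ u) (ceilSum_zero γ u), upperValue]
  congr 1
  · simp [ceilSum]
  · congr 1; funext n
    simp only [ceilSum]
    push_cast
    rw [show u + (1 + (n : ℝ)) * γ = u + γ + n * γ by ring, one_mul]
    omega

theorem mul_lowerValue {β : ℝ} (hβ : 1 < β) (γ u : ℝ) :
    β * lowerValue β γ u = (⌊u + γ⌋ - ⌊u⌋ : ℤ) + lowerValue β γ (u + γ) := by
  rw [lowerValue, mul_sumValue hβ (bddIncrements_floorSum γ u) (floorSum_zero γ u), lowerValue]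
  congr 1
  · simp [floorSum]
  · congr 1; funext n
    simp only [floorSum]
    push_cast
    rw [show u + (1 + (n : ℝ)) * γ = u + γ + n * γ by ring, one_mul]
    omega

theorem upperValue_add_int (β γ u : ℝ) (k : ℤ) : upperValue β γ (u + k) = upperValue β γ u := by
  rw [upperValue, upperValue]; congr 1; funext n
  simp only [ceilSum]
  rw [add_right_comm, Int.ceil_add_intCast, Int.ceil_add_intCast]; omega

theorem lowerValue_add_int (β γ u : ℝ) (k : ℤ) : lowerValue β γ (u + k) = lowerValue β γ u := by
  rw [lowerValue, lowerValue]; congr 1; funext n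
  simp only [floorSum]
  rw [add_right_comm, Int.floor_add_intCast, Int.floor_add_intCast]; omega

section Values

variable {β : ℝ}

/-- Subadditivity of the ceiling: intercept 0 has the largest partial sums. -/
theorem upperValue_le (hβ : 1 < β) (γ u : ℝ) : upperValue β γ u ≤ upperValue β γ 0 :=
  sumValue_mono hβ (bddIncrements_ceilSum _ _) (bddIncrements_ceilSum _ _)
    (by rw [ceilSum_zero, ceilSum_zero])
    (fun n => by rw [ceilSum_zero_right]; exact ceilSum_le γ u n)

theorem lowerValue_le (hβ : 1 < β) (γ u : ℝ) : lowerValue β γ u ≤ upperValue β γ 0 :=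
  sumValue_mono hβ (bddIncrements_floorSum _ _) (bddIncrements_ceilSum _ _)
    (by rw [ceilSum_zero, floorSum_zero])
    (fun n => by rw [ceilSum_zero_right]; exact floorSum_le γ u n)

theorem lowerValue_zero_le (hβ : 1 < β) (γ u : ℝ) : lowerValue β γ 0 ≤ upperValue β γ u :=
  sumValue_mono hβ (bddIncrements_floorSum _ _) (bddIncrements_ceilSum _ _)
    (by rw [ceilSum_zero, floorSum_zero])
    (fun n => by rw [floorSum_zero_right]; exact le_ceilSum γ u n)

/-- Rotation sums of one slope are at least ⌊nγ⌋ ≥ ⌈nγ⌉ - 1, so all values of that slope lie in an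
interval of length 1/β. -/
theorem upperValue_sub_le (hβ : 1 < β) (γ u : ℝ) :
    upperValue β γ 0 - 1 / β ≤ upperValue β γ u := by
  rw [← sumValue_indicator, upperValue,
    ← sumValue_sub hβ (bddIncrements_ceilSum _ _) bddIncrements_indicator]
  refine sumValue_mono hβ ((bddIncrements_ceilSum _ _).sub bddIncrements_indicator)
    (bddIncrements_ceilSum _ _) (by simp [ceilSum]) fun n => ?_
  have h1 := le_ceilSum γ u n
  have h2 := Int.ceil_le_floor_add_one ((n : ℝ) * γ)
  rw [ceilSum_zero_right]
  split_ifs with h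
  · simp [h, ceilSum]
  · omega

theorem upperValue_strictMono (hβ : 1 < β) : StrictMono fun γ => upperValue β γ 0 := by
  intro γ γ' h
  obtain ⟨m, hm⟩ := exists_nat_gt (1 / (γ' - γ))
  rw [div_lt_iff₀ (by linarith)] at hm
  refine sumValue_lt hβ (bddIncrements_ceilSum _ _) (bddIncrements_ceilSum _ _)
    (by rw [ceilSum_zero, ceilSum_zero]) (fun n => ?_) (m := m) ?_
  · rw [ceilSum_zero_right, ceilSum_zero_right]
    exact Int.ceil_mono (by gcongr)
  · rw [ceilSum_zero_right, ceilSum_zero_right, Int.lt_ceil]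
    linarith [Int.ceil_lt_add_one ((m : ℝ) * γ)]

theorem one_div_le_upperValue (hβ : 1 < β) {γ : ℝ} (hγ : 0 < γ) : 1 / β ≤ upperValue β γ 0 := by
  rw [← sumValue_indicator]
  refine sumValue_mono hβ bddIncrements_indicator (bddIncrements_ceilSum _ _)
    (by simp [ceilSum]) fun n => ?_
  rw [ceilSum_zero_right]
  split_ifs with h
  · simp [h]
  · have : 0 < ⌈(n : ℝ) * γ⌉ := Int.ceil_pos.2 (by positivity)
    omega

/-- The orbit of the value of an upper rotation sequence. -/
theorem iterate_upperValue (hβ : 1 < β) {γ : ℝ} (hγ : 0 < γ) (hV : upperValue β γ 0 < 1) (n : ℕ) :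
    (betaMap β)^[n] (upperValue β γ 0) = upperValue β γ (n * γ) := by
  induction n with
  | zero => simp
  | succ n ih =>
    have e := mul_upperValue hβ γ (n * γ)
    have e2 : (n : ℝ) * γ + γ = ((n + 1 : ℕ) : ℝ) * γ := by push_cast; ring
    rw [e2] at e
    rw [Function.iterate_succ_apply', ih,
      betaMap_eq_of_mem (k := ⌈((n + 1 : ℕ) : ℝ) * γ⌉ - ⌈(n : ℝ) * γ⌉)]
    · linarith
    · have h1 := upperValue_le hβ γ (((n + 1 : ℕ) : ℝ) * γ)
      have h2 := upperValue_sub_le hβ γ (((n + 1 : ℕ) : ℝ) * γ)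
      have h3 := one_div_le_upperValue hβ hγ
      constructor <;> linarith

/-- For n ≥ 1 one has ⌊nγ⌋ + 1 ≤ ⌈nγ'⌉, strictly for large n. This is what separates the gaps
belonging to different slopes. -/
theorem lowerValue_add_lt (hβ : 1 < β) {γ γ' : ℝ} (h : γ < γ') :
    lowerValue β γ 0 + 1 / β < upperValue β γ' 0 := by
  rw [← sumValue_indicator, ← lt_sub_iff_add_lt, upperValue,
    ← sumValue_sub hβ (bddIncrements_ceilSum _ _) bddIncrements_indicator]
  obtain ⟨m, hm⟩ := exists_nat_gt (1 / (γ' - γ))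
  have hm0 : m ≠ 0 := by
    rintro rfl
    have : 0 < 1 / (γ' - γ) := by rw [one_div, inv_pos]; linarith
    push_cast at hm; linarith
  rw [div_lt_iff₀ (by linarith)] at hm
  refine sumValue_lt hβ (bddIncrements_floorSum _ _)
    ((bddIncrements_ceilSum _ _).sub bddIncrements_indicator) (by simp [ceilSum, floorSum])
    (fun n => ?_) (m := m) ?_
  · rw [ceilSum_zero_right, floorSum_zero_right]
    split_ifs with hn
    · simp [hn]
    · have : ⌊(n : ℝ) * γ⌋ < ⌈(n : ℝ) * γ'⌉ := by
        rw [Int.lt_ceil]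
        refine (Int.floor_le _).trans_lt ?_
        have : (0 : ℝ) < n := by positivity
        gcongr
      omega
  · rw [ceilSum_zero_right, floorSum_zero_right, if_neg hm0]
    have : ⌊(m : ℝ) * γ⌋ + 1 < ⌈(m : ℝ) * γ'⌉ := by
      rw [Int.lt_ceil]; push_cast
      linarith [Int.floor_le ((m : ℝ) * γ)]
    omega

theorem lowerValue_add_eq (hβ : 1 < β) {γ : ℝ} (h : ∀ n : ℕ, n ≠ 0 → (⌊n * γ⌋ : ℝ) ≠ n * γ) :
    lowerValue β γ 0 + 1 / β = upperValue β γ 0 := by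
  rw [← sumValue_indicator, ← eq_sub_iff_add_eq, upperValue,
    ← sumValue_sub hβ (bddIncrements_ceilSum _ _) bddIncrements_indicator, lowerValue]
  congr 1; funext n
  rw [ceilSum_zero_right, floorSum_zero_right]
  split_ifs with hn
  · simp [hn]
  · rw [eq_sub_iff_add_eq, eq_comm, Int.ceil_eq_iff]
    push_cast
    have h1 := lt_of_le_of_ne (Int.floor_le ((n : ℝ) * γ)) (h n hn)
    constructor <;> linarith [Int.lt_floor_add_one ((n : ℝ) * γ)]

/-- Left continuity of the value of the upper rotation sequence in the slope. -/
theorem exists_slope_lt (hβ : 1 < β) {γ l v : ℝ} (hl : l < γ) (hγ : 0 < γ)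
    (hv : v < upperValue β γ 0) : ∃ γ', l < γ' ∧ γ' < γ ∧ v < upperValue β γ' 0 := by
  obtain ⟨N, hN⟩ : ∃ N : ℕ, upperValue β γ 0 / β ^ N < upperValue β γ 0 - v := by
    have h1 : Tendsto (fun N : ℕ => upperValue β γ 0 / β ^ N) atTop (𝓝 0) :=
      tendsto_const_nhds.div_atTop (tendsto_pow_atTop_atTop_of_one_lt hβ)
    exact (h1.eventually_lt_const (by linarith)).exists
  have hev : ∀ᶠ γ' in 𝓝[<] γ, ∀ n ≤ N, ceilSum γ 0 n = ceilSum γ' 0 n := by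
    refine (Set.finite_Iic N).eventually_all.2 fun n hn => ?_
    have : ∀ᶠ γ' in 𝓝[<] γ, (⌈(n : ℝ) * γ⌉ : ℝ) - 1 < n * γ' := by
      have hc : Tendsto (fun γ' : ℝ => (n : ℝ) * γ') (𝓝[<] γ) (𝓝 (n * γ)) :=
        ((continuous_const.mul continuous_id).tendsto γ).mono_left nhdsWithin_le_nhds
      exact hc.eventually_const_lt (by linarith [Int.ceil_lt_add_one ((n : ℝ) * γ)])
    filter_upwards [this, self_mem_nhdsWithin] with γ' h1 h2
    rw [ceilSum_zero_right, ceilSum_zero_right, eq_comm, Int.ceil_eq_iff]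
    refine ⟨h1, le_trans ?_ (Int.le_ceil _)⟩
    have : γ' < γ := h2
    gcongr
  have hl' : ∀ᶠ γ' in 𝓝[<] γ, max l 0 < γ' :=
    eventually_nhdsWithin_of_eventually_nhds (eventually_gt_nhds (max_lt hl hγ))
  obtain ⟨γ', h1, h2, h3⟩ := (hev.and (hl'.and self_mem_nhdsWithin)).exists
  refine ⟨γ', (le_max_left _ _).trans_lt h2, h3, ?_⟩
  have hγ' : 0 < γ' := (le_max_right _ _).trans_lt h2
  have h4 := sumValue_le_of_agree hβ (bddIncrements_ceilSum γ 0) (bddIncrements_ceilSum γ' 0) h1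
    (fun n _ => ceilSum_monotone hγ'.le 0 (Nat.le_succ n)) (⌈(N : ℝ) * γ⌉)
  have h5 : (fun n => ceilSum γ 0 (N + n) - ⌈(N : ℝ) * γ⌉) = ceilSum γ (N * γ) := by
    funext n
    simp only [ceilSum]; push_cast
    rw [zero_add, Int.ceil_zero, sub_zero, add_mul]
  rw [h5] at h4
  have h6 : sumValue β (ceilSum γ (N * γ)) / β ^ N ≤ upperValue β γ 0 / β ^ N := by
    have := upperValue_le hβ γ (N * γ)
    gcongr
    exact this
  simp only [upperValue] at *
  linarith

/-- Right limits of the value of the upper rotation sequence in the slope. -/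
theorem exists_slope_gt (hβ : 1 < β) {γ v : ℝ} (hγ : 0 ≤ γ)
    (hv : lowerValue β γ 0 + 1 / β < v) : ∃ γ', γ < γ' ∧ upperValue β γ' 0 < v := by
  obtain ⟨N, hN⟩ : ∃ N : ℕ, upperValue β (γ + 1) 0 / β ^ N <
      v - (lowerValue β γ 0 + 1 / β) := by
    have h1 : Tendsto (fun N : ℕ => upperValue β (γ + 1) 0 / β ^ N) atTop (𝓝 0) :=
      tendsto_const_nhds.div_atTop (tendsto_pow_atTop_atTop_of_one_lt hβ)
    exact (h1.eventually_lt_const (by linarith)).exists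
  -- The limit of ⌈nγ'⌉ as γ' decreases to γ: ⌊nγ⌋ + 1 for n ≥ 1, and 0 for n = 0.
  set S : ℕ → ℤ := fun n => floorSum γ 0 n - (-(if n = 0 then 0 else 1)) with hS
  have hneg : BddIncrements fun n => -(if n = 0 then 0 else 1 : ℤ) := by
    refine ⟨1, fun i => ?_⟩
    by_cases h : i = 0 <;> simp [h]
  have hSb : BddIncrements S := (bddIncrements_floorSum γ 0).sub hneg
  have hSv : sumValue β S = lowerValue β γ 0 + 1 / β := by
    rw [hS, sumValue_sub hβ (bddIncrements_floorSum γ 0) hneg, sub_eq_add_neg, lowerValue]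
    congr 1
    rw [← sumValue_indicator, sumValue, sumValue, ← tsum_neg]
    refine tsum_congr fun i => ?_
    push_cast; ring
  have hev : ∀ᶠ γ' in 𝓝[>] γ, ∀ n ≤ N, ceilSum γ' 0 n = S n := by
    refine (Set.finite_Iic N).eventually_all.2 fun n hn => ?_
    have : ∀ᶠ γ' in 𝓝[>] γ, (n : ℝ) * γ' < ⌊(n : ℝ) * γ⌋ + 1 := by
      have hc : Tendsto (fun γ' : ℝ => (n : ℝ) * γ') (𝓝[>] γ) (𝓝 (n * γ)) :=
        ((continuous_const.mul continuous_id).tendsto γ).mono_left nhdsWithin_le_nhds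
      exact hc.eventually_lt_const (Int.lt_floor_add_one _)
    filter_upwards [this, self_mem_nhdsWithin] with γ' h1 h2
    have h2 : γ < γ' := h2
    rw [hS, ceilSum_zero_right]
    simp only [floorSum_zero_right]
    split_ifs with h0
    · simp [h0]
    · rw [Int.ceil_eq_iff]
      push_cast
      have h3 : (0 : ℝ) < n := by positivity
      have h4 : (n : ℝ) * γ < n * γ' := by gcongr
      constructor <;> linarith [Int.floor_le ((n : ℝ) * γ)]
  have hl' : ∀ᶠ γ' in 𝓝[>] γ, γ' < γ + 1 :=
    eventually_nhdsWithin_of_eventually_nhds (eventually_lt_nhds (by linarith))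
  obtain ⟨γ', h1, h2, h3⟩ := (hev.and (hl'.and self_mem_nhdsWithin)).exists
  refine ⟨γ', h3, ?_⟩
  have h4 := sumValue_le_of_agree hβ (bddIncrements_ceilSum γ' 0) hSb h1
    (fun n _ => by
      rw [hS]
      have := floorSum_monotone hγ 0 (show n ≤ n + 1 by omega)
      by_cases hn : n = 0
      · simp only [hn, zero_add, if_true, one_ne_zero, if_false] at this ⊢; linarith
      · simp only [hn, Nat.succ_ne_zero, if_false]; linarith) (⌈(N : ℝ) * γ'⌉)
  have h5 : (fun n => ceilSum γ' 0 (N + n) - ⌈(N : ℝ) * γ'⌉) = ceilSum γ' (N * γ') := by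
    funext n
    simp only [ceilSum]; push_cast
    rw [zero_add, Int.ceil_zero, sub_zero, add_mul]
  rw [h5, hSv] at h4
  have h6 : sumValue β (ceilSum γ' (N * γ')) / β ^ N ≤ upperValue β (γ + 1) 0 / β ^ N := by
    have := (upperValue_le hβ γ' (N * γ')).trans ((upperValue_strictMono hβ).monotone h2.le)
    gcongr
    exact this
  simp only [upperValue] at *
  linarith

theorem le_of_upperValue_le_one (hβ : 1 < β) {γ : ℝ} (hγ : 0 ≤ γ) (h : upperValue β γ 0 ≤ 1) :
    γ ≤ β := by
  have h1 := mul_upperValue hβ γ 0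
  have h2 : 0 ≤ upperValue β γ (0 + γ) := sumValue_nonneg hβ (ceilSum_monotone hγ _)
  rw [zero_add, Int.ceil_zero, sub_zero] at h1
  rw [zero_add] at h2
  have := Int.le_ceil γ
  nlinarith

/-- Every base either is the base of an upper rotation sequence, or lies in the gap of a rational
slope. -/
theorem slope_dichotomy (hβ : 1 < β) :
    (∃ γ > 0, upperValue β γ 0 = 1) ∨
      ∃ γ > 0, upperValue β γ 0 < 1 ∧ 1 ≤ lowerValue β γ 0 + 1 / β := by
  -- At the supremum of these slopes, left continuity gives V ≤ 1 and the right limit gives W ≥ 1.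
  set A := {γ : ℝ | 0 < γ ∧ upperValue β γ 0 ≤ 1} with hA
  have hne : A.Nonempty := by
    have h0 : lowerValue β 0 0 + 1 / β < 1 := by
      have : lowerValue β 0 0 = 0 := by simp [lowerValue, sumValue, floorSum]
      rw [this, zero_add, div_lt_one (by linarith)]; exact hβ
    obtain ⟨γ, h1, h2⟩ := exists_slope_gt hβ le_rfl h0
    exact ⟨γ, h1, h2.le⟩
  have hbdd : BddAbove A := ⟨β, fun γ hγ => le_of_upperValue_le_one hβ hγ.1.le hγ.2⟩
  have hpos : 0 < sSup A := by
    obtain ⟨γ, hγ⟩ := hne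
    exact hγ.1.trans_le (le_csSup hbdd hγ)
  have h1 : upperValue β (sSup A) 0 ≤ 1 := by
    by_contra! h
    obtain ⟨γ, -, h2, h3⟩ := exists_slope_lt hβ hpos hpos h
    obtain ⟨γ', h4, h5⟩ := exists_lt_of_lt_csSup hne h2
    have := (upperValue_strictMono hβ) h5
    simp only at this
    linarith [h4.2]
  have h2 : 1 ≤ lowerValue β (sSup A) 0 + 1 / β := by
    by_contra! h
    obtain ⟨γ, h3, h4⟩ := exists_slope_gt hβ hpos.le h
    exact absurd (le_csSup hbdd (show γ ∈ A from ⟨hpos.trans h3, h4.le⟩)) (not_le.2 h3)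
  rcases h1.eq_or_lt with h | h
  · exact Or.inl ⟨_, hpos, h⟩
  · exact Or.inr ⟨_, hpos, h, h2⟩

end Values

/-! ### Bases in the gap of a rational slope -/

theorem ceil_eq_floor_add_one {x : ℝ} (h : (⌊x⌋ : ℝ) ≠ x) : ⌈x⌉ = ⌊x⌋ + 1 := by
  rw [Int.ceil_eq_iff]
  have h1 := lt_of_le_of_ne (Int.floor_le x) h
  push_cast
  constructor <;> linarith [Int.lt_floor_add_one x]

theorem floor_mul_ne {p q i : ℕ} (hpq : Nat.Coprime p q) (hi : 0 < i) (hiq : i < q) :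
    (⌊(i : ℝ) * (p / q)⌋ : ℝ) ≠ i * (p / q) := by
  intro h
  have hq : (q : ℝ) ≠ 0 := by have : 0 < q := by omega
                              positivity
  have h1 : (⌊(i : ℝ) * (p / q)⌋ : ℝ) * q = i * p := by rw [h]; field_simp
  have h2 : ⌊(i : ℝ) * (p / q)⌋ * (q : ℤ) = (i * p : ℕ) := by exact_mod_cast h1
  have h3 : (q : ℤ) ∣ ((i * p : ℕ) : ℤ) := ⟨_, by rw [← h2, mul_comm]⟩
  have h4 : q ∣ i := (Nat.Coprime.dvd_of_dvd_mul_right hpq.symm (Int.natCast_dvd_natCast.1 h3))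
  exact absurd (Nat.le_of_dvd hi h4) (by omega)

theorem ceil_succ_div {m q : ℕ} (hq : 0 < q) :
    ⌈((m : ℝ) + 1) / q⌉ = ⌊(m : ℝ) / q⌋ + 1 := by
  have hq' : (0 : ℝ) < q := by positivity
  rw [Int.ceil_eq_iff]
  push_cast
  constructor
  · have : (m : ℝ) / q < (m + 1) / q := by gcongr; linarith
    linarith [Int.floor_le ((m : ℝ) / q)]
  · have h1 := Int.lt_floor_add_one ((m : ℝ) / q)
    rw [div_lt_iff₀ hq'] at h1
    rw [div_le_iff₀ hq']
    have : (m : ℤ) < (⌊(m : ℝ) / q⌋ + 1) * q := by exact_mod_cast h1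
    have : (m : ℤ) + 1 ≤ (⌊(m : ℝ) / q⌋ + 1) * q := this
    exact_mod_cast this

theorem upperValue_one_div {β : ℝ} {p q : ℕ} (hq : 0 < q) :
    upperValue β (p / q) (1 / q) = lowerValue β (p / q) 0 := by
  rw [upperValue, lowerValue]; congr 1; funext n
  have h1 := ceil_succ_div (m := n * p) hq
  have h2 := ceil_succ_div (m := 0) hq
  simp only [ceilSum, floorSum_zero_right]
  have e1 : (1 : ℝ) / q + n * (p / q) = (((n * p : ℕ) : ℝ) + 1) / q := by push_cast; ring
  have e2 : (1 : ℝ) / q = (((0 : ℕ) : ℝ) + 1) / q := by push_cast; ring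
  have e3 : (n : ℝ) * (p / q) = ((n * p : ℕ) : ℝ) / q := by push_cast; ring
  rw [e1, e3, h1, e2, h2]
  simp

/-- The upper and lower sequences of slope p/q pair their digits so that the gap from V to W = t +
1/β expands affinely for q steps, when it becomes the gap from V to 1 + t. A point of (V, 1) hence
moves away from V or, on passing 1, drops below t. Here t is the minimum of the orbit of V. -/
theorem exists_isolatedPoint_of_gap {β : ℝ} (hβ : 1 < β) {p q : ℕ} (hp : 0 < p) (hq : 0 < q)
    (hpq : Nat.Coprime p q) (hV : upperValue β (p / q) 0 < 1)
    (hW : 1 ≤ lowerValue β (p / q) 0 + 1 / β) : (isolatedPoints (minimalPoints β)).Nonempty := by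
  have hβ0 : 0 < β := by linarith
  have hq' : (0 : ℝ) < q := by positivity
  have hp' : (0 : ℝ) < p := by positivity
  set γ : ℝ := p / q with hγdef
  have hγ : 0 < γ := by positivity
  have hqγ : (q : ℝ) * γ = (p : ℤ) := by rw [hγdef]; push_cast; field_simp
  set V := upperValue β γ 0 with hVdef
  set t := lowerValue β γ 0 with htdef
  have hβinv : 1 / β < 1 := by rw [div_lt_one hβ0]; exact hβ
  have ht0 : 0 < t := by linarith
  have hVβ := one_div_le_upperValue hβ hγ
  have hβinv0 : 0 < 1 / β := by positivity
  have hVm : V ∈ Ico (0 : ℝ) 1 := ⟨by linarith, hV⟩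
  have horb := iterate_upperValue hβ hγ hV
  have hfc : ∀ i : ℕ, 0 < i → i < q → ⌈(i : ℝ) * γ⌉ = ⌊(i : ℝ) * γ⌋ + 1 :=
    fun i h1 h2 => ceil_eq_floor_add_one (floor_mul_ne hpq h1 h2)
  have hgap1 : β * (t + 1 / β - V) = 1 + ⌊γ⌋ - ⌈γ⌉ + lowerValue β γ γ - upperValue β γ γ := by
    have h1 := mul_lowerValue hβ γ 0
    have h2 := mul_upperValue hβ γ 0
    simp only [zero_add, Int.floor_zero, Int.ceil_zero, sub_zero] at h1 h2
    have h3 : β * (1 / β) = 1 := by field_simp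
    linear_combination h1 - h2 + h3
  have hgap : ∀ i : ℕ, 1 ≤ i → i < q →
      β ^ i * (t + 1 / β - V) = lowerValue β γ (i * γ) - upperValue β γ (i * γ) := by
    intro i hi
    induction i, hi using Nat.le_induction with
    | base =>
      intro h1
      have := hfc 1 one_pos h1
      rw [Nat.cast_one, one_mul] at this ⊢
      rw [pow_one, hgap1, this]; push_cast; ring
    | succ i hi ih =>
      intro h1
      have h2 := ih (by omega)
      have h3 := mul_lowerValue hβ γ (i * γ)
      have h4 := mul_upperValue hβ γ (i * γ)
      have e : (i : ℝ) * γ + γ = ((i + 1 : ℕ) : ℝ) * γ := by push_cast; ring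
      rw [e] at h3 h4
      rw [hfc i hi (by omega), hfc (i + 1) (by omega) h1] at h4
      push_cast at h3 h4 ⊢
      rw [pow_succ]
      linear_combination β * h2 + h3 - h4
  have hgapq : β ^ q * (t + 1 / β - V) = 1 + t - V := by
    have hVp : upperValue β γ (p : ℤ) = V := by
      have := upperValue_add_int β γ 0 p
      rwa [zero_add] at this
    have htp : lowerValue β γ (p : ℤ) = t := by
      have := lowerValue_add_int β γ 0 p
      rwa [zero_add] at this
    obtain ⟨k, rfl⟩ : ∃ k, q = k + 1 := ⟨q - 1, by omega⟩
    rcases Nat.eq_zero_or_pos k with rfl | hk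
    · have hγp : γ = (p : ℤ) := by rw [← hqγ]; simp
      rw [zero_add, pow_one, hgap1, hγp, Int.floor_intCast, Int.ceil_intCast, ← hγp]
      rw [hγp] at hVp htp ⊢
      rw [hVp, htp]; ring
    · have h2 := hgap k hk (by omega)
      have h3 := mul_lowerValue hβ γ (k * γ)
      have h4 := mul_upperValue hβ γ (k * γ)
      have e : (k : ℝ) * γ + γ = (p : ℤ) := by rw [← hqγ]; push_cast; ring
      rw [e] at h3 h4
      rw [hfc k hk (by omega), Int.ceil_intCast, hVp] at h4
      rw [Int.floor_intCast, htp] at h3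
      push_cast at h3 h4
      rw [pow_succ]
      linear_combination β * h2 + h3 - h4
  have hTq : (betaMap β)^[q] V = V := by
    rw [horb, hqγ]
    have := upperValue_add_int β γ 0 p
    rwa [zero_add] at this
  -- Bézout gives i₀ with i₀ p ≡ 1 mod q, so the intercept i₀ γ is 1/q modulo 1, where the upper
  -- sequence coincides with the lower sequence of intercept 0.
  obtain ⟨i₀, hi₀⟩ : ∃ i₀, (betaMap β)^[i₀] V = t := by
    obtain ⟨a, b, hab⟩ := Nat.isCoprime_iff_coprime.2 hpq
    refine ⟨(a % q).toNat, ?_⟩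
    have hnn : 0 ≤ a % (q : ℤ) := Int.emod_nonneg _ (by omega)
    have h1 : ((a % (q : ℤ)).toNat : ℝ) = ((a - q * (a / q) : ℤ) : ℝ) := by
      rw [← Int.emod_def]
      have : ((a % (q : ℤ)).toNat : ℤ) = a % q := Int.toNat_of_nonneg hnn
      exact_mod_cast congrArg (Int.cast : ℤ → ℝ) this
    have h2 : (a : ℝ) * p + b * q = 1 := by exact_mod_cast hab
    have h3 : ((a % (q : ℤ)).toNat : ℝ) * γ = 1 / q + ((-b - p * (a / q) : ℤ) : ℝ) := by
      rw [h1, hγdef]; push_cast; field_simp; linarith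
    rw [horb, h3, upperValue_add_int, upperValue_one_div hq]
  refine ⟨t, mem_isolatedPoints_of_escape hβ hVm hq.ne' hTq hi₀ ht0 (fun n => ?_)
    (fun y hy => ?_)⟩
  · rw [horb]; exact lowerValue_zero_le hβ γ _
  · have hyV : y - V < t + 1 / β - V := by linarith [hy.2]
    have hyV0 : 0 < y - V := by linarith [hy.1]
    obtain ⟨k, rfl⟩ : ∃ k, q = k + 1 := ⟨q - 1, by omega⟩
    have hsh := iterate_betaMap_shadow (β := β) (x := V) (y := y) (n := k) (by
      intro i hi
      have hpos : 0 < β ^ i * (y - V) := by positivity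
      refine ⟨by linarith [(iterate_betaMap_mem β hVm i).1], ?_⟩
      rcases Nat.eq_zero_or_pos i with rfl | hi0
      · simpa using hy.2
      · have h1 := hgap i hi0 (by omega)
        have h2 : β ^ i * (y - V) < β ^ i * (t + 1 / β - V) := by gcongr
        have h3 := lowerValue_le hβ γ (i * γ)
        rw [horb]
        linarith) k le_rfl
    have hlt : β ^ (k + 1) * (y - V) < 1 + t - V := by
      rw [← hgapq]; gcongr
    have hpos : 0 < β ^ (k + 1) * (y - V) := by positivity
    have hTV := iterate_betaMap_succ β V k
    rw [hTq] at hTV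
    have e : β * (betaMap β)^[k] y = V + β ^ (k + 1) * (y - V) + greedyDigit β V k := by
      rw [hsh, pow_succ]; linear_combination -hTV
    rw [Function.iterate_succ_apply']
    rcases lt_or_ge (V + β ^ (k + 1) * (y - V)) 1 with h | h
    · right
      rw [betaMap_eq_of_mem (k := greedyDigit β V k), e]
      · ring
      · rw [e]; constructor <;> linarith [hVm.1]
    · left
      rw [betaMap_eq_of_mem (k := greedyDigit β V k + 1), e]
      · push_cast; linarith
      · have htV := lowerValue_le hβ γ 0
        rw [e]; push_cast; constructor <;> linarith

/-! ### Bases of upper rotation sequences -/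

section Rotation

variable {β γ : ℝ}

/-- A point whose orbit stays above `1 - 1 / β` follows the orbit of one. -/
theorem sum_greedyDigit_of_ge (hβ : 1 < β) (hV : upperValue β γ 0 = 1) {x : ℝ}
    (hx : x ∈ Ico (0 : ℝ) 1) (hlow : ∀ n, 1 - 1 / β ≤ (betaMap β)^[n] x) (n : ℕ) :
    (∑ i ∈ Finset.range n, greedyDigit β x i = ⌈n * γ⌉ ∧
      (betaMap β)^[n] x < upperValue β γ (n * γ)) ∨
    (∑ i ∈ Finset.range n, greedyDigit β x i + 1 = ⌈n * γ⌉ ∧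
      upperValue β γ (n * γ) ≤ (betaMap β)^[n] x) := by
  have hβ0 : 0 < β := by linarith
  have hβinv : 1 / β < 1 := by rw [div_lt_one hβ0]; exact hβ
  have hββ : β * (1 / β) = 1 := by field_simp
  induction n with
  | zero => left; simp [hV, hx.2]
  | succ n ih =>
    have h1 := mul_upperValue hβ γ (n * γ)
    have e : (n : ℝ) * γ + γ = ((n + 1 : ℕ) : ℝ) * γ := by push_cast; ring
    rw [e] at h1
    have h2 := iterate_betaMap_succ β x n
    have h3 := upperValue_le hβ γ (n * γ)
    have h4 := upperValue_le hβ γ (((n + 1 : ℕ) : ℝ) * γ)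
    have h5 := upperValue_sub_le hβ γ (n * γ)
    have h6 := upperValue_sub_le hβ γ (((n + 1 : ℕ) : ℝ) * γ)
    have h7 := hlow n
    have h8 := hlow (n + 1)
    have h9 := (iterate_betaMap_mem β hx n).2
    have h10 := (iterate_betaMap_mem β hx (n + 1)).2
    rw [hV] at h3 h4 h5 h6
    rw [Finset.sum_range_succ]
    set X := (betaMap β)^[n] x
    set X' := (betaMap β)^[n + 1] x
    set H := upperValue β γ (n * γ)
    set H' := upperValue β γ (((n + 1 : ℕ) : ℝ) * γ)
    set c := ⌈(n : ℝ) * γ⌉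
    set c' := ⌈((n + 1 : ℕ) : ℝ) * γ⌉
    set d := greedyDigit β x n
    set s := ∑ i ∈ Finset.range n, greedyDigit β x i
    have h11 : β * (H - X) = ((c' - c - d : ℤ) : ℝ) + (H' - X') := by
      push_cast at h1 ⊢; linarith
    have h12 : β * (H - X) ≤ 1 := by
      rw [← hββ]; exact mul_le_mul_of_nonneg_left (by linarith) hβ0.le
    have h13 : -1 < β * (H - X) := by
      have : -1 = β * (-(1 / β)) := by linarith
      rw [this]; exact mul_lt_mul_of_pos_left (by linarith) hβ0
    -- Both orbits stay in an interval of length 1/β, so this integer has only two possible values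
    -- in each case, and its value decides the new order of the two points.
    set δ := c' - c - d with hδ
    rcases ih with ⟨h14, h15⟩ | ⟨h14, h15⟩
    · have h16 : 0 < β * (H - X) := mul_pos hβ0 (by linarith)
      have l1 : (-1 : ℝ) < δ := by linarith
      have l2 : (δ : ℝ) < 2 := by linarith
      have l1' : -1 < δ := by exact_mod_cast l1
      have l2' : δ < 2 := by exact_mod_cast l2
      obtain hd | hd : δ = 0 ∨ δ = 1 := by omega
      · left; rw [hd] at h11; push_cast at h11
        exact ⟨by omega, by linarith⟩
      · right; rw [hd] at h11; push_cast at h11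
        exact ⟨by omega, by linarith⟩
    · have h16 : β * (H - X) ≤ 0 := mul_nonpos_of_nonneg_of_nonpos hβ0.le (by linarith)
      have l1 : (-2 : ℝ) < δ := by linarith
      have l2 : (δ : ℝ) < 1 := by linarith
      have l1' : -2 < δ := by exact_mod_cast l1
      have l2' : δ < 1 := by exact_mod_cast l2
      obtain hd | hd : δ = 0 ∨ δ = -1 := by omega
      · right; rw [hd] at h11; push_cast at h11
        exact ⟨by omega, by linarith⟩
      · left; rw [hd] at h11; push_cast at h11
        exact ⟨by omega, by linarith⟩

/-- There is no periodic orbit in the interval between `1 - 1 / β` and `1`. -/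
theorem not_periodic_of_ge (hβ : 1 < β) (hV : upperValue β γ 0 = 1) {x : ℝ}
    (hx : x ∈ Ico (0 : ℝ) 1) (hlow : ∀ n, 1 - 1 / β ≤ (betaMap β)^[n] x) {q : ℕ} (hq : q ≠ 0)
    (hper : (betaMap β)^[q] x = x) : False := by
  have hβ0 : 0 < β := by linarith
  set S : ℕ → ℤ := fun n => ∑ i ∈ Finset.range n, greedyDigit β x i with hS
  have hSadd : ∀ k n, S (k + n) = S k + ∑ i ∈ Finset.range n, greedyDigit β ((betaMap β)^[k] x) i := by
    intro k n
    rw [hS]; simp only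
    rw [Finset.sum_range_add]
    simp only [greedyDigit_iterate]
  have hbd : ∀ k n, S (k + n) - S k = ⌈(n : ℝ) * γ⌉ ∨ S (k + n) - S k + 1 = ⌈(n : ℝ) * γ⌉ := by
    intro k n
    rw [hSadd k n, add_sub_cancel_left]
    rcases sum_greedyDigit_of_ge hβ hV (iterate_betaMap_mem β hx k) (fun i => by
      rw [← Function.iterate_add_apply]; exact hlow _) n with h | h
    · exact Or.inl h.1
    · exact Or.inr h.1
  have hSq : ∀ n, S (q + n) = S q + S n := by
    intro n
    rw [hSadd q n, hper]
  have hSjq : ∀ j : ℕ, S (j * q) = j * S q := by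
    intro j
    induction j with
    | zero => simp [hS]
    | succ j ih => rw [Nat.succ_mul, add_comm, hSq, ih]; push_cast; ring
  -- The digit sums of a periodic orbit are linear along multiples of q and stay within bounded
  -- distance of nγ.
  have hslope : (S q : ℝ) = q * γ := by
    by_contra hne
    have hpos : 0 < |(S q : ℝ) - q * γ| := abs_pos.2 (sub_ne_zero.2 hne)
    obtain ⟨j, hj⟩ := exists_nat_gt (2 / |(S q : ℝ) - q * γ|)
    rw [div_lt_iff₀ hpos] at hj
    have h1 := hbd 0 (j * q)
    rw [zero_add, show S 0 = 0 by simp [hS], sub_zero, hSjq] at h1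
    have h2 := Int.le_ceil (((j * q : ℕ) : ℝ) * γ)
    have h3 := Int.ceil_lt_add_one (((j * q : ℕ) : ℝ) * γ)
    have h4 : |(j : ℝ) * (S q - q * γ)| < 2 := by
      rw [abs_lt]
      rcases h1 with h1 | h1
      · rw [← h1] at h2 h3; push_cast at h2 h3
        constructor <;> linarith
      · rw [← h1] at h2 h3; push_cast at h2 h3
        constructor <;> linarith
    rw [abs_mul, Nat.abs_cast] at h4
    linarith
  -- Starting where S n - nγ is minimal, all further digit sums are at least nγ, hence equal ⌈nγ⌉.
  -- The shifted point y < 1 then has exactly the digits of 1, and the difference 1 - y expands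
  -- without bound.
  obtain ⟨m, -, hm⟩ := Finset.exists_min_image (Finset.range q) (fun m => (S m : ℝ) - m * γ)
    ⟨0, Finset.mem_range.2 (by omega)⟩
  have hg : ∀ n : ℕ, (S m : ℝ) - m * γ ≤ S n - n * γ := by
    intro n
    have e1 : ∀ j r : ℕ, S (j * q + r) = j * S q + S r := by
      intro j r
      induction j with
      | zero => simp
      | succ j ih =>
        rw [Nat.succ_mul, show j * q + q + r = q + (j * q + r) by ring, hSq, ih]; push_cast; ring
    have h1 := hm (n % q) (Finset.mem_range.2 (Nat.mod_lt _ (by omega)))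
    have h2 := e1 (n / q) (n % q)
    rw [Nat.div_add_mod' n q] at h2
    have h3 : (n : ℝ) = (n / q : ℕ) * q + (n % q : ℕ) := by exact_mod_cast (Nat.div_add_mod' n q).symm
    rw [h2, Int.cast_add, Int.cast_mul, Int.cast_natCast, hslope]
    generalize ((n / q : ℕ) : ℝ) = a at *
    generalize ((n % q : ℕ) : ℝ) = b at *
    rw [h3]
    linarith
  set y := (betaMap β)^[m] x with hy
  have hym := iterate_betaMap_mem β hx m
  have hsum : ∀ n : ℕ, ∑ i ∈ Finset.range n, greedyDigit β y i = ⌈(n : ℝ) * γ⌉ := by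
    intro n
    have h1 := hg (m + n)
    have h2 := hSadd m n
    have h3 := hbd m n
    have h4 : ⌈(n : ℝ) * γ⌉ ≤ S (m + n) - S m := by
      rw [Int.ceil_le]; push_cast at h1 ⊢; linarith
    rw [← hy] at h2
    omega
  have hD : ∀ n : ℕ, upperValue β γ (n * γ) - (betaMap β)^[n] y = β ^ n * (1 - y) := by
    intro n
    induction n with
    | zero => simp [hV]
    | succ n ih =>
      have h1 := mul_upperValue hβ γ (n * γ)
      have e : (n : ℝ) * γ + γ = ((n + 1 : ℕ) : ℝ) * γ := by push_cast; ring
      rw [e] at h1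
      have h2 := iterate_betaMap_succ β y n
      have h3 := hsum (n + 1)
      rw [Finset.sum_range_succ, hsum n] at h3
      have h4 : (greedyDigit β y n : ℝ) = ((⌈((n + 1 : ℕ) : ℝ) * γ⌉ - ⌈(n : ℝ) * γ⌉ : ℤ) : ℝ) := by
        rw [← h3]; push_cast; ring
      rw [h2, h4, pow_succ]
      linear_combination β * ih - h1
  obtain ⟨n, hn⟩ := pow_unbounded_of_one_lt (1 / (1 - y)) hβ
  rw [div_lt_iff₀ (by linarith [hym.2])] at hn
  have h1 := hD n
  have h2 := upperValue_le hβ γ (n * γ)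
  have h3 := (iterate_betaMap_mem β hym n).1
  rw [hV] at h2
  linarith

theorem isolatedPoints_eq_empty (hβ : 1 < β) (hγ : 0 < γ) (hV : upperValue β γ 0 = 1) :
    isolatedPoints (minimalPoints β) = ∅ := by
  have hβ0 : 0 < β := by linarith
  rw [eq_empty_iff_forall_notMem]
  rintro t ⟨ht, U, hU, hUS⟩
  by_cases hper : ∀ n, n ≠ 0 → (betaMap β)^[n] t ≠ t
  · obtain ⟨y, hy, hyt⟩ := accPt_iff_nhds.1 (accPt_of_not_periodic hβ ht hper) U hU
    rw [hUS] at hy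
    exact hyt hy
  push Not at hper
  obtain ⟨q, hq, hper⟩ := hper
  have hperp : Function.IsPeriodicPt (betaMap β) q t := hper
  have htlow : t < 1 - 1 / β := by
    by_contra! h
    exact not_periodic_of_ge hβ hV ht.1 (fun n => h.trans (ht.2 n)) hq hper
  obtain ⟨i₁, hi₁q, hi₁⟩ := Finset.exists_max_image (Finset.range q) (fun i => (betaMap β)^[i] t)
    ⟨0, Finset.mem_range.2 (by omega)⟩
  set p := (betaMap β)^[i₁] t with hp
  have hp1 : p < 1 := (iterate_betaMap_mem β ht.1 i₁).2
  have hmax : ∀ n, (betaMap β)^[n] t ≤ p := by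
    intro n
    rw [← hperp.iterate_mod_apply n]
    exact hi₁ _ (Finset.mem_range.2 (Nat.mod_lt _ (by omega)))
  -- With y > p, a point following t from the right can be carried past p onto y. With y > t + 1/β,
  -- the orbit of y, which stays above y - 1/β, remains above that point.
  obtain ⟨γ', hγ'0, hγ', hv⟩ := exists_slope_lt hβ (l := 0) hγ hγ (v := max p (t + 1 / β))
    (by rw [hV]; exact max_lt hp1 (by linarith))
  set y := upperValue β γ' 0 with hy
  have hy1 : y < 1 := by
    rw [← hV]; exact upperValue_strictMono hβ hγ'
  have hpy : p < y := (le_max_left _ _).trans_lt hv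
  have hty : t < y - 1 / β := by linarith [le_max_right p (t + 1 / β)]
  have hyorb : ∀ n, y - 1 / β ≤ (betaMap β)^[n] y := by
    intro n
    rw [iterate_upperValue hβ hγ'0 hy1]
    exact upperValue_sub_le hβ γ' _
  obtain ⟨ε, hε, hball⟩ := Metric.mem_nhds_iff.1 hU
  obtain ⟨M, hM⟩ := exists_pow_lt_of_lt_one (y := β⁻¹) (lt_min hε (sub_pos.2 hty))
    (inv_lt_one_of_one_lt₀ hβ)
  obtain ⟨N, hN1, hN2⟩ : ∃ N, (betaMap β)^[N] t = p ∧ M ≤ N := by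
    refine ⟨i₁ + q * M, ?_, le_add_left (Nat.le_mul_of_pos_left _ (by omega))⟩
    rw [Function.iterate_add_apply, (hperp.mul_const M).eq]
  set e := (y - p) / β ^ N with he
  have he0 : 0 < e := div_pos (by linarith) (by positivity)
  have hesmall : e < min ε (y - 1 / β - t) := by
    refine lt_of_le_of_lt ?_ hM
    rw [inv_pow, ← one_div, he]
    have : 0 ≤ p := (iterate_betaMap_mem β ht.1 i₁).1
    exact div_le_div₀ zero_le_one (by linarith) (by positivity) (pow_le_pow_right₀ hβ.le hN2)
  have hsh : ∀ i ≤ N, (betaMap β)^[i] (t + e) = (betaMap β)^[i] t + β ^ i * e := by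
    have := iterate_betaMap_shadow (β := β) (x := t) (y := t + e) (n := N) (fun i hi => by
      rw [add_sub_cancel_left]
      have h1 : β ^ i * e ≤ y - p := by
        have h2 : β ^ i ≤ β ^ N := pow_le_pow_right₀ hβ.le hi
        calc β ^ i * e ≤ β ^ N * e := by gcongr
          _ = y - p := by rw [he]; field_simp
      have h3 : 0 ≤ β ^ i * e := by positivity
      exact ⟨by linarith [(iterate_betaMap_mem β ht.1 i).1], by linarith [hmax i]⟩)
    intro i hi
    rw [this i hi, add_sub_cancel_left]
  have hmem : t + e ∈ minimalPoints β := by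
    have h1 : e < y - 1 / β - t := hesmall.trans_le (min_le_right _ _)
    have h2 : 0 < 1 / β := by positivity
    refine ⟨⟨by linarith [ht.1.1], by linarith⟩, fun n => ?_⟩
    rcases le_total n N with hn | hn
    · rw [hsh n hn]
      have h3 : 1 ≤ β ^ n := one_le_pow₀ hβ.le
      have := ht.2 n
      nlinarith
    · obtain ⟨k, rfl⟩ : ∃ k, n = k + N := ⟨n - N, by omega⟩
      rw [Function.iterate_add_apply, hsh N le_rfl, hN1, show p + β ^ N * e = y by
        rw [he]; field_simp; ring]
      linarith [hyorb k]
  have : t + e ∈ U ∩ minimalPoints β := by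
    refine ⟨hball ?_, hmem⟩
    rw [Metric.mem_ball, Real.dist_eq, add_sub_cancel_left, abs_of_pos he0]
    exact hesmall.trans_le (min_le_left _ _)
  rw [hUS, mem_singleton_iff] at this
  linarith

end Rotation

/-! ### The set of bases of upper rotation sequences -/

/-- The bases `β` in which the upper rotation sequence of some slope has the value one. -/
def rotationBases : Set ℝ := {β | 1 < β ∧ ∃ γ > 0, upperValue β γ 0 = 1}

theorem sumValue_antitone_base {β β' : ℝ} (hβ : 1 < β) (h : β ≤ β') {S : ℕ → ℤ} (hS : Monotone S)
    (hb : BddIncrements S) : sumValue β' S ≤ sumValue β S := by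
  refine (summable_sumValue (hβ.trans_le h) hb).tsum_le_tsum (fun i => ?_) (summable_sumValue hβ hb)
  have : (0 : ℝ) ≤ ((S (i + 1) - S i : ℤ) : ℝ) := by exact_mod_cast sub_nonneg.2 (hS (Nat.le_succ i))
  gcongr

theorem sumValue_lt_of_base_lt {β β' : ℝ} (hβ : 1 < β) (h : β < β') {S : ℕ → ℤ} (hS : Monotone S)
    (hb : BddIncrements S) (h01 : S 0 < S 1) : sumValue β' S < sumValue β S := by
  refine (summable_sumValue (hβ.trans h) hb).tsum_lt_tsum (i := 0) (fun i => ?_) ?_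
    (summable_sumValue hβ hb)
  · have : (0 : ℝ) ≤ ((S (i + 1) - S i : ℤ) : ℝ) := by
      exact_mod_cast sub_nonneg.2 (hS (Nat.le_succ i))
    gcongr
  · have : (0 : ℝ) < ((S (0 + 1) - S 0 : ℤ) : ℝ) := by exact_mod_cast sub_pos.2 h01
    gcongr

/-- For b near 1 the first n digits already give at least S n / b^n ≥ 1, and for a large base the
value is at most 1; the value is continuous in between. -/
theorem exists_base {S : ℕ → ℤ} (hS : Monotone S) (hb : BddIncrements S) (h0 : S 0 = 0) {n : ℕ}
    (hn : 2 ≤ S n) : ∃ β > 1, sumValue β S = 1 := by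
  obtain ⟨C, hC⟩ := id hb
  have hinc : ∀ i, (0 : ℝ) ≤ ((S (i + 1) - S i : ℤ) : ℝ) := fun i => by
    exact_mod_cast sub_nonneg.2 (hS (Nat.le_succ i))
  have hC0 : 0 ≤ C := (abs_nonneg _).trans (hC 0)
  obtain ⟨b, hb2, hb1⟩ : ∃ b : ℝ, b ^ n < 2 ∧ 1 < b := by
    have h1 : ∀ᶠ b : ℝ in 𝓝[>] 1, b ^ n < 2 := by
      refine eventually_nhdsWithin_of_eventually_nhds ?_
      exact ((continuous_pow n).tendsto (1 : ℝ)).eventually_lt_const (by norm_num)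
    exact (h1.and self_mem_nhdsWithin).exists
  set B := max b (C + 1) with hB
  have hbB : b ≤ B := le_max_left _ _
  have hB1 : 1 < B := hb1.trans_le hbB
  have hcont : ContinuousOn (fun β => sumValue β S) (Icc b B) := by
    refine continuousOn_tsum (u := fun i => C / b ^ (i + 1)) (fun i => ?_)
      (summable_const_div_pow hb1 C) (fun i x hx => ?_)
    · refine continuousOn_const.div (continuousOn_id.pow _) fun x hx => ?_
      have : 0 < x := by linarith [hx.1]
      exact (pow_pos this _).ne'
    · have hx0 : 0 < x := by linarith [hx.1]
      rw [Real.norm_eq_abs, abs_div, abs_of_pos (pow_pos hx0 _)]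
      have hbx := hx.1
      gcongr
      exact hC i
  have hlow : 1 ≤ sumValue b S := by
    have h1 : ∑ i ∈ Finset.range n, ((S (i + 1) - S i : ℤ) : ℝ) / b ^ (i + 1) ≤ sumValue b S :=
      (summable_sumValue hb1 hb).sum_le_tsum _ (fun i _ => div_nonneg (hinc i) (by positivity))
    have h2 : ∑ i ∈ Finset.range n, ((S (i + 1) - S i : ℤ) : ℝ) / b ^ n ≤
        ∑ i ∈ Finset.range n, ((S (i + 1) - S i : ℤ) : ℝ) / b ^ (i + 1) := by
      refine Finset.sum_le_sum fun i hi => ?_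
      rw [Finset.mem_range] at hi
      have := hinc i
      gcongr
      · exact hb1.le
      · omega
    have h3 : ∑ i ∈ Finset.range n, ((S (i + 1) - S i : ℤ) : ℝ) / b ^ n = S n / b ^ n := by
      rw [← Finset.sum_div, ← Int.cast_sum, Finset.sum_range_sub, h0, sub_zero]
    have h4 : 1 ≤ (S n : ℝ) / b ^ n := by
      rw [one_le_div (by positivity)]
      have : (2 : ℝ) ≤ S n := by exact_mod_cast hn
      linarith
    linarith
  have hhigh : sumValue B S ≤ 1 := by
    have h1 := (hasSum_one_div_pow_succ hB1).mul_left C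
    have h2 : sumValue B S ≤ C * (1 / (B - 1)) := by
      rw [← h1.tsum_eq]
      refine (summable_sumValue hB1 hb).tsum_le_tsum (fun i => ?_) h1.summable
      rw [mul_one_div]
      gcongr
      exact (le_abs_self _).trans (hC i)
    refine h2.trans ?_
    rw [mul_one_div, div_le_one (by linarith)]
    linarith [le_max_right b (C + 1)]
  obtain ⟨β, hβ, h⟩ := intermediate_value_Icc' hbB hcont ⟨hhigh, hlow⟩
  exact ⟨β, hb1.trans_le hβ.1, h⟩

theorem exists_two_le_mul {γ : ℝ} (hγ : 0 < γ) : ∃ n : ℕ, n ≠ 0 ∧ 2 ≤ (n : ℝ) * γ := by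
  obtain ⟨n, hn⟩ := exists_nat_ge (2 / γ)
  refine ⟨n, ?_, ?_⟩
  · rintro rfl
    have : 0 < 2 / γ := by positivity
    push_cast at hn; linarith
  · rwa [div_le_iff₀ hγ] at hn

theorem exists_base_upperValue {γ : ℝ} (hγ : 0 < γ) : ∃ β > 1, upperValue β γ 0 = 1 := by
  obtain ⟨n, -, hn⟩ := exists_two_le_mul hγ
  refine exists_base (ceilSum_monotone hγ.le 0) (bddIncrements_ceilSum γ 0) (ceilSum_zero γ 0)
    (n := n) ?_
  rw [ceilSum_zero_right]
  have : (2 : ℝ) ≤ ⌈(n : ℝ) * γ⌉ := hn.trans (Int.le_ceil _)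
  exact_mod_cast this

/-- A base determines its slope, by strict monotonicity of the value, and every positive slope has a
base. -/
theorem not_countable_rotationBases : ¬ rotationBases.Countable := by
  intro hc
  choose! f hf1 hf2 using fun (γ : ℝ) (hγ : γ ∈ Ioi (0 : ℝ)) => exists_base_upperValue hγ
  have hmaps : MapsTo f (Ioi 0) rotationBases := fun γ hγ => ⟨hf1 γ hγ, γ, hγ, hf2 γ hγ⟩
  have hinj : InjOn f (Ioi 0) := by
    intro γ hγ γ' hγ' h
    have h1 := hf2 γ' hγ'
    rw [← h, ← hf2 γ hγ] at h1
    exact ((upperValue_strictMono (hf1 γ hγ)).injective h1).symm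
  have h1 := hmaps.countable_of_injOn hinj hc
  have h2 := h1.measure_zero volume
  simp at h2

/-- Two rotation bases with the same first digits are close. -/
theorem abs_sub_le_of_ceil_eq {b B β β' γ γ' : ℝ} (hb : 1 < b) (hbβ : b ≤ β) (hβB : β ≤ B)
    (hbβ' : b ≤ β') (hβB' : β' ≤ B) (hγ : 0 < γ) (hγ' : 0 < γ') (hV : upperValue β γ 0 = 1)
    (hV' : upperValue β' γ' 0 = 1) {n : ℕ} (hn : n ≠ 0)
    (h : ∀ i ≤ n, ⌈(i : ℝ) * γ⌉ = ⌈(i : ℝ) * γ'⌉) : |β - β'| ≤ B ^ 2 / b ^ n := by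
  wlog hle : β ≤ β' generalizing β β' γ γ'
  · rw [abs_sub_comm]
    exact this hbβ' hβB' hbβ hβB hγ' hγ hV' hV (fun i hi => (h i hi).symm) (by linarith)
  have key : ∀ x δ : ℝ, b ≤ x → 0 < δ → upperValue x δ 0 = 1 →
      (∀ i ≤ n, ⌈(i : ℝ) * γ⌉ = ⌈(i : ℝ) * δ⌉) →
      defect (fun i => ceilSum γ 0 (i + 1) - ceilSum γ 0 i) n x ∈ Icc 0 (1 / b ^ n) := by
    intro x δ hx hδ hxV hx2
    have hx1 : 1 < x := hb.trans_le hx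
    have e1 : defect (fun i => ceilSum γ 0 (i + 1) - ceilSum γ 0 i) n x =
        sumValue x (fun m => ceilSum δ 0 (n + m) - ⌈(n : ℝ) * δ⌉) / x ^ n := by
      have h1 := sumValue_shift hx1 (bddIncrements_ceilSum δ 0) n (⌈(n : ℝ) * δ⌉)
      rw [upperValue] at hxV
      rw [hxV] at h1
      rw [defect, sub_eq_iff_eq_add']
      refine h1.trans ?_
      congr 1
      refine Finset.sum_congr rfl fun i hi => ?_
      rw [Finset.mem_range] at hi
      simp only [ceilSum_zero_right]
      rw [hx2 i hi.le, hx2 (i + 1) hi]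
    have e2 : (fun m => ceilSum δ 0 (n + m) - ⌈(n : ℝ) * δ⌉) = ceilSum δ (n * δ) := by
      funext m
      simp only [ceilSum]; push_cast
      rw [zero_add, Int.ceil_zero, sub_zero, add_mul]
    rw [e1, e2]
    have h3 := upperValue_le hx1 δ (n * δ)
    rw [hxV] at h3
    have h4 : 0 ≤ sumValue x (ceilSum δ (n * δ)) := sumValue_nonneg hx1 (ceilSum_monotone hδ.le _)
    have h5 : 0 < x := by linarith
    refine ⟨by positivity, ?_⟩
    exact div_le_div₀ zero_le_one h3 (by positivity) (by gcongr)
  have h1 := key β γ hbβ hγ hV (fun i _ => rfl)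
  have h2 := key β' γ' hbβ' hγ' hV' h
  have h3 := defect_sub_ge (a := fun i => ceilSum γ 0 (i + 1) - ceilSum γ 0 i)
    (fun i => sub_nonneg.2 (ceilSum_monotone hγ.le 0 (Nat.le_succ i)))
    (by
      simp only [ceilSum_zero_right]
      have : 0 < ⌈γ⌉ := Int.ceil_pos.2 hγ
      push_cast
      simp; omega) hn (show 0 < β by linarith) hle hβB'
  rw [abs_sub_comm, abs_of_nonneg (by linarith)]
  have hB : 0 < B := by linarith
  have h4 : (β' - β) / B ^ 2 ≤ 1 / b ^ n := by linarith [h1.1, h2.2]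
  rw [div_le_iff₀ (by positivity)] at h4
  calc β' - β ≤ 1 / b ^ n * B ^ 2 := h4
    _ = B ^ 2 / b ^ n := by ring

/-- Slopes up to B have at most quadratically many prefixes of length n, and bases sharing a prefix
are within B^2 / b^n. The d-dimensional sums of these covers tend to 0. -/
theorem hausdorffMeasure_rotationBases_inter {b : ℝ} (hb : 1 < b) {B : ℕ} {d : ℝ} (hd : 0 < d) :
    μH[d] (rotationBases ∩ Icc b B) = 0 := by
  set M : ℕ → ℕ := fun n => (n + 1) * (n * B + 1) + 1 with hM
  set c : ℕ → ℝ → ℤ := fun n γ => ∑ i ∈ Finset.range (n + 1), ⌈(i : ℝ) * γ⌉ with hc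
  set t : ∀ n : ℕ, Fin (M n) → Set ℝ := fun n j =>
    {β | β ∈ Icc b (B : ℝ) ∧ ∃ γ > 0, upperValue β γ 0 = 1 ∧ c n γ = j} with ht
  have hdiam : ∀ n : ℕ, n ≠ 0 → ∀ j, Metric.ediam (t n j) ≤
      ENNReal.ofReal ((B : ℝ) ^ 2 / b ^ n) := by
    intro n hn j
    refine Metric.ediam_le fun x hx y hy => ?_
    obtain ⟨⟨hx1, hx2⟩, γ, hγ, hxV, hxc⟩ := hx
    obtain ⟨⟨hy1, hy2⟩, γ', hγ', hyV, hyc⟩ := hy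
    rw [edist_dist, Real.dist_eq]
    apply ENNReal.ofReal_le_ofReal
    -- Each ceiling is monotone in the slope, so equality of the total `c n` forces equality of all
    -- of them. The single integer `c n γ` thus encodes the prefix.
    have hsum : ∀ u v : ℝ, u ≤ v → c n u = c n v → ∀ i ≤ n, ⌈(i : ℝ) * u⌉ = ⌈(i : ℝ) * v⌉ := by
      intro u v huv huv' i hi
      refine (Finset.sum_eq_sum_iff_of_le fun i _ => ?_).1 huv' i (Finset.mem_range.2 (by omega))
      exact Int.ceil_mono (by gcongr)
    refine abs_sub_le_of_ceil_eq hb hx1 hx2 hy1 hy2 hγ hγ' hxV hyV hn fun i hi => ?_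
    rcases le_total γ γ' with h | h
    · exact hsum γ γ' h (hxc.trans hyc.symm) i hi
    · exact (hsum γ' γ h (hyc.trans hxc.symm) i hi).symm
  have hcov : ∀ n, rotationBases ∩ Icc b (B : ℝ) ⊆ ⋃ j, t n j := by
    rintro n β ⟨⟨hβ1, γ, hγ, hV⟩, hβ⟩
    have hγβ := le_of_upperValue_le_one hβ1 hγ.le hV.le
    have hc0 : 0 ≤ c n γ := Finset.sum_nonneg fun i _ => Int.ceil_nonneg (by positivity)
    have hcM : c n γ ≤ (n + 1) * (n * B + 1) := by
      have h1 : ∀ i ∈ Finset.range (n + 1), ⌈(i : ℝ) * γ⌉ ≤ ((n * B + 1 : ℕ) : ℤ) := by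
        intro i hi
        rw [Finset.mem_range] at hi
        rw [Int.ceil_le]
        push_cast
        have h2 : (i : ℝ) ≤ n := by exact_mod_cast (by omega : i ≤ n)
        have h3 : γ ≤ B := hγβ.trans hβ.2
        have : (i : ℝ) * γ ≤ n * B := by gcongr
        linarith
      have := Finset.sum_le_sum h1
      simpa using this
    refine mem_iUnion.2 ⟨⟨(c n γ).toNat, ?_⟩, hβ, γ, hγ, hV, ?_⟩
    · have : (c n γ).toNat < M n ↔ c n γ < M n := by omega
      rw [this, hM]; push_cast; omega
    · simp only; omega
  have hr : Tendsto (fun n : ℕ => ENNReal.ofReal ((B : ℝ) ^ 2 / b ^ n)) atTop (𝓝 0) := by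
    rw [← ENNReal.ofReal_zero]
    exact ENNReal.tendsto_ofReal
      (tendsto_const_nhds.div_atTop (tendsto_pow_atTop_atTop_of_one_lt hb))
  have hle := Measure.hausdorffMeasure_le_liminf_sum d (rotationBases ∩ Icc b (B : ℝ)) _ hr t
    (by filter_upwards [eventually_ne_atTop 0] with n hn j using hdiam n hn j)
    (Eventually.of_forall hcov)
  have hsum : ∀ᶠ n in atTop, ∑ j, Metric.ediam (t n j) ^ d ≤
      ENNReal.ofReal ((M n : ℝ) * ((B : ℝ) ^ 2 / b ^ n) ^ d) := by
    filter_upwards [eventually_ne_atTop 0] with n hn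
    calc ∑ j, Metric.ediam (t n j) ^ d ≤ ∑ j : Fin (M n), ENNReal.ofReal ((B : ℝ) ^ 2 / b ^ n) ^ d :=
          Finset.sum_le_sum fun j _ => ENNReal.rpow_le_rpow (hdiam n hn j) hd.le
      _ = ENNReal.ofReal ((M n : ℝ) * ((B : ℝ) ^ 2 / b ^ n) ^ d) := by
          rw [Finset.sum_const, Finset.card_univ, Fintype.card_fin, nsmul_eq_mul,
            ENNReal.ofReal_rpow_of_nonneg (by positivity) hd.le,
            ENNReal.ofReal_mul (by positivity), ENNReal.ofReal_natCast]
  have hlim : Tendsto (fun n : ℕ => ENNReal.ofReal ((M n : ℝ) * ((B : ℝ) ^ 2 / b ^ n) ^ d)) atTop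
      (𝓝 0) := by
    rw [← ENNReal.ofReal_zero]
    refine ENNReal.tendsto_ofReal ?_
    set r : ℝ := (b ^ d)⁻¹ with hrdef
    have hbd : 1 < b ^ d := Real.one_lt_rpow hb hd
    have hr0 : 0 < r := inv_pos.2 (by linarith)
    have hr1 : r < 1 := inv_lt_one_of_one_lt₀ hbd
    have t2 := tendsto_pow_const_mul_const_pow_of_lt_one 2 hr0.le hr1
    have t1 := tendsto_self_mul_const_pow_of_lt_one hr0.le hr1
    have t0 := tendsto_pow_atTop_nhds_zero_of_lt_one hr0.le hr1
    have := (((t2.const_mul (B : ℝ)).add (t1.const_mul ((B : ℝ) + 1))).add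
      (t0.const_mul 2)).const_mul (((B : ℝ) ^ 2) ^ d)
    simp only [mul_zero, add_zero] at this
    refine this.congr fun n => ?_
    have e : ((B : ℝ) ^ 2 / b ^ n) ^ d = ((B : ℝ) ^ 2) ^ d * r ^ n := by
      rw [Real.div_rpow (by positivity) (by positivity), hrdef, inv_pow, div_eq_mul_inv,
        ← Real.rpow_natCast b n, ← Real.rpow_natCast (b ^ d) n, ← Real.rpow_mul (by linarith),
        ← Real.rpow_mul (by linarith), mul_comm d]
    rw [e, hM]; push_cast; ring
  refine le_antisymm (hle.trans ?_) zero_le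
  calc liminf (fun n => ∑ j, Metric.ediam (t n j) ^ d) atTop
      ≤ liminf (fun n : ℕ => ENNReal.ofReal ((M n : ℝ) * ((B : ℝ) ^ 2 / b ^ n) ^ d)) atTop :=
        liminf_le_liminf hsum
    _ = 0 := hlim.liminf_eq

theorem dimH_rotationBases : dimH rotationBases = 0 := by
  have hsub : rotationBases ⊆ ⋃ k : ℕ, rotationBases ∩ Icc (1 + 1 / ((k : ℝ) + 1)) (k : ℝ) := by
    rintro β ⟨hβ, h⟩
    obtain ⟨k₁, hk₁⟩ := exists_nat_gt (1 / (β - 1))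
    obtain ⟨k₂, hk₂⟩ := exists_nat_ge β
    rw [div_lt_iff₀ (by linarith)] at hk₁
    refine mem_iUnion.2 ⟨max k₁ k₂, ⟨hβ, h⟩, ?_, ?_⟩
    · have h1 : (k₁ : ℝ) ≤ (max k₁ k₂ : ℕ) := by exact_mod_cast le_max_left _ _
      have h2 : 1 / (((max k₁ k₂ : ℕ) : ℝ) + 1) ≤ β - 1 := by
        rw [div_le_iff₀ (by positivity)]; nlinarith
      linarith
    · exact hk₂.trans (by exact_mod_cast le_max_right _ _)
  refine le_antisymm ((dimH_mono hsub).trans ?_) zero_le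
  rw [dimH_iUnion]
  refine iSup_le fun k => ?_
  refine dimH_le fun d' hd' => ?_
  by_contra! h
  have hpos : (0 : ℝ) < d' := by exact_mod_cast h
  rw [hausdorffMeasure_rotationBases_inter (by
    have : 0 < 1 / ((k : ℝ) + 1) := by positivity
    linarith) hpos] at hd'
  exact ENNReal.zero_ne_top hd'

/-! ### Christoffel words -/

/-- The lower Christoffel word of slope `p / q`. -/
def christoffel (p q : ℕ) : List ℕ := (List.range q).map fun i => (i + 1) * p / q - i * p / q

/-- The upper Christoffel word of slope `p / q`. -/
def upperChristoffel (p q : ℕ) : List ℕ :=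
  (List.range q).map fun i => ((i + 1) * p + (q - 1)) / q - (i * p + (q - 1)) / q

theorem length_christoffel (p q : ℕ) : (christoffel p q).length = q := by simp [christoffel]

theorem length_upperChristoffel (p q : ℕ) : (upperChristoffel p q).length = q := by
  simp [upperChristoffel]

/-- The mediant exceeds a/b by 1/(b(b+d)), so i ≤ b steps add less than 1/b, and no integer is
crossed from a fraction with denominator b. -/
theorem mul_mediant_div_left {a b c d i : ℕ} (hb : 0 < b) (h : b * c = a * d + 1) (hi : i ≤ b)
    (hd : 0 < d) : i * (a + c) / (b + d) = i * a / b := by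
  have h1 := Nat.div_add_mod (i * a) b
  have h2 := Nat.mod_lt (i * a) hb
  set k := i * a / b
  set r := i * a % b
  rw [Nat.div_eq_iff (by omega)]
  have key : b * (i * (a + c)) = (b * k + r) * (b + d) + i := by
    rw [h1]
    have : b * (i * (a + c)) = i * a * b + i * (b * c) := by ring
    rw [this, h]; ring
  constructor
  · by_contra! hlt
    have h3 : b * (i * (a + c) + 1) ≤ b * ((b + d) * k) := Nat.mul_le_mul_left b (by nlinarith)
    nlinarith
  · by_contra! hlt
    have h3 : b * (k * (b + d) + (b + d)) ≤ b * (i * (a + c)) := Nat.mul_le_mul_left b (by omega)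
    have h4 : (b * k + r) * (b + d) ≤ (b * k + (b - 1)) * (b + d) :=
      Nat.mul_le_mul_right _ (by omega)
    obtain ⟨b', rfl⟩ : ∃ b', b = b' + 1 := ⟨b - 1, by omega⟩
    simp only [Nat.add_sub_cancel] at h4
    nlinarith

/-- Measured back from the end, the line of mediant slope exceeds a + jc/d by (d-j)/(d(b+d)) < 1/d,
again too little to cross an integer. -/
theorem mul_mediant_div_right {a b c d j : ℕ} (hb : 0 < b) (h : b * c = a * d + 1) (hj : j ≤ d)
    (hd : 0 < d) : (b + j) * (a + c) / (b + d) = a + j * c / d := by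
  have h1 := Nat.div_add_mod (j * c) d
  have h2 := Nat.mod_lt (j * c) hd
  set k := j * c / d
  set r := j * c % d
  rw [Nat.div_eq_iff (by omega)]
  have key : d * ((b + j) * (a + c)) + (b + j) = (d * (a + k) + r + 1) * (b + d) := by
    have e1 : d * (a + k) + r + 1 = b * c + j * c := by rw [h]; linarith
    rw [e1]
    have : d * ((b + j) * (a + c)) + (b + j) = (b + j) * (a * d + 1) + (b + j) * (c * d) := by ring
    rw [this, ← h]; ring
  constructor
  · by_contra! hlt
    have h3 : d * ((b + j) * (a + c) + 1) ≤ d * ((a + k) * (b + d)) := Nat.mul_le_mul_left d hlt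
    nlinarith
  · by_contra! hlt
    have h3 : d * ((a + k) * (b + d) + (b + d)) ≤ d * ((b + j) * (a + c)) :=
      Nat.mul_le_mul_left d (by omega)
    have h4 : (d * (a + k) + r + 1) * (b + d) ≤ (d * (a + k) + d) * (b + d) :=
      Nat.mul_le_mul_right _ (by omega)
    nlinarith

theorem christoffel_append {a b c d : ℕ} (hb : 0 < b) (hd : 0 < d) (h : b * c = a * d + 1) :
    christoffel a b ++ christoffel c d = christoffel (a + c) (b + d) := by
  rw [christoffel, christoffel, christoffel, List.range_add, List.map_append, List.map_map]
  congr 1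
  · refine List.map_congr_left fun i hi => ?_
    rw [List.mem_range] at hi
    rw [mul_mediant_div_left hb h hi.le hd, mul_mediant_div_left hb h (by omega) hd]
  · refine List.map_congr_left fun i hi => ?_
    rw [List.mem_range] at hi
    simp only [Function.comp]
    rw [add_assoc, mul_mediant_div_right hb h hi.le hd, mul_mediant_div_right hb h (by omega) hd,
      Nat.add_sub_add_left]

theorem incr_christoffel (p : ℕ) {q : ℕ} (hq : 0 < q) :
    incr (christoffel p q) = christoffel (p + q) q := by
  rw [incr, christoffel, christoffel, List.map_map]
  refine List.map_congr_left fun i _ => ?_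
  simp only [Function.comp]
  rw [mul_add, mul_add, Nat.add_mul_div_right _ _ hq, Nat.add_mul_div_right _ _ hq]
  have : i * p / q ≤ (i + 1) * p / q := Nat.div_le_div_right (Nat.mul_le_mul_right p (by omega))
  omega

theorem iterate_incr_christoffel (p : ℕ) {q : ℕ} (hq : 0 < q) (k : ℕ) :
    incr^[k] (christoffel p q) = christoffel (p + k * q) q := by
  induction k with
  | zero => simp
  | succ k ih =>
    rw [Function.iterate_succ_apply', ih, incr_christoffel _ hq]
    congr 1; ring

/-! ### Farey words are Christoffel words -/

/-- Two words are the Christoffel words of neighbouring Farey fractions in the unit interval. -/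
def FareyNeighbours (u v : List ℕ) : Prop :=
  ∃ a b c d : ℕ, u = christoffel a b ∧ v = christoffel c d ∧ 0 < b ∧ 0 < d ∧ b * c = a * d + 1

/-- A word is the Christoffel word of a reduced fraction. -/
def IsChristoffel (w : List ℕ) : Prop := ∃ a b : ℕ, 0 < b ∧ Nat.Coprime a b ∧ w = christoffel a b

theorem FareyNeighbours.left_append {u v : List ℕ} (h : FareyNeighbours u v) :
    FareyNeighbours u (u ++ v) := by
  obtain ⟨a, b, c, d, rfl, rfl, hb, hd, h⟩ := h
  exact ⟨a, b, a + c, b + d, rfl, christoffel_append hb hd h, hb, by omega, by linarith⟩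

theorem FareyNeighbours.append_right {u v : List ℕ} (h : FareyNeighbours u v) :
    FareyNeighbours (u ++ v) v := by
  obtain ⟨a, b, c, d, rfl, rfl, hb, hd, h⟩ := h
  exact ⟨a + c, b + d, c, d, christoffel_append hb hd h, rfl, by omega, hd, by linarith⟩

theorem FareyNeighbours.isChristoffel {u v : List ℕ} (h : FareyNeighbours u v) :
    IsChristoffel v := by
  obtain ⟨a, b, c, d, rfl, rfl, hb, hd, h⟩ := h
  refine ⟨c, d, hd, ?_, rfl⟩
  have h1 : Nat.gcd c d ∣ a * d + 1 := h ▸ Dvd.dvd.mul_left (Nat.gcd_dvd_left c d) b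
  have h2 : Nat.gcd c d ∣ a * d := Dvd.dvd.mul_left (Nat.gcd_dvd_right c d) a
  exact Nat.dvd_one.1 ((Nat.dvd_add_right h2).1 h1)

theorem fareyInsert_cons (u : List ℕ) (l : List (List ℕ)) :
    ∃ l', fareyInsert (u :: l) = u :: l' := by
  cases l with
  | nil => exact ⟨[], rfl⟩
  | cons v l => exact ⟨_, rfl⟩

theorem isChain_fareyInsert {l : List (List ℕ)} (h : List.IsChain FareyNeighbours l) :
    List.IsChain FareyNeighbours (fareyInsert l) := by
  induction l with
  | nil => exact h
  | cons u l ih =>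
    cases l with
    | nil => exact h
    | cons v l =>
      rw [List.isChain_cons_cons] at h
      have h2 := ih h.2
      obtain ⟨l', hl'⟩ := fareyInsert_cons v l
      rw [fareyInsert, hl', List.isChain_cons_cons, List.isChain_cons_cons]
      rw [hl'] at h2
      exact ⟨h.1.left_append, h.1.append_right, h2⟩

theorem isChristoffel_of_mem_fareyInsert {l : List (List ℕ)}
    (h : List.IsChain FareyNeighbours l) (hl : ∀ w ∈ l, IsChristoffel w) :
    ∀ w ∈ fareyInsert l, IsChristoffel w := by
  induction l with
  | nil => exact hl
  | cons u l ih =>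
    cases l with
    | nil => exact hl
    | cons v l =>
      rw [List.isChain_cons_cons] at h
      intro w hw
      rw [fareyInsert, List.mem_cons, List.mem_cons] at hw
      rcases hw with rfl | rfl | hw
      · exact hl _ (by simp)
      · exact h.1.left_append.isChristoffel
      · exact ih h.2 (fun w hw => hl w (List.mem_cons_of_mem _ hw)) w hw

theorem fareyList_spec (n : ℕ) : List.IsChain FareyNeighbours (fareyList n) ∧
    ∀ w ∈ fareyList n, IsChristoffel w := by
  induction n with
  | zero =>
    refine ⟨?_, ?_⟩
    · rw [fareyList, List.isChain_cons_cons]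
      exact ⟨⟨0, 1, 1, 1, by decide, by decide, by omega, by omega, by omega⟩,
        List.isChain_singleton _⟩
    · intro w hw
      simp only [fareyList, List.mem_cons, List.not_mem_nil, or_false] at hw
      rcases hw with rfl | rfl
      · exact ⟨0, 1, by omega, by decide, by decide⟩
      · exact ⟨1, 1, by omega, by decide, by decide⟩
  | succ n ih => exact ⟨isChain_fareyInsert ih.1, isChristoffel_of_mem_fareyInsert ih.1 ih.2⟩

theorem infix_fareyInsert {u v : List ℕ} {l : List (List ℕ)} (h : [u, v] <:+: l) :
    [u, u ++ v, v] <:+: fareyInsert l := by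
  obtain ⟨s, t, rfl⟩ := h
  induction s with
  | nil =>
    obtain ⟨l', hl'⟩ := fareyInsert_cons v t
    refine ⟨[], l', ?_⟩
    simp only [List.nil_append, List.cons_append, fareyInsert, hl']
  | cons x s ih =>
    obtain ⟨y, m, hm⟩ : ∃ y m, s ++ [u, v] ++ t = y :: m := by
      cases s with
      | nil => exact ⟨u, v :: t, rfl⟩
      | cons y s => exact ⟨y, s ++ [u, v] ++ t, rfl⟩
    obtain ⟨s', t', h⟩ := ih
    rw [hm] at h
    refine ⟨x :: (x ++ y) :: s', t', ?_⟩
    have e : x :: s ++ [u, v] ++ t = x :: y :: m := by rw [← hm]; simp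
    rw [e, fareyInsert, ← h]
    simp

/-- A fraction strictly between neighbours has denominator at least b + d. Each insertion replaces b
+ d by a larger number, so x/y is met as a mediant before b + d exceeds y; N bounds the remaining
steps. -/
theorem exists_mem_fareyList {x y : ℕ} (hxy : Nat.Coprime x y) (N : ℕ) :
    ∀ n a b c d : ℕ, [christoffel a b, christoffel c d] <:+: fareyList n → 0 < b → 0 < d →
      b * c = a * d + 1 → a * y < x * b → x * d < c * y → y < b + d + N →
      ∃ m, christoffel x y ∈ fareyList m := by
  induction N with
  | zero =>
    intro n a b c d _ hb hd h h1 h2 h3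
    exfalso
    -- Equivalent to y = d(xb - ay) + b(cy - xd), with both brackets at least 1.
    have e : y + (a * y) * d + (x * d) * b = (c * y) * b + (x * b) * d := by
      have : (c * y) * b = (b * c) * y := by ring
      rw [this, h]; ring
    nlinarith
  | succ N ih =>
    intro n a b c d hinf hb hd h h1 h2 h3
    have hins := infix_fareyInsert hinf
    rw [christoffel_append hb hd h] at hins
    have hinf1 : [christoffel a b, christoffel (a + c) (b + d)] <:+: fareyList (n + 1) :=
      List.IsInfix.trans ⟨[], [christoffel c d], rfl⟩ hins
    have hinf2 : [christoffel (a + c) (b + d), christoffel c d] <:+: fareyList (n + 1) :=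
      List.IsInfix.trans ⟨[christoffel a b], [], rfl⟩ hins
    rcases lt_trichotomy (x * (b + d)) ((a + c) * y) with hlt | heq | hgt
    · exact ih (n + 1) a b (a + c) (b + d) hinf1 hb (by omega) (by linarith) h1 hlt (by omega)
    · refine ⟨n + 1, ?_⟩
      have hy : y ∣ b + d := (hxy.symm).dvd_of_dvd_mul_left (heq ▸ Dvd.intro_left _ rfl)
      have h4 : b + d ≤ y := by
        have e : y + (a * y) * d + (x * d) * b = (c * y) * b + (x * b) * d := by
          have : (c * y) * b = (b * c) * y := by ring
          rw [this, h]; ring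
        nlinarith
      have h5 : y = b + d := le_antisymm (Nat.le_of_dvd (by omega) hy) h4
      have h6 : x = a + c := by
        rw [← h5] at heq
        exact Nat.eq_of_mul_eq_mul_right (by omega) heq
      rw [h5, h6]
      exact hinf1.subset (by simp)
    · exact ih (n + 1) (a + c) (b + d) c d hinf2 (by omega) hd (by linarith) hgt h2 (by omega)

theorem mem_extendedFareyWords_iff {s : List ℕ} : s ∈ extendedFareyWords ↔
    ∃ p q : ℕ, 0 < p ∧ 0 < q ∧ Nat.Coprime p q ∧ s = christoffel p q := by
  constructor
  · rintro ⟨w, hw, k, rfl⟩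
    obtain ⟨a, b, ha, hb, hab, rfl⟩ : ∃ a b : ℕ, 0 < a ∧ 0 < b ∧ Nat.Coprime a b ∧
        w = christoffel a b := by
      rcases hw with rfl | ⟨⟨n, hn⟩, h0, -⟩
      · exact ⟨1, 1, by omega, by omega, by decide, by decide⟩
      · obtain ⟨a, b, hb, hab, rfl⟩ := (fareyList_spec n).2 w hn
        refine ⟨a, b, Nat.pos_of_ne_zero ?_, hb, hab, rfl⟩
        rintro rfl
        rw [Nat.coprime_zero_left] at hab
        subst hab
        exact h0 (by decide)
    refine ⟨a + k * b, b, by omega, hb, ?_, iterate_incr_christoffel a hb k⟩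
    rwa [Nat.coprime_add_mul_right_left]
  · rintro ⟨p, q, hp, hq, hpq, rfl⟩
    rcases Nat.lt_or_ge 1 q with hq1 | hq1
    · have hmod : Nat.Coprime (p % q) q := by
        rw [Nat.Coprime, ← Nat.gcd_rec, Nat.gcd_comm]; exact hpq
      have hpos : 0 < p % q := by
        refine Nat.pos_of_ne_zero fun h => ?_
        rw [h, Nat.coprime_zero_left] at hmod
        omega
      have hlt := Nat.mod_lt p hq
      refine ⟨christoffel (p % q) q, Or.inr ⟨?_, ?_, ?_⟩, p / q, ?_⟩
      · exact exists_mem_fareyList hmod q 0 0 1 1 1 (by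
          rw [show christoffel 0 1 = [0] by decide, show christoffel 1 1 = [1] by decide]
          exact List.infix_refl _) (by omega) (by omega) (by omega) (by omega) (by omega)
          (by omega)
      · intro h
        have := congrArg List.length h
        rw [length_christoffel] at this
        simp at this; omega
      · intro h
        have := congrArg List.length h
        rw [length_christoffel] at this
        simp at this; omega
      · rw [iterate_incr_christoffel _ hq, Nat.mod_add_div']
    · obtain rfl : q = 1 := by omega
      refine ⟨christoffel 1 1, Or.inl (by decide), p - 1, ?_⟩
      rw [iterate_incr_christoffel _ hq]
      congr 1; omega

/-! ### The largest rotation -/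

theorem foldr_max_eq {l : List (List ℕ)} {w M : List ℕ} (hM : M ∈ l) (hl : ∀ x ∈ l, x ≤ M)
    (hw : w ≤ M) : l.foldr max w = M := by
  refine le_antisymm ?_ ?_
  · clear hM
    induction l with
    | nil => exact hw
    | cons x l ih =>
      exact max_le (hl x (by simp)) (ih fun y hy => hl y (List.mem_cons_of_mem _ hy))
  · clear hl
    induction l with
    | nil => simp at hM
    | cons x l ih =>
      rcases List.mem_cons.1 hM with rfl | h
      · exact le_max_left _ _
      · exact (ih h).trans (le_max_right _ _)

/-- Domination of partial sums implies lexicographic domination of the words of differences. -/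
theorem map_range_sub_le (q : ℕ) : ∀ f g : ℕ → ℕ, Monotone f → Monotone g →
    (∀ n, f n - f 0 ≤ g n - g 0) →
    (List.range q).map (fun i => f (i + 1) - f i) ≤ (List.range q).map fun i => g (i + 1) - g i := by
  induction q with
  | zero => intro f g _ _ _; simp
  | succ q ih =>
    intro f g hf hg h
    rw [List.range_succ_eq_map, List.map_cons, List.map_cons, List.map_map, List.map_map]
    rcases (h 1).lt_or_eq with h1 | h1
    · exact le_of_lt (List.Lex.rel (by simpa using h1))
    · rw [show f (0 + 1) - f 0 = g (0 + 1) - g 0 by simpa using h1]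
      refine List.cons_le_cons _ ?_
      refine ih (fun i => f (i + 1)) (fun i => g (i + 1)) (fun i j hij => hf (by omega))
        (fun i j hij => hg (by omega)) fun n => ?_
      have h2 := h (n + 1)
      have h3 := hf (show 0 ≤ 1 by omega)
      have h4 := hg (show 0 ≤ 1 by omega)
      have h5 := hf (show 1 ≤ n + 1 by omega)
      have h6 := hg (show 1 ≤ n + 1 by omega)
      simp only [zero_add]
      omega

theorem mul_div_monotone (p q c : ℕ) : Monotone fun n => (n * p + c) / q :=
  fun m n h => Nat.div_le_div_right (by have := Nat.mul_le_mul_right p h; omega)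

theorem digit_mod (p c : ℕ) {q : ℕ} (hq : 0 < q) (i : ℕ) :
    ((i % q + 1) * p + c) / q - (i % q * p + c) / q = ((i + 1) * p + c) / q - (i * p + c) / q := by
  have h := Nat.mod_add_div i q
  set k := i / q
  set r := i % q
  have e1 : (i + 1) * p + c = (r + 1) * p + c + q * (k * p) := by rw [← h]; ring
  have e2 : i * p + c = r * p + c + q * (k * p) := by rw [← h]; ring
  rw [e1, e2, Nat.add_mul_div_left _ _ hq, Nat.add_mul_div_left _ _ hq, Nat.add_sub_add_right]

theorem christoffel_rotate (p : ℕ) {q : ℕ} (hq : 0 < q) (m : ℕ) :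
    (christoffel p q).rotate m =
      (List.range q).map fun i => (m + (i + 1)) * p / q - (m + i) * p / q := by
  refine List.ext_getElem (by simp [length_christoffel]) fun i h1 h2 => ?_
  rw [List.getElem_rotate]
  simp only [christoffel, List.getElem_map, List.getElem_range, List.length_map, List.length_range]
  have := digit_mod p 0 hq (i + m)
  simp only [add_zero] at this
  rw [this]
  congr 3 <;> ring

/-- The partial sums of any rotation are differences of floors and are at most ⌈np/q⌉, the partial
sums of the upper word. The rotation by m with mp ≡ -1 mod q attains them. -/
theorem largestRotation_christoffel {p q : ℕ} (hq : 0 < q) (hpq : Nat.Coprime p q) :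
    largestRotation (christoffel p q) = upperChristoffel p q := by
  have hrot : ∀ m, (christoffel p q).rotate m ≤ upperChristoffel p q := by
    intro m
    rw [christoffel_rotate p hq]
    refine map_range_sub_le q (fun i => (m + i) * p / q) (fun i => (i * p + (q - 1)) / q)
      (fun i j h => Nat.div_le_div_right (Nat.mul_le_mul_right p (by omega)))
      (mul_div_monotone p q _) fun n => ?_
    have h0 : (0 * p + (q - 1)) / q = 0 := by
      rw [zero_mul, zero_add]; exact Nat.div_eq_of_lt (by omega)
    simp only [add_zero, h0, tsub_zero]
    rw [tsub_le_iff_left]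
    have h1 := Nat.div_add_mod (m * p) q
    have h2 := Nat.mod_lt (m * p) hq
    rw [add_mul]
    have h3 : m * p + n * p ≤ (n * p + (q - 1)) + q * (m * p / q) := by omega
    refine (Nat.div_le_div_right h3).trans ?_
    rw [Nat.add_mul_div_left _ _ hq, add_comm]
  obtain ⟨m, k, hmk⟩ : ∃ m k, m * p = k * q + (q - 1) := by
    rcases Nat.lt_or_ge 1 q with hq1 | hq1
    · obtain ⟨m, -, hm⟩ := Nat.exists_mul_mod_eq_one_of_coprime hpq hq1
      refine ⟨m * (q - 1), p * m / q * (q - 1), ?_⟩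
      have := Nat.div_add_mod (p * m) q
      rw [hm] at this
      calc m * (q - 1) * p = (p * m) * (q - 1) := by ring
        _ = (q * (p * m / q) + 1) * (q - 1) := by rw [this]
        _ = _ := by ring
    · exact ⟨0, 0, by omega⟩
  have hup : (christoffel p q).rotate m = upperChristoffel p q := by
    rw [christoffel_rotate p hq, upperChristoffel]
    refine List.map_congr_left fun i _ => ?_
    have e : ∀ n, (m + n) * p / q = k + (n * p + (q - 1)) / q := by
      intro n
      rw [add_mul, hmk, show k * q + (q - 1) + n * p = n * p + (q - 1) + q * k by ring,
        Nat.add_mul_div_left _ _ hq, add_comm]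
    rw [e, e, Nat.add_sub_add_left]
  refine foldr_max_eq ?_ ?_ ?_
  · rw [List.mem_cyclicPermutations_iff]
    exact List.IsRotated.symm ⟨m, hup⟩
  · intro x hx
    rw [List.mem_cyclicPermutations_iff] at hx
    obtain ⟨n, rfl⟩ := hx.symm
    exact hrot n
  · simpa using hrot 0

/-! ### The values of the sequences of a Christoffel word -/

theorem ceil_mul_div (p : ℕ) {q : ℕ} (hq : 0 < q) (n : ℕ) :
    ⌈(n : ℝ) * (p / q)⌉ = (((n * p + (q - 1)) / q : ℕ) : ℤ) := by
  have hq' : (0 : ℝ) < q := by positivity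
  set m := (n * p + (q - 1)) / q with hm
  have h1 := Nat.div_add_mod (n * p + (q - 1)) q
  have h2 := Nat.mod_lt (n * p + (q - 1)) hq
  rw [← hm] at h1
  have h3 : n * p ≤ q * m := by omega
  have h4 : q * m < n * p + q := by omega
  have h3' : (n : ℝ) * p ≤ q * m := by exact_mod_cast h3
  have h4' : (q : ℝ) * m < n * p + q := by exact_mod_cast h4
  rw [Int.ceil_eq_iff, ← mul_div_assoc, Int.cast_natCast]
  constructor
  · rw [lt_div_iff₀ hq']; linarith
  · rw [div_le_iff₀ hq']; linarith

theorem floor_mul_div (p q n : ℕ) : ⌊(n : ℝ) * (p / q)⌋ = ((n * p / q : ℕ) : ℤ) := by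
  have h := Nat.floor_div_eq_div (K := ℝ) (n * p) q
  rw [← h, ← mul_div_assoc, Int.natCast_floor_eq_floor (by positivity)]
  push_cast
  rfl

theorem baseValue_eq_sumValue (β : ℝ) {c S : ℕ → ℕ} (hS : Monotone S)
    (h : ∀ i, c i = S (i + 1) - S i) : baseValue β c = sumValue β fun n => (S n : ℤ) := by
  refine tsum_congr fun i => ?_
  rw [h, Nat.cast_sub (hS (Nat.le_succ i))]
  push_cast
  rfl

theorem periodicSeq_christoffel (p : ℕ) {q : ℕ} (hq : 0 < q) (i : ℕ) :
    periodicSeq (christoffel p q) i = (i + 1) * p / q - i * p / q := by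
  have h := digit_mod p 0 hq i
  simp only [add_zero] at h
  rw [← h, periodicSeq, length_christoffel]
  simp [christoffel, List.getD_eq_getElem?_getD, List.getElem?_range (Nat.mod_lt i hq)]

theorem getD_upperChristoffel (p : ℕ) {q i : ℕ} (hi : i < q) :
    (upperChristoffel p q).getD i 0 =
      ((i + 1) * p + (q - 1)) / q - (i * p + (q - 1)) / q := by
  simp [upperChristoffel, List.getD_eq_getElem?_getD, List.getElem?_range hi]

theorem periodicSeq_upperChristoffel (p : ℕ) {q : ℕ} (hq : 0 < q) (i : ℕ) :
    periodicSeq (upperChristoffel p q) i =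
      ((i + 1) * p + (q - 1)) / q - (i * p + (q - 1)) / q := by
  rw [← digit_mod p _ hq i, periodicSeq, length_upperChristoffel,
    getD_upperChristoffel p (Nat.mod_lt i hq)]

theorem baseValue_periodicSeq_upperChristoffel (β : ℝ) (p : ℕ) {q : ℕ} (hq : 0 < q) :
    baseValue β (periodicSeq (upperChristoffel p q)) = upperValue β (p / q) 0 := by
  rw [baseValue_eq_sumValue β (mul_div_monotone p q (q - 1)) (periodicSeq_upperChristoffel p hq),
    upperValue]
  congr 1
  funext n
  rw [ceilSum_zero_right, ceil_mul_div p hq]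

theorem add_sub_one_div {p q j : ℕ} (hpq : Nat.Coprime p q) (hj : 0 < j) (hjq : j < q) :
    (j * p + (q - 1)) / q = j * p / q + 1 := by
  have h1 := Nat.div_add_mod (j * p) q
  have h2 := Nat.mod_lt (j * p) (hj.trans hjq)
  have h3 : j * p % q ≠ 0 := fun h =>
    absurd (Nat.le_of_dvd hj (hpq.symm.dvd_of_dvd_mul_right (Nat.dvd_of_mod_eq_zero h)))
      (not_le.2 hjq)
  have e : j * p + (q - 1) = (j * p % q - 1) + q * (j * p / q + 1) := by
    rw [mul_add]; omega
  rw [e, Nat.add_mul_div_left _ _ (by omega), Nat.div_eq_of_lt (by omega), zero_add]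

/-- The partial sums of the lower rotation sequence whose first digit is increased by one. -/
noncomputable def raisedFloorSum (γ : ℝ) (n : ℕ) : ℤ :=
  floorSum γ 0 n + if n = 0 then 0 else 1

theorem raisedFloorSum_zero (γ : ℝ) : raisedFloorSum γ 0 = 0 := by
  simp [raisedFloorSum, floorSum_zero]

theorem raisedFloorSum_monotone {γ : ℝ} (hγ : 0 ≤ γ) : Monotone (raisedFloorSum γ) := by
  refine (floorSum_monotone hγ 0).add fun m n h => ?_
  split_ifs <;> omega

theorem raisedFloorSum_lt {γ : ℝ} (hγ : 0 ≤ γ) : raisedFloorSum γ 0 < raisedFloorSum γ 1 := by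
  have h := floorSum_monotone hγ 0 (Nat.zero_le 1)
  simp only [raisedFloorSum, if_true, one_ne_zero, if_false]
  omega

theorem bddIncrements_raisedFloorSum (γ : ℝ) : BddIncrements (raisedFloorSum γ) := by
  obtain ⟨C, hC⟩ := bddIncrements_floorSum γ 0
  obtain ⟨D, hD⟩ := bddIncrements_indicator
  refine ⟨C + D, fun i => ?_⟩
  have e : ((raisedFloorSum γ (i + 1) - raisedFloorSum γ i : ℤ) : ℝ) =
      ((floorSum γ 0 (i + 1) - floorSum γ 0 i : ℤ) : ℝ) +
        (((if i + 1 = 0 then 0 else 1) - (if i = 0 then 0 else 1) : ℤ) : ℝ) := by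
    simp only [raisedFloorSum]; push_cast; ring
  rw [e]
  exact (abs_add_le _ _).trans (add_le_add (hC i) (hD i))

theorem sumValue_raisedFloorSum {β : ℝ} (hβ : 1 < β) (γ : ℝ) :
    sumValue β (raisedFloorSum γ) = lowerValue β γ 0 + 1 / β := by
  have h := sumValue_sub hβ (bddIncrements_raisedFloorSum γ) (bddIncrements_floorSum γ 0)
  have e : (fun n => raisedFloorSum γ n - floorSum γ 0 n) = fun n => if n = 0 then 0 else 1 := by
    funext n; rw [raisedFloorSum, add_sub_cancel_left]
  rw [e, sumValue_indicator] at h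
  rw [lowerValue]
  linarith

/-- For 0 < j < q the upper sums are the lower ones plus one; at q the two agree, but raising the
last digit restores the surplus. So 𝕃(s)⁺ s^∞ is s^∞ with its first digit raised. The test `i + 1 =
0` keeps the form of a difference of partial sums. -/
theorem prependWord_christoffel {p q : ℕ} (hq : 0 < q) (hpq : Nat.Coprime p q)
    (i : ℕ) : prependWord (wordPlus (upperChristoffel p q)) (periodicSeq (christoffel p q)) i =
      ((i + 1) * p / q + if i + 1 = 0 then 0 else 1) - (i * p / q + if i = 0 then 0 else 1) := by
  set U := upperChristoffel p q with hU
  have hlU : U.length = q := length_upperChristoffel p q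
  have hlen : (wordPlus U).length = q := by
    rw [wordPlus, List.length_append, List.length_dropLast, hlU, List.length_singleton]; omega
  have hdrop : ∀ j < q - 1, U.dropLast.getD j 0 = U.getD j 0 := fun j hj => by
    rw [List.getD_eq_getElem?_getD, List.getElem?_dropLast, if_pos (by rwa [hlU]),
      List.getD_eq_getElem?_getD]
  have hzero : (q - 1) / q = 0 := Nat.div_eq_of_lt (by omega)
  rw [prependWord, hlen]
  simp only [Nat.add_eq_zero_iff, one_ne_zero, and_false, if_false]
  split_ifs with h1 h2 h2
  · subst h2
    rw [wordPlus]
    rcases Nat.lt_or_ge 1 q with hq1 | hq1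
    · rw [List.getD_append _ _ _ _ (by rw [List.length_dropLast, hlU]; omega)]
      have := getD_upperChristoffel p hq
      rw [← hU] at this
      rw [hdrop 0 (by omega), this, zero_add, add_sub_one_div hpq (by omega) hq1]
      simp [hzero]
    · obtain rfl : q = 1 := by omega
      simp [hU, upperChristoffel]
  · have hd := getD_upperChristoffel p h1
    rw [← hU, add_sub_one_div hpq (Nat.pos_of_ne_zero h2) h1] at hd
    rcases Nat.lt_or_ge (i + 1) q with hlast | hlast
    · rw [wordPlus, List.getD_append _ _ _ _ (by rw [List.length_dropLast, hlU]; omega)]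
      rw [hdrop i (by omega), hd, add_sub_one_div hpq (by omega) hlast]
    · obtain rfl : q = i + 1 := by omega
      rw [wordPlus, List.getD_append_right _ _ _ _ (by rw [List.length_dropLast, hlU]; omega)]
      have e : U.getLastD 0 = U.getD i 0 := by
        rw [List.getLastD_eq_getLast?, List.getLast?_eq_getElem?, hlU,
          List.getD_eq_getElem?_getD]
        rfl
      rw [e, hd, List.length_dropLast, hlU, Nat.add_sub_cancel, Nat.sub_self,
        List.getD_cons_zero]
      have h3 : ((i + 1) * p + i) / (i + 1) = p := by
        rw [Nat.mul_add_div (by omega), Nat.div_eq_of_lt (by omega), add_zero]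
      have h4 : (i + 1) * p / (i + 1) = p := Nat.mul_div_cancel_left p (by omega)
      have h5 : i * p / (i + 1) + 1 ≤ p := by
        rw [Nat.add_one_le_iff, Nat.div_lt_iff_lt_mul (by omega)]
        have : 0 < p := Nat.pos_of_ne_zero fun h => by
          rw [h, Nat.coprime_zero_left] at hpq; omega
        nlinarith
      rw [h3, h4]
      omega
  · omega
  · rw [periodicSeq_christoffel p hq, Nat.add_sub_add_right]
    obtain ⟨j, rfl⟩ : ∃ j, i = j + q := ⟨i - q, by omega⟩
    have e1 : (j + q + 1) * p = (j + 1) * p + q * p := by ring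
    have e2 : (j + q) * p = j * p + q * p := by ring
    rw [e1, e2, Nat.add_mul_div_left _ _ hq, Nat.add_mul_div_left _ _ hq, Nat.add_sub_cancel,
      Nat.add_sub_add_right]

theorem baseValue_prependWord_christoffel {β : ℝ} (hβ : 1 < β) {p q : ℕ} (hq : 0 < q)
    (hpq : Nat.Coprime p q) :
    baseValue β (prependWord (wordPlus (upperChristoffel p q)) (periodicSeq (christoffel p q))) =
      lowerValue β (p / q) 0 + 1 / β := by
  have hS : Monotone fun n => n * p / q + if n = 0 then 0 else 1 := by
    refine (mul_div_monotone p q 0).add fun m n h => ?_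
    split_ifs <;> omega
  rw [baseValue_eq_sumValue β hS (prependWord_christoffel hq hpq), ← sumValue_raisedFloorSum hβ]
  congr 1
  funext n
  rw [raisedFloorSum, floorSum_zero_right, floor_mul_div]
  push_cast
  rfl

theorem isLeftEnd_christoffel {β : ℝ} {p q : ℕ} (hq : 0 < q) (hpq : Nat.Coprime p q) :
    IsLeftEnd (christoffel p q) β ↔ 1 < β ∧ upperValue β (p / q) 0 = 1 := by
  rw [IsLeftEnd, largestRotation_christoffel hq hpq, baseValue_periodicSeq_upperChristoffel β p hq]

theorem isRightEnd_christoffel {β : ℝ} {p q : ℕ} (hq : 0 < q) (hpq : Nat.Coprime p q) :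
    IsRightEnd (christoffel p q) β ↔ 1 < β ∧ lowerValue β (p / q) 0 + 1 / β = 1 := by
  rw [IsRightEnd, largestRotation_christoffel hq hpq]
  exact and_congr_right fun hβ => by rw [baseValue_prependWord_christoffel hβ hq hpq]

/-! ### The Farey intervals -/

/-- For fixed digits the value strictly decreases in the base, so lying between the two ends is a
pair of inequalities at β itself. -/
theorem mem_fareyInterval_christoffel {β : ℝ} (hβ : 1 < β) {p q : ℕ} (hp : 0 < p) (hq : 0 < q)
    (hpq : Nat.Coprime p q) : β ∈ fareyInterval (christoffel p q) ↔
      upperValue β (p / q) 0 ≤ 1 ∧ 1 ≤ lowerValue β (p / q) 0 + 1 / β := by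
  set γ : ℝ := p / q with hγ
  have hγ0 : 0 < γ := by positivity
  constructor
  · rintro ⟨a, b, ha, hb, hab, hβb⟩
    rw [isLeftEnd_christoffel hq hpq] at ha
    rw [isRightEnd_christoffel hq hpq] at hb
    constructor
    · rw [← ha.2]
      exact sumValue_antitone_base ha.1 hab (ceilSum_monotone hγ0.le 0) (bddIncrements_ceilSum _ 0)
    · rw [← hγ, ← sumValue_raisedFloorSum hb.1] at hb
      rw [← sumValue_raisedFloorSum hβ, ← hb.2]
      exact sumValue_antitone_base hβ hβb (raisedFloorSum_monotone hγ0.le)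
        (bddIncrements_raisedFloorSum γ)
  · rintro ⟨hV, hW⟩
    obtain ⟨a, ha1, ha⟩ := exists_base_upperValue hγ0
    obtain ⟨n, hn0, hn⟩ := exists_two_le_mul hγ0
    obtain ⟨b, hb1, hb⟩ := exists_base (raisedFloorSum_monotone hγ0.le)
      (bddIncrements_raisedFloorSum γ) (raisedFloorSum_zero γ) (n := n) (by
        have h : (2 : ℤ) ≤ ⌊(n : ℝ) * γ⌋ := Int.le_floor.2 (by exact_mod_cast hn)
        rw [raisedFloorSum, floorSum_zero_right, if_neg hn0]
        omega)
    refine ⟨a, b, (isLeftEnd_christoffel hq hpq).2 ⟨ha1, ha⟩,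
      (isRightEnd_christoffel hq hpq).2 ⟨hb1, by rw [← sumValue_raisedFloorSum hb1, hb]⟩, ?_, ?_⟩
    · by_contra! h
      have h1 : ceilSum γ 0 0 < ceilSum γ 0 1 := by
        rw [ceilSum_zero, ceilSum_zero_right]
        exact Int.ceil_pos.2 (by simpa using hγ0)
      have := sumValue_lt_of_base_lt hβ h (ceilSum_monotone hγ0.le 0) (bddIncrements_ceilSum γ 0) h1
      rw [upperValue] at ha hV
      linarith
    · by_contra! h
      have := sumValue_lt_of_base_lt hb1 h (raisedFloorSum_monotone hγ0.le)
        (bddIncrements_raisedFloorSum γ) (raisedFloorSum_lt hγ0.le)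
      rw [hb, sumValue_raisedFloorSum hβ] at this
      linarith

theorem exists_coprime_of_floor_eq {γ : ℝ} (hγ : 0 < γ) {n : ℕ} (hn : n ≠ 0)
    (h : (⌊n * γ⌋ : ℝ) = n * γ) :
    ∃ p q : ℕ, 0 < p ∧ 0 < q ∧ Nat.Coprime p q ∧ γ = p / q := by
  have hn0 : (0 : ℝ) < n := by positivity
  have hr : γ = ((⌊n * γ⌋ / n : ℚ) : ℝ) := by
    push_cast
    rw [h]; field_simp
  set r : ℚ := ⌊n * γ⌋ / n
  have hr0 : 0 < r := by rw [hr] at hγ; exact_mod_cast hγ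
  have hnum : 0 < r.num := Rat.num_pos.2 hr0
  refine ⟨r.num.natAbs, r.den, Int.natAbs_pos.2 hnum.ne', r.pos, r.reduced, ?_⟩
  rw [hr, Nat.cast_natAbs, abs_of_pos hnum]
  exact Rat.cast_def r

/-- At an irrational slope the upper value equals its right limit, so no gap exists. -/
theorem exists_coprime_of_gap {β : ℝ} (hβ : 1 < β) {γ : ℝ} (hγ : 0 < γ)
    (hV : upperValue β γ 0 < 1) (hW : 1 ≤ lowerValue β γ 0 + 1 / β) :
    ∃ p q : ℕ, 0 < p ∧ 0 < q ∧ Nat.Coprime p q ∧ γ = p / q := by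
  by_contra hne
  have h := lowerValue_add_eq hβ (γ := γ) fun n hn he =>
    hne (exists_coprime_of_floor_eq hγ hn he)
  linarith

/-- A base outside all intervals has no rational gap, so the dichotomy supplies a slope. Conversely
a rational slope makes the base a left end, and for an irrational slope strict monotonicity in the
slope excludes every rational interval. -/
theorem exceptionalSetL_eq_rotationBases : exceptionalSetL = rotationBases := by
  ext β
  constructor
  · rintro (⟨hβ, hE⟩ | ⟨s, hs, hl⟩)
    · refine ⟨hβ, ?_⟩
      rcases slope_dichotomy hβ with h | ⟨γ, hγ, hV, hW⟩
      · exact h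
      · obtain ⟨p, q, hp, hq, hpq, rfl⟩ := exists_coprime_of_gap hβ hγ hV hW
        refine absurd ?_ hE
        exact mem_biUnion (mem_extendedFareyWords_iff.2 ⟨p, q, hp, hq, hpq, rfl⟩)
          ((mem_fareyInterval_christoffel hβ hp hq hpq).2 ⟨hV.le, hW⟩)
    · obtain ⟨p, q, hp, hq, hpq, rfl⟩ := mem_extendedFareyWords_iff.1 hs
      obtain ⟨hβ, hV⟩ := (isLeftEnd_christoffel hq hpq).1 hl
      exact ⟨hβ, _, by positivity, hV⟩
  · rintro ⟨hβ, γ, hγ, hV⟩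
    by_cases hrat : ∃ p q : ℕ, 0 < p ∧ 0 < q ∧ Nat.Coprime p q ∧ γ = p / q
    · obtain ⟨p, q, hp, hq, hpq, rfl⟩ := hrat
      exact Or.inr ⟨_, mem_extendedFareyWords_iff.2 ⟨p, q, hp, hq, hpq, rfl⟩,
        (isLeftEnd_christoffel hq hpq).2 ⟨hβ, hV⟩⟩
    · refine Or.inl ⟨hβ, fun hmem => ?_⟩
      obtain ⟨s, hs, hβs⟩ := mem_iUnion₂.1 hmem
      obtain ⟨p, q, hp, hq, hpq, rfl⟩ := mem_extendedFareyWords_iff.1 hs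
      obtain ⟨h1, h2⟩ := (mem_fareyInterval_christoffel hβ hp hq hpq).1 hβs
      rcases lt_trichotomy γ (p / q) with h | h | h
      · have := upperValue_strictMono hβ h
        simp only at this
        linarith
      · exact hrat ⟨p, q, hp, hq, hpq, h⟩
      · have := lowerValue_add_lt hβ h
        linarith

theorem isolatedPoints_minimalPoints_eq_empty_iff {β : ℝ} (hβ : 1 < β) :
    isolatedPoints (minimalPoints β) = ∅ ↔ β ∈ exceptionalSetL := by
  rw [exceptionalSetL_eq_rotationBases]
  constructor
  · intro h
    refine ⟨hβ, ?_⟩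
    rcases slope_dichotomy hβ with h1 | ⟨γ, hγ, hV, hW⟩
    · exact h1
    · obtain ⟨p, q, hp, hq, hpq, rfl⟩ := exists_coprime_of_gap hβ hγ hV hW
      exact absurd h (exists_isolatedPoint_of_gap hβ hp hq hpq hV hW).ne_empty
  · rintro ⟨-, γ, hγ, hV⟩
    exact isolatedPoints_eq_empty hβ hγ hV

end BetaBifurcation

theorem theorem2 :
    (∀ β : ℝ, 1 < β →
      BetaBifurcation.bifurcationSet β =
        {t : ℝ | t ∈ Ico (0 : ℝ) 1 ∧ ∀ n : ℕ, t ≤ (BetaBifurcation.betaMap β)^[n] t}) ∧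
    (∀ β : ℝ, 1 < β →
      volume (BetaBifurcation.bifurcationSet β) = 0 ∧
        dimH (BetaBifurcation.bifurcationSet β) = 1) ∧
    (∀ᵐ β : ℝ ∂volume, 1 < β → ∀ δ : ℝ, 0 < δ →
      (BetaBifurcation.isolatedPoints (BetaBifurcation.bifurcationSet β) ∩ Ioo 0 δ).Infinite ∧
        (BetaBifurcation.accumulationPoints
          (BetaBifurcation.bifurcationSet β) ∩ Ioo 0 δ).Infinite) ∧
    (¬ BetaBifurcation.exceptionalSetL.Countable ∧
      dimH BetaBifurcation.exceptionalSetL = 0 ∧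
      ∀ β : ℝ, 1 < β →
        (BetaBifurcation.isolatedPoints (BetaBifurcation.bifurcationSet β) = ∅ ↔
          β ∈ BetaBifurcation.exceptionalSetL)) := by
  refine ⟨fun β hβ => BetaBifurcation.bifurcationSet_eq_minimalPoints hβ, fun β hβ => ?_, ?_,
    ?_, ?_, fun β hβ => ?_⟩
  · rw [BetaBifurcation.bifurcationSet_eq_minimalPoints hβ]
    exact ⟨BetaBifurcation.volume_minimalPoints hβ, BetaBifurcation.dimH_minimalPoints hβ⟩
  · filter_upwards [BetaBifurcation.ae_infinite_isolatedPoints] with β h hβ δ hδ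
    rw [BetaBifurcation.bifurcationSet_eq_minimalPoints hβ]
    exact ⟨h hβ δ hδ, BetaBifurcation.infinite_accumulationPoints hβ hδ⟩
  · rw [BetaBifurcation.exceptionalSetL_eq_rotationBases]
    exact BetaBifurcation.not_countable_rotationBases
  · rw [BetaBifurcation.exceptionalSetL_eq_rotationBases]
    exact BetaBifurcation.dimH_rotationBases
  · rw [BetaBifurcation.bifurcationSet_eq_minimalPoints hβ]
    exact BetaBifurcation.isolatedPoints_minimalPoints_eq_empty_iff hβ
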